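/- Let $n\ge 1$. For measurable $g:\mathbb R^n\to\mathbb R^n$ let $g^*(\tau)=\sup\{y>0:|\{|g|>y\}|>\tau\}$, and let $L^{p,q}$ be the Lorentz space of measurable $g$ with $\|g\|^*_{L^{p,q}}<\infty$, where $\|g\|^*_{L^{p,q}}=\big(\tfrac qp\int_0^\infty[\tau^{1/p}g^*(\tau)]^q\tfrac{d\tau}\tau\big)^{1/q}$ for $p,q<\infty$ and $\|g\|^*_{L^{p,\infty}}=\sup_{\tau>0}\tau^{1/p}g^*(\tau)$ for $p\le\infty$. Write $\|g\|_{L^{\overline\infty}}=\sup_{x\in\mathbb R^n}|g(x)|$ (a true supremum), and let $L^{\overline\infty}$ be the space of measurable $g$ for which it is finite; functions in $L^{p,q}\cap L^{\overline\infty}$ are identified only if they agree everywhere. For $t>0$ let $$\Phi(t,x)=(4\pi t)^{-n/2}e^{-|x|^2/4t},\qquad \mathcal T_{ij}(t,x)=(2\pi)^{-n}\int_{\mathbb R^n}e^{\mathrm i x\cdot\xi-t|\xi|^2}\Big(\delta_{ij}-\frac{\xi_i\xi_j}{|\xi|^2}\Big)\,d\xi,$$ $$S_i[f](t,x)=\int_{\mathbb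 R^n}\Phi(t,x-y)f_i(y)\,dy,\qquad B_i[u,v](t,x)=\int_0^t\!\int_{\mathbb R^n}\sum_{j,k}\partial_k\mathcal T_{ij}(t-s,x-y)\,u_j(s,y)v_k(s,y)\,dy\,ds .$$ For $T\in(0,\infty]$, a *mild solution on $(0,T)$ with datum $f$* is a measurable $u:(0,T)\times\mathbb R^n\to\mathbb R^n$ with $u(t,x)=S[f](t,x)-B[u,u](t,x)$ for all $(t,x)\in(0,T)\times\mathbb R^n$, such that for some $\sigma>-1$ one has $\sup_{t\in(0,T')}t^{-\sigma/2}\|u(t)\|_{L^{\overline\infty}}<\infty$ for all $T'\in(0,T)$. **Theorem.** Let $p\in(1,\infty]$ and $q\in[1,\infty]$, with $q=\infty$ if $p=\infty$, and let $f\in L^{p,q}(\mathbb R^n)\cap\bigcup_{r\in(n,\infty]}L^{r,\infty}(\mathbb R^n)$. Let $T_*$ be the supremum of all $T\in(0,\infty]$ for which there is a mild solution on $(0,T)$ with datum $f$. Then $T_*\in(0,\infty]$, and there is exactly one mild solution $u_*$ on $(0,T_*)$ with datum $f$. Moreover: 1. $u_*(t)\in L^{p,q}\cap L^{\overline\infty}$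 for all $t\in(0,T_*)$, and $u_*:(0,T_*)\to L^{p,q}\cap L^{\overline\infty}$ is continuous, that is, $\|u_*(t)-u_*(t_0)\|^*_{L^{p,q}}\to0$ and $\|u_*(t)-u_*(t_0)\|_{L^{\overline\infty}}\to0$ as $t\to t_0$, for every $t_0\in(0,T_*)$. 2. For each $\alpha\in(0,1)$ the Hölder seminorm $[u_*(t)]_{C^\alpha(\mathbb R^n)}=\sup_{x\ne y}|u_*(t,x)-u_*(t,y)|/|x-y|^\alpha$ is locally bounded in $t\in(0,T_*)$. 3. If $q<\infty$, then $\|u_*(t)-f\|^*_{L^{p,q}}\to0$ as $t\to0^+$. -/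

import Mathlib

open MeasureTheory Set Filter Topology
open scoped ENNReal NNReal

namespace LorentzNS

/-- The Euclidean space `ℝⁿ`. -/
abbrev Rn (n : ℕ) : Type := EuclideanSpace ℝ (Fin n)

noncomputable section

variable {n : ℕ}

/-! ### Lorentz spaces -/

/-- The distribution function `λ_f(y) = |{x : |f(x)| > y}|`. -/
def distribFun (f : Rn n → Rn n) (y : ℝ) : ℝ≥0∞ :=
  volume {x : Rn n | y < ‖f x‖}

/-- The decreasing rearrangement `f^*(t) = sup {y ∈ (0,∞) : λ_f(y) > t}` for `t ∈ (0,∞)`, with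
values in `[0,∞]` (the supremum of the empty set is `0`). -/
def rearrangement (f : Rn n → Rn n) (t : ℝ) : ℝ≥0∞ :=
  ⨆ (y : ℝ) (_ : 0 < y ∧ ENNReal.ofReal t < distribFun f y), ENNReal.ofReal y

/-- The Lorentz quasinorm of `L^{p,q}(ℝⁿ)`, with values in `[0,∞]`:
`(q/p ∫₀^∞ [t^{1/p} f^*(t)]^q dt/t)^{1/q}` if `q < ∞`, and `sup_{t>0} t^{1/p} f^*(t)` if `q = ∞`.
It is only used for `p ∈ [1,∞]`, `q ∈ [1,∞]` with `p = ∞ → q = ∞`; for `p = ∞` the exponent `1/p`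
is `0`, as it should be. -/
def lorentzQuasinorm (p q : ℝ≥0∞) (f : Rn n → Rn n) : ℝ≥0∞ :=
  if q = ∞ then
    ⨆ (t : ℝ) (_ : 0 < t), ENNReal.ofReal t ^ (p.toReal)⁻¹ * rearrangement f t
  else
    (q / p * ∫⁻ t in Ioi (0 : ℝ),
      (ENNReal.ofReal t ^ (p.toReal)⁻¹ * rearrangement f t) ^ q.toReal / ENNReal.ofReal t)
        ^ (q.toReal)⁻¹

/-- `f` is (a representative of) an element of `L^{p,q}(ℝⁿ)`: Lebesgue measurable with finite
quasinorm. -/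
def MemLorentz (p q : ℝ≥0∞) (f : Rn n → Rn n) : Prop :=
  AEStronglyMeasurable f volume ∧ lorentzQuasinorm p q f < ∞

/-- The norm `sup_x |f(x)|` (a true supremum, not an essential one). -/
def supNorm (f : Rn n → Rn n) : ℝ≥0∞ := ⨆ x : Rn n, ‖f x‖ₑ

/-! ### The kernels and the integral operators -/

/-- The heat kernel `Φ(t,x) = (4πt)^{-n/2} exp(-|x|²/(4t))`. -/
def heatKernel (t : ℝ) (x : Rn n) : ℝ :=
  (4 * Real.pi * t) ^ (-(n : ℝ) / 2) * Real.exp (-‖x‖ ^ 2 / (4 * t))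

/-- The Oseen kernel
`𝒯_{ij}(t,x) = (2π)^{-n} ∫ exp(i x·ξ - t|ξ|²) (δ_{ij} - ξ_i ξ_j / |ξ|²) dξ`. The integral is
absolutely convergent for `t > 0`, and is real since the last factor is an even function of `ξ`. -/
def oseenKernel (i j : Fin n) (t : ℝ) (x : Rn n) : ℝ :=
  (((2 * Real.pi : ℝ) : ℂ)⁻¹ ^ n *
    ∫ ξ : Rn n,
      Complex.exp (Complex.I * ((inner ℝ x ξ : ℝ) : ℂ) - ((t * ‖ξ‖ ^ 2 : ℝ) : ℂ)) *
        (((if i = j then 1 else 0) - ξ i * ξ j / ‖ξ‖ ^ 2 : ℝ) : ℂ)).re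

/-- The spatial derivative `∇_k 𝒯_{ij}(t,x)`. -/
def gradOseenKernel (i j k : Fin n) (t : ℝ) (x : Rn n) : ℝ :=
  lineDeriv ℝ (oseenKernel i j t) x (EuclideanSpace.single k 1)

/-- The `i`-th component of the heat map, `S_i[f](t,x) = ∫ Φ(t,x-y) f_i(y) dy`. -/
def heatMap (f : Rn n → Rn n) (i : Fin n) (t : ℝ) (x : Rn n) : ℝ :=
  ∫ y : Rn n, heatKernel t (x - y) * f y i

/-- The `i`-th component of the bilinear operator,
`B_i[u,v](t,x) = ∫₀ᵗ ∫ ∇_k 𝒯_{ij}(t-s,x-y) u_j(s,y) v_k(s,y) dy ds`, summed over `j` and `k`. -/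
def bilinearOp (u v : ℝ → Rn n → Rn n) (i : Fin n) (t : ℝ) (x : Rn n) : ℝ :=
  ∫ s in (0 : ℝ)..t, ∫ y : Rn n,
    ∑ j : Fin n, ∑ k : Fin n, gradOseenKernel i j k (t - s) (x - y) * u s y j * v s y k

/-! ### Path spaces and solutions -/

/-- The time interval `(0,T)` for `T ∈ [0,∞]`. -/
def timeInterval (T : ℝ≥0∞) : Set ℝ := {t : ℝ | 0 < t ∧ ENNReal.ofReal t < T}

/-- Membership in the space of measurable `u` on `(0,T) × ℝⁿ` such that
`sup_{t ∈ (0,T)} t^{-σ/2} sup_x |u(t,x)| < ∞`. Only the values of `u` on `(0,T) × ℝⁿ` matter. -/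
def MemPath (σ : ℝ) (T : ℝ≥0∞) (u : ℝ → Rn n → Rn n) : Prop :=
  AEStronglyMeasurable (fun z : ℝ × Rn n => u z.1 z.2)
      (volume.restrict (timeInterval T ×ˢ (univ : Set (Rn n)))) ∧
    (⨆ t ∈ timeInterval T, ENNReal.ofReal (t ^ (-σ / 2)) * supNorm (u t)) < ∞

/-- Membership in the intersection of the previous spaces over all `T' ∈ (0,T)`. -/
def MemPathMinus (σ : ℝ) (T : ℝ≥0∞) (u : ℝ → Rn n → Rn n) : Prop :=
  ∀ T' : ℝ≥0∞, 0 < T' → T' < T → MemPath σ T' u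

/-- `u` belongs to the class `⋃_{σ > -1} ⋂_{T' < T}` of the above spaces and satisfies
`u = S[f] - B[u,u]` at every point of `(0,T) × ℝⁿ`. For `u` in this class and `f` in some
`L^{r,∞}(ℝⁿ)` with `r > n`, all the integrals converge absolutely at every such point. -/
def IsMildSolution (f : Rn n → Rn n) (T : ℝ≥0∞) (u : ℝ → Rn n → Rn n) : Prop :=
  (∃ σ : ℝ, -1 < σ ∧ MemPathMinus σ T u) ∧
    ∀ t ∈ timeInterval T, ∀ (x : Rn n) (i : Fin n),
      u t x i = heatMap f i t x - bilinearOp u u i t x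

/-- The maximal time `T_*[f] ∈ [0,∞]` of existence of a solution. -/
def maximalTime (f : Rn n → Rn n) : ℝ≥0∞ :=
  sSup {T : ℝ≥0∞ | 0 < T ∧ ∃ u : ℝ → Rn n → Rn n, IsMildSolution f T u}

end

end LorentzNS

open LorentzNS

namespace LorentzNS

noncomputable section

variable {n : ℕ}

/-! Each time slice is controlled by two quantities: the true supremum of |u(t)|, and the
K-functional K(g,τ), the supremum of ∫ φ|g| over weights 0 ≤ φ ≤ 1 of mass at most τ (`kFun`). K is
subadditive in g, and convolution with an integrable kernel J costs only the factor ‖J‖₁. Since τ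
g*(τ) ≤ K(g,τ) ≤ ∫₀^τ g*, Hardy's inequality, which is where p > 1 enters, shows that K(g,τ) ≤ c
K(f,τ) for all τ bounds the L^{p,q} quasinorm of g by c times a finite quantity depending on f
(`lorentzFun_kFun_ne_top`, `lorentzQuasinorm_le_of_kFun_le`). All Lorentz estimates thus reduce to
estimates at a fixed τ.

The assumption f ∈ L^{r,∞} with r > n gives K(f,τ) ≤ M τ^{1-1/r}, hence |S[f](t)| ≤ C t^{-a} with a
= n/(2r) < 1/2. The kernel ∂ₖ𝒯ᵢⱼ(t) is the integral over s > t of ∂ᵢ∂ⱼ∂ₖΦ(s) - δᵢⱼ ∂ₖΔΦ(s)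
(`gradOseenKernel_eq`), because e^{-t|ξ|²} = ∫ₜ^∞ |ξ|² e^{-s|ξ|²} ds and the factor |ξ|² clears the
denominator of the symbol. Its L¹ norm is therefore O(t^{-1/2}), and a Hölder bound of order γ in
time or 2γ in space costs a further t^{-γ}.

As a < 1/2, the singularities (t-s)^{-1/2} and s^{-2a} are integrable, and a Picard iteration in the
norm sup t^a ‖u(t)‖_∞ gives a local solution (`exists_picard_fixed`). The singular Gronwall lemma
`volterra_gronwall` is used twice: on ‖u(t)-v(t)‖_∞ it gives uniqueness, and on t ↦ K(u(t),τ) it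
gives K(u(t),τ) ≤ L K(f,τ) with L independent of τ (`IsLocalSol.kFun_le`). A mild solution of any
admissible rate agrees near t = 0 with the Picard solution, so it has the rate t^{-a}
(`IsLocalSol.improve`); by uniqueness the solutions on shorter intervals glue to a maximal one.

Regularity follows by comparing kernels. Continuity in L^{p,q} comes from K(u(t)-u(t₀),τ) ≤ c(t)
K(f,τ) with c(t) → 0. The initial value, for q < ∞, comes from dominated convergence in τ, where
K(u(t)-f,τ) → 0 for each τ because translations are continuous at fixed τ. -/

/-! ### The K-functional -/

/-- Measurable weights with values in `[0,1]` and total mass at most `τ`. -/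
def massFns (n : ℕ) (τ : ℝ) : Set (Rn n → ℝ≥0∞) :=
  {φ | Measurable φ ∧ (∀ x, φ x ≤ 1) ∧ ∫⁻ x, φ x ≤ ENNReal.ofReal τ}

/-- The K-functional of the couple `(L¹, L^∞)`, in its dual form. -/
def kFun (g : Rn n → Rn n) (τ : ℝ) : ℝ≥0∞ := ⨆ φ ∈ massFns n τ, ∫⁻ x, φ x * ‖g x‖ₑ

theorem lintegral_le_kFun {φ : Rn n → ℝ≥0∞} {τ : ℝ} (hφ : φ ∈ massFns n τ) (g : Rn n → Rn n) :
    ∫⁻ x, φ x * ‖g x‖ₑ ≤ kFun g τ :=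
  le_iSup₂ (f := fun φ (_ : φ ∈ massFns n τ) => ∫⁻ x, φ x * ‖g x‖ₑ) φ hφ

theorem kFun_le_iff {g : Rn n → Rn n} {τ : ℝ} {c : ℝ≥0∞} :
    kFun g τ ≤ c ↔ ∀ φ ∈ massFns n τ, ∫⁻ x, φ x * ‖g x‖ₑ ≤ c := iSup₂_le_iff

theorem kFun_mono (g : Rn n → Rn n) : Monotone (kFun g) := by
  intro a b hab
  refine kFun_le_iff.2 fun φ hφ => lintegral_le_kFun ⟨hφ.1, hφ.2.1, hφ.2.2.trans ?_⟩ g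
  exact ENNReal.ofReal_le_ofReal hab

theorem kFun_le_of_bound {g : Rn n → Rn n} {τ : ℝ} {M : ℝ≥0∞} (hg : ∀ x, ‖g x‖ₑ ≤ M) :
    kFun g τ ≤ ENNReal.ofReal τ * M := by
  refine kFun_le_iff.2 fun φ hφ => ?_
  calc ∫⁻ x, φ x * ‖g x‖ₑ ≤ ∫⁻ x, φ x * M := lintegral_mono fun x => mul_le_mul_right (hg x) _
    _ = (∫⁻ x, φ x) * M := lintegral_mul_const _ hφ.1
    _ ≤ _ := mul_le_mul_left hφ.2.2 _

theorem kFun_le_lintegral {g : Rn n → Rn n} {τ : ℝ} : kFun g τ ≤ ∫⁻ x, ‖g x‖ₑ :=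
  kFun_le_iff.2 fun φ hφ => lintegral_mono fun x => by
    simpa using mul_le_mul_left (hφ.2.1 x) ‖g x‖ₑ

theorem kFun_add_le {g h : Rn n → Rn n} (hg : Measurable g) {τ : ℝ} :
    kFun (g + h) τ ≤ kFun g τ + kFun h τ := by
  refine kFun_le_iff.2 fun φ hφ => ?_
  calc ∫⁻ x, φ x * ‖(g + h) x‖ₑ ≤ ∫⁻ x, (φ x * ‖g x‖ₑ + φ x * ‖h x‖ₑ) :=
        lintegral_mono fun x => by
          rw [← mul_add]; exact mul_le_mul_right (enorm_add_le _ _) _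
    _ = (∫⁻ x, φ x * ‖g x‖ₑ) + ∫⁻ x, φ x * ‖h x‖ₑ := lintegral_add_left (hφ.1.mul hg.enorm) _
    _ ≤ _ := add_le_add (lintegral_le_kFun hφ g) (lintegral_le_kFun hφ h)

theorem kFun_neg (g : Rn n → Rn n) (τ : ℝ) : kFun (-g) τ = kFun g τ := by
  simp [kFun]

theorem kFun_sub_le {g h : Rn n → Rn n} (hg : Measurable g) {τ : ℝ} :
    kFun (g - h) τ ≤ kFun g τ + kFun h τ := by
  rw [sub_eq_add_neg, ← kFun_neg h]
  exact kFun_add_le hg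

/-- After division by M the kernel k is itself an admissible weight. This turns a sup bound and an
L¹ bound of a kernel into a pointwise bound of a convolution. -/
theorem lintegral_kernel_mul_le {k : Rn n → ℝ≥0∞} (hk : Measurable k) {M : ℝ≥0∞} {τ : ℝ}
    (hM0 : M ≠ 0) (hM : M ≠ ∞) (hkM : ∀ x, k x ≤ M) (hki : ∫⁻ x, k x ≤ M * ENNReal.ofReal τ)
    (g : Rn n → Rn n) : ∫⁻ x, k x * ‖g x‖ₑ ≤ M * kFun g τ := by
  have hφ : (fun x => M⁻¹ * k x) ∈ massFns n τ := by
    refine ⟨hk.const_mul _, fun x => ?_, ?_⟩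
    · calc M⁻¹ * k x ≤ M⁻¹ * M := mul_le_mul_right (hkM x) _
        _ = 1 := ENNReal.inv_mul_cancel hM0 hM
    · rw [lintegral_const_mul _ hk]
      calc M⁻¹ * ∫⁻ x, k x ≤ M⁻¹ * (M * ENNReal.ofReal τ) := mul_le_mul_right hki _
        _ = _ := by rw [← mul_assoc, ENNReal.inv_mul_cancel hM0 hM, one_mul]
  calc ∫⁻ x, k x * ‖g x‖ₑ = ∫⁻ x, M * (M⁻¹ * k x * ‖g x‖ₑ) := by
        refine lintegral_congr fun x => ?_
        rw [← mul_assoc, ← mul_assoc, ENNReal.mul_inv_cancel hM0 hM, one_mul]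
    _ = M * ∫⁻ x, M⁻¹ * k x * ‖g x‖ₑ := lintegral_const_mul' _ _ hM
    _ ≤ _ := mul_le_mul_right (lintegral_le_kFun hφ g) _

theorem lintegral_translate_le_kFun {φ : Rn n → ℝ≥0∞} {τ : ℝ} (hφ : φ ∈ massFns n τ)
    (g : Rn n → Rn n) (y : Rn n) : ∫⁻ x, φ x * ‖g (x - y)‖ₑ ≤ kFun g τ := by
  rw [← lintegral_add_right_eq_self _ y]
  simp only [add_sub_cancel_right]
  refine lintegral_le_kFun (φ := fun x => φ (x + y)) ⟨?_, fun x => hφ.2.1 _, ?_⟩ g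
  · exact hφ.1.comp (measurable_id.add_const y)
  · rw [lintegral_add_right_eq_self φ y]; exact hφ.2.2

theorem lintegral_conv_comm (J h : Rn n → ℝ≥0∞) (x : Rn n) :
    ∫⁻ y, J (x - y) * h y = ∫⁻ y, J y * h (x - y) := by
  rw [← lintegral_sub_left_eq_self (fun y => J (x - y) * h y) x]
  simp

/-- Minkowski's inequality: Tonelli moves the integral over the shift y outside, and shifting g by y
amounts to shifting φ, which stays admissible. -/
theorem lintegral_mul_conv_le {J : Rn n → ℝ≥0∞} (hJ : Measurable J) {g : Rn n → Rn n}
    (hg : Measurable g) {φ : Rn n → ℝ≥0∞} {τ : ℝ} (hφ : φ ∈ massFns n τ) :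
    ∫⁻ x, φ x * ∫⁻ y, J (x - y) * ‖g y‖ₑ ≤ (∫⁻ y, J y) * kFun g τ := by
  have hm : Measurable (Function.uncurry fun x y : Rn n => φ x * (J y * ‖g (x - y)‖ₑ)) :=
    (hφ.1.comp measurable_fst).mul ((hJ.comp measurable_snd).mul
      (hg.comp (measurable_fst.sub measurable_snd)).enorm)
  calc ∫⁻ x, φ x * ∫⁻ y, J (x - y) * ‖g y‖ₑ
      = ∫⁻ x, ∫⁻ y, φ x * (J y * ‖g (x - y)‖ₑ) := by
        refine lintegral_congr fun x => ?_
        rw [lintegral_conv_comm J (fun y => ‖g y‖ₑ), lintegral_const_mul]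
        exact hJ.mul (hg.comp (measurable_const.sub measurable_id)).enorm
    _ = ∫⁻ y, ∫⁻ x, φ x * (J y * ‖g (x - y)‖ₑ) := lintegral_lintegral_swap hm.aemeasurable
    _ ≤ ∫⁻ y, J y * kFun g τ := by
        refine lintegral_mono fun y => ?_
        calc ∫⁻ x, φ x * (J y * ‖g (x - y)‖ₑ) = ∫⁻ x, J y * (φ x * ‖g (x - y)‖ₑ) :=
              lintegral_congr fun x => mul_left_comm _ _ _
          _ = J y * ∫⁻ x, φ x * ‖g (x - y)‖ₑ := lintegral_const_mul _
              (hφ.1.mul (hg.comp (measurable_id.sub_const y)).enorm)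
          _ ≤ _ := mul_le_mul_right (lintegral_translate_le_kFun hφ g y) _
    _ = _ := lintegral_mul_const _ hJ

theorem kFun_conv_le {J : Rn n → ℝ≥0∞} (hJ : Measurable J) {g W : Rn n → Rn n}
    (hg : Measurable g) (hW : ∀ x, ‖W x‖ₑ ≤ ∫⁻ y, J (x - y) * ‖g y‖ₑ) (τ : ℝ) :
    kFun W τ ≤ (∫⁻ y, J y) * kFun g τ :=
  kFun_le_iff.2 fun _ hφ =>
    (lintegral_mono fun x => mul_le_mul_right (hW x) _).trans (lintegral_mul_conv_le hJ hg hφ)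

/-! ### Comparison with the decreasing rearrangement -/

theorem distribFun_anti (f : Rn n → Rn n) : Antitone (distribFun f) := fun _ _ h =>
  measure_mono fun _ hx => lt_of_le_of_lt h hx

theorem rearrangement_anti (f : Rn n → Rn n) : Antitone (rearrangement f) := by
  intro s t h
  refine iSup₂_le fun y hy => ?_
  exact le_iSup₂ (f := fun (y : ℝ) (_ : 0 < y ∧ ENNReal.ofReal s < distribFun f y) =>
    ENNReal.ofReal y) y ⟨hy.1, lt_of_le_of_lt (ENNReal.ofReal_le_ofReal h) hy.2⟩

theorem measurable_rearrangement (f : Rn n → Rn n) : Measurable (rearrangement f) :=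
  (rearrangement_anti f).measurable

theorem le_rearrangement {f : Rn n → Rn n} {y t : ℝ} (hy : 0 < y)
    (h : ENNReal.ofReal t < distribFun f y) : ENNReal.ofReal y ≤ rearrangement f t :=
  le_iSup₂ (f := fun (y : ℝ) (_ : 0 < y ∧ ENNReal.ofReal t < distribFun f y) =>
    ENNReal.ofReal y) y ⟨hy, h⟩

theorem measurableSet_lt_norm {f : Rn n → Rn n} (hf : Measurable f) (y : ℝ) :
    MeasurableSet {x | y < ‖f x‖} := measurableSet_lt measurable_const hf.norm

/-- For y below f*(τ) the set where |f| > y has measure above τ; spreading the mass τ uniformly over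
part of it gives a competitor in the supremum. -/
theorem mul_rearrangement_le_kFun {f : Rn n → Rn n} (hf : Measurable f) (τ : ℝ) :
    ENNReal.ofReal τ * rearrangement f τ ≤ kFun f τ := by
  rw [rearrangement, ENNReal.mul_iSup]
  refine iSup_le fun y => ?_
  rw [ENNReal.mul_iSup]
  refine iSup_le fun hy => ?_
  -- The level set may have infinite measure, so a part E of finite measure still exceeding τ is
  -- used; then c = τ/|E| ≤ 1.
  obtain ⟨E, hE, hEs, hlt, hfin⟩ := Measure.exists_subset_measure_lt_top
    (measurableSet_lt_norm hf y) hy.2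
  have hE0 : volume E ≠ 0 := (lt_of_le_of_lt bot_le hlt).ne'
  set c : ℝ≥0∞ := ENNReal.ofReal τ / volume E with hc
  have hcE : c * volume E = ENNReal.ofReal τ := ENNReal.div_mul_cancel hE0 hfin.ne
  have hφ : (E.indicator fun _ => c) ∈ massFns n τ := by
    refine ⟨measurable_const.indicator hE, fun x => ?_, ?_⟩
    · refine indicator_apply_le' (fun _ => ?_) (fun _ => zero_le_one)
      exact ENNReal.div_le_of_le_mul (by simpa using hlt.le)
    · rw [lintegral_indicator_const hE, hcE]
  refine le_trans ?_ (lintegral_le_kFun hφ f)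
  calc ENNReal.ofReal τ * ENNReal.ofReal y
      = ∫⁻ x, E.indicator (fun _ => c * ENNReal.ofReal y) x := by
        rw [lintegral_indicator_const hE, mul_right_comm, hcE]
    _ ≤ _ := by
        refine lintegral_mono fun x => ?_
        by_cases hx : x ∈ E
        · simp only [indicator_of_mem hx]
          refine mul_le_mul_right ?_ _
          rw [← ofReal_norm]
          exact ENNReal.ofReal_le_ofReal (hEs hx).le
        · simp [indicator_of_notMem hx]

/-- Both sides are compared with the area of the region s < λ(y) in 0 < s < τ, y > 0: the slices at
fixed y contain (0, min(τ, λ(y))), and those at fixed s lie in (0, f*(s)]. -/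
theorem lintegral_min_distribFun_le (f : Rn n → Rn n) (τ : ℝ) :
    ∫⁻ y in Ioi (0 : ℝ), min (ENNReal.ofReal τ) (distribFun f y)
      ≤ ∫⁻ s in Ioo 0 τ, rearrangement f s := by
  have hd : Measurable (distribFun f) := (distribFun_anti f).measurable
  have hset : MeasurableSet {z : ℝ × ℝ | ENNReal.ofReal z.1 < distribFun f z.2} :=
    measurableSet_lt (ENNReal.measurable_ofReal.comp measurable_fst) (hd.comp measurable_snd)
  have hmeas : Measurable (Function.uncurry fun (y s : ℝ) =>
      {z : ℝ × ℝ | ENNReal.ofReal z.1 < distribFun f z.2}.indicator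
        (fun _ => (1 : ℝ≥0∞)) (s, y)) :=
    (measurable_const.indicator hset).comp measurable_swap
  calc ∫⁻ y in Ioi (0 : ℝ), min (ENNReal.ofReal τ) (distribFun f y)
      ≤ ∫⁻ y in Ioi (0 : ℝ), ∫⁻ s in Ioo 0 τ,
          {z : ℝ × ℝ | ENNReal.ofReal z.1 < distribFun f z.2}.indicator
            (fun _ => (1 : ℝ≥0∞)) (s, y) := by
        refine lintegral_mono fun y => ?_
        have : ∀ s, {z : ℝ × ℝ | ENNReal.ofReal z.1 < distribFun f z.2}.indicator
            (fun _ => (1 : ℝ≥0∞)) (s, y)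
            = {s : ℝ | ENNReal.ofReal s < distribFun f y}.indicator (fun _ => 1) s := fun s => rfl
        simp only [this]
        have hS : MeasurableSet {s : ℝ | ENNReal.ofReal s < distribFun f y} :=
          measurableSet_lt ENNReal.measurable_ofReal measurable_const
        rw [lintegral_indicator_const hS, one_mul, Measure.restrict_apply hS]
        rcases eq_or_ne (distribFun f y) ∞ with h | h
        · simp [h]
        · have hsub : Ioo 0 (min τ (distribFun f y).toReal) ⊆
              {s : ℝ | ENNReal.ofReal s < distribFun f y} ∩ Ioo 0 τ := by
            intro s hs
            have h2 := lt_min_iff.1 hs.2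
            exact ⟨(ENNReal.ofReal_lt_iff_lt_toReal hs.1.le h).2 h2.2, hs.1, h2.1⟩
          refine le_trans ?_ (measure_mono hsub)
          rw [Real.volume_Ioo, sub_zero, ENNReal.ofReal_min, ENNReal.ofReal_toReal h]
    _ = ∫⁻ s in Ioo 0 τ, ∫⁻ y in Ioi (0 : ℝ),
          {z : ℝ × ℝ | ENNReal.ofReal z.1 < distribFun f z.2}.indicator
            (fun _ => (1 : ℝ≥0∞)) (s, y) := lintegral_lintegral_swap hmeas.aemeasurable
    _ ≤ _ := by
        refine lintegral_mono fun s => ?_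
        have : ∀ y, {z : ℝ × ℝ | ENNReal.ofReal z.1 < distribFun f z.2}.indicator
            (fun _ => (1 : ℝ≥0∞)) (s, y)
            = {y : ℝ | ENNReal.ofReal s < distribFun f y}.indicator (fun _ => 1) y := fun s => rfl
        simp only [this]
        have hS : MeasurableSet {y : ℝ | ENNReal.ofReal s < distribFun f y} :=
          measurableSet_lt measurable_const hd
        rw [lintegral_indicator_const hS, one_mul, Measure.restrict_apply hS]
        rcases eq_or_ne (rearrangement f s) ∞ with h | h
        · simp [h]
        · have hsub : {y : ℝ | ENNReal.ofReal s < distribFun f y} ∩ Ioi 0 ⊆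
              Ioc 0 (rearrangement f s).toReal := by
            intro y hy
            refine ⟨hy.2, ?_⟩
            exact (ENNReal.ofReal_le_iff_le_toReal h).1 (le_rearrangement hy.2 hy.1)
          refine (measure_mono hsub).trans ?_
          rw [Real.volume_Ioc, sub_zero, ENNReal.ofReal_toReal h]

/-- Layer-cake formula for the measure φ dx: the set where |f| > y has φ-mass at most τ and at most
λ(y). -/
theorem kFun_le_lintegral_rearrangement {f : Rn n → Rn n} (hf : Measurable f) (τ : ℝ) :
    kFun f τ ≤ ∫⁻ s in Ioo 0 τ, rearrangement f s := by
  refine kFun_le_iff.2 fun φ hφ => le_trans ?_ (lintegral_min_distribFun_le f τ)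
  have h1 : ∫⁻ x, φ x * ‖f x‖ₑ = ∫⁻ x, ENNReal.ofReal ‖f x‖ ∂(volume.withDensity φ) := by
    rw [lintegral_withDensity_eq_lintegral_mul _ hφ.1 hf.norm.ennreal_ofReal]
    simp
  rw [h1, lintegral_eq_lintegral_meas_lt _ (ae_of_all _ fun x => norm_nonneg _)
    hf.norm.aemeasurable]
  refine lintegral_mono fun y => ?_
  have hS := measurableSet_lt_norm hf y
  rw [withDensity_apply _ hS]
  refine le_min ((setLIntegral_le_lintegral _ _).trans hφ.2.2) ?_
  calc ∫⁻ x in {x | y < ‖f x‖}, φ x ≤ ∫⁻ x in {x | y < ‖f x‖}, 1 :=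
        lintegral_mono fun x => hφ.2.1 x
    _ = _ := by simp [distribFun]

/-! ### Hardy's inequality and the Lorentz functional -/

theorem lintegral_Ioo_rpow {b τ : ℝ} (hb : -1 < b) (hτ : 0 < τ) :
    ∫⁻ s in Ioo 0 τ, ENNReal.ofReal s ^ b = ENNReal.ofReal (τ ^ (b + 1) / (b + 1)) := by
  have hint : IntegrableOn (fun s : ℝ => s ^ b) (Ioo 0 τ) :=
    ((intervalIntegral.intervalIntegrable_rpow' hb (a := 0) (b := τ)).1).mono_set Ioo_subset_Ioc_self
  have hval : ∫ s in Ioo 0 τ, s ^ b = τ ^ (b + 1) / (b + 1) := by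
    rw [← integral_Ioc_eq_integral_Ioo, ← intervalIntegral.integral_of_le hτ.le,
      integral_rpow (Or.inl hb), Real.zero_rpow (by linarith), sub_zero]
  rw [← hval, ofReal_integral_eq_lintegral_ofReal hint]
  · refine setLIntegral_congr_fun measurableSet_Ioo fun s hs => ?_
    exact ENNReal.ofReal_rpow_of_pos hs.1
  · exact (ae_restrict_iff' measurableSet_Ioo).2 (ae_of_all _ fun s hs => Real.rpow_nonneg hs.1.le _)

theorem lintegral_Ioi_rpow {b s : ℝ} (hb : b < -1) (hs : 0 < s) :
    ∫⁻ t in Ioi s, ENNReal.ofReal t ^ b = ENNReal.ofReal (s ^ (b + 1) / (-(b + 1))) := by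
  have hint : IntegrableOn (fun s : ℝ => s ^ b) (Ioi s) := integrableOn_Ioi_rpow_of_lt hb hs
  have hval : ∫ t in Ioi s, t ^ b = s ^ (b + 1) / (-(b + 1)) := by
    rw [integral_Ioi_rpow_of_lt hb hs, div_neg, neg_div]
  rw [← hval, ofReal_integral_eq_lintegral_ofReal hint]
  · refine setLIntegral_congr_fun measurableSet_Ioi fun t ht => ?_
    exact ENNReal.ofReal_rpow_of_pos (hs.trans ht)
  · exact (ae_restrict_iff' measurableSet_Ioi).2
      (ae_of_all _ fun t ht => Real.rpow_nonneg (hs.trans ht).le _)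

/-- Jensen's inequality for a measure that need not have mass one. -/
theorem rpow_lintegral_le {α : Type*} [MeasurableSpace α] {ν : Measure α} {g : α → ℝ≥0∞}
    (hg : Measurable g) {Q : ℝ} (hQ : 1 ≤ Q) :
    (∫⁻ x, g x ∂ν) ^ Q ≤ (∫⁻ x, g x ^ Q ∂ν) * ν univ ^ (Q - 1) := by
  have h := eLpNorm'_le_eLpNorm'_mul_rpow_measure_univ (μ := ν) (f := g) one_pos hQ
    hg.aestronglyMeasurable
  simp only [eLpNorm', enorm_eq_self, ENNReal.rpow_one, one_div, inv_one] at h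
  have hQ0 : 0 < Q := by linarith
  calc (∫⁻ x, g x ∂ν) ^ Q
      ≤ ((∫⁻ x, g x ^ Q ∂ν) ^ Q⁻¹ * ν univ ^ (1 - Q⁻¹)) ^ Q := by gcongr
    _ = _ := by
        rw [ENNReal.mul_rpow_of_nonneg _ _ hQ0.le, ← ENNReal.rpow_mul, ← ENNReal.rpow_mul,
          inv_mul_cancel₀ hQ0.ne', ENNReal.rpow_one, sub_mul, inv_mul_cancel₀ hQ0.ne', one_mul]

/-- Jensen's inequality with respect to s^{-b} ds on (0,τ), whose mass is τ^{1-b}/(1-b). The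
exponent -b is integrable at 0 as b < 1, and it leaves the factor τ^{b-2}, integrable at infinity,
for the outer integral. -/
theorem hardy_pointwise {b Q : ℝ} (hb1 : b < 1) (hQ : 1 ≤ Q) {h : ℝ → ℝ≥0∞}
    (hh : Measurable h) {τ : ℝ} (hτ : 0 < τ) :
    (ENNReal.ofReal τ ^ b * ((∫⁻ s in Ioo 0 τ, h s) / ENNReal.ofReal τ)) ^ Q / ENNReal.ofReal τ
      ≤ ENNReal.ofReal (1 - b)⁻¹ ^ (Q - 1) * (ENNReal.ofReal τ ^ (b - 2) *
        ∫⁻ s in Ioo 0 τ, (ENNReal.ofReal s ^ b * h s) ^ Q * ENNReal.ofReal s ^ (-b)) := by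
  have hQ0 : 0 ≤ Q := by linarith
  set x := ENNReal.ofReal τ with hx
  have hx0 : x ≠ 0 := by simpa [hx] using hτ
  have hxt : x ≠ ∞ := ENNReal.ofReal_ne_top
  set ν := (volume.restrict (Ioo 0 τ)).withDensity (fun s : ℝ => ENNReal.ofReal s ^ (-b)) with hν
  have hdm : Measurable fun s : ℝ => ENNReal.ofReal s ^ (-b) :=
    ENNReal.measurable_ofReal.pow_const _
  have hgm : Measurable fun s : ℝ => ENNReal.ofReal s ^ b * h s :=
    (ENNReal.measurable_ofReal.pow_const _).mul hh
  have h1 : ∫⁻ s in Ioo 0 τ, h s = ∫⁻ s, ENNReal.ofReal s ^ b * h s ∂ν := by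
    rw [hν, lintegral_withDensity_eq_lintegral_mul _ hdm hgm]
    refine setLIntegral_congr_fun measurableSet_Ioo fun s hs => ?_
    have hs0 : ENNReal.ofReal s ≠ 0 := by simpa using hs.1
    simp only [Pi.mul_apply]
    rw [← mul_assoc, ← ENNReal.rpow_add _ _ hs0 ENNReal.ofReal_ne_top]
    simp
  have h2 : ν univ = x ^ (1 - b) * ENNReal.ofReal (1 - b)⁻¹ := by
    rw [hν, withDensity_apply _ MeasurableSet.univ, Measure.restrict_univ,
      lintegral_Ioo_rpow (by linarith) hτ, hx, ENNReal.ofReal_rpow_of_pos hτ,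
      ← ENNReal.ofReal_mul (Real.rpow_nonneg hτ.le _), div_eq_mul_inv]
    congr 3 <;> ring
  have h3 : ∫⁻ s, (ENNReal.ofReal s ^ b * h s) ^ Q ∂ν =
      ∫⁻ s in Ioo 0 τ, (ENNReal.ofReal s ^ b * h s) ^ Q * ENNReal.ofReal s ^ (-b) := by
    rw [hν, lintegral_withDensity_eq_lintegral_mul _ hdm (hgm.pow_const Q)]
    exact lintegral_congr fun s => mul_comm _ _
  have h4 := rpow_lintegral_le (ν := ν) hgm hQ
  rw [← h1, h2, h3] at h4
  set I := ∫⁻ s in Ioo 0 τ, h s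
  set G := ∫⁻ s in Ioo 0 τ, (ENNReal.ofReal s ^ b * h s) ^ Q * ENNReal.ofReal s ^ (-b)
  calc (x ^ b * (I / x)) ^ Q / x = x ^ (b * Q - Q - 1) * I ^ Q := by
        rw [div_eq_mul_inv, div_eq_mul_inv, ENNReal.mul_rpow_of_nonneg _ _ hQ0,
          ENNReal.mul_rpow_of_nonneg _ _ hQ0, ← ENNReal.rpow_neg_one x, ← ENNReal.rpow_mul,
          ← ENNReal.rpow_mul, sub_eq_add_neg, sub_eq_add_neg, ENNReal.rpow_add _ _ hx0 hxt,
          ENNReal.rpow_add _ _ hx0 hxt, neg_one_mul]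
        ring
    _ ≤ x ^ (b * Q - Q - 1) * (G * (x ^ (1 - b) * ENNReal.ofReal (1 - b)⁻¹) ^ (Q - 1)) :=
        mul_le_mul_right h4 _
    _ = ENNReal.ofReal (1 - b)⁻¹ ^ (Q - 1) *
        ((x ^ (b * Q - Q - 1) * x ^ ((1 - b) * (Q - 1))) * G) := by
        rw [ENNReal.mul_rpow_of_nonneg _ _ (by linarith), ← ENNReal.rpow_mul]
        ring
    _ = _ := by
        rw [← ENNReal.rpow_add _ _ hx0 hxt,
          show b * Q - Q - 1 + (1 - b) * (Q - 1) = b - 2 by ring]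

/-- Tonelli applied to the pointwise bound leaves ∫ₛ^∞ τ^{b-2} dτ = s^{b-1}/(1-b). This factor
1/(1-b) joins the power Q-1 already present, whence the exponent Q. -/
theorem hardy_inequality {b Q : ℝ} (hb1 : b < 1) (hQ : 1 ≤ Q) {h : ℝ → ℝ≥0∞}
    (hh : Measurable h) :
    ∫⁻ τ in Ioi (0 : ℝ), (ENNReal.ofReal τ ^ b *
        ((∫⁻ s in Ioo 0 τ, h s) / ENNReal.ofReal τ)) ^ Q / ENNReal.ofReal τ
      ≤ ENNReal.ofReal (1 - b)⁻¹ ^ Q *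
        ∫⁻ s in Ioi (0 : ℝ), (ENNReal.ofReal s ^ b * h s) ^ Q / ENNReal.ofReal s := by
  have hc0 : ENNReal.ofReal (1 - b)⁻¹ ≠ 0 := by
    simpa using hb1
  set c := ENNReal.ofReal (1 - b)⁻¹ with hc
  have hct : c ≠ ∞ := ENNReal.ofReal_ne_top
  set G : ℝ → ℝ≥0∞ := fun s => (ENNReal.ofReal s ^ b * h s) ^ Q * ENNReal.ofReal s ^ (-b) with hG
  have hGm : Measurable G :=
    (((ENNReal.measurable_ofReal.pow_const _).mul hh).pow_const _).mul
      (ENNReal.measurable_ofReal.pow_const _)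
  have hm : Measurable (Function.uncurry fun (τ s : ℝ) =>
      ENNReal.ofReal τ ^ (b - 2) * {z : ℝ × ℝ | z.1 < z.2}.indicator (fun z => G z.1) (s, τ)) := by
    refine ((ENNReal.measurable_ofReal.comp measurable_fst).pow_const _).mul ?_
    exact ((hGm.comp measurable_fst).indicator
      (measurableSet_lt measurable_fst measurable_snd)).comp measurable_swap
  calc _ ≤ ∫⁻ τ in Ioi (0 : ℝ), c ^ (Q - 1) * (ENNReal.ofReal τ ^ (b - 2) *
        ∫⁻ s in Ioo 0 τ, G s) := setLIntegral_mono' measurableSet_Ioi fun τ hτ =>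
          hardy_pointwise hb1 hQ hh hτ
    _ = c ^ (Q - 1) * ∫⁻ τ in Ioi (0 : ℝ), ∫⁻ s in Ioi (0 : ℝ), (ENNReal.ofReal τ ^ (b - 2) *
        {z : ℝ × ℝ | z.1 < z.2}.indicator (fun z => G z.1) (s, τ)) := by
        rw [lintegral_const_mul' _ _ (ENNReal.rpow_ne_top_of_nonneg (by linarith) hct)]
        congr 1
        refine setLIntegral_congr_fun measurableSet_Ioi fun τ (hτ : 0 < τ) => ?_
        have hτ0 : ENNReal.ofReal τ ≠ 0 := by simpa using hτ
        rw [lintegral_const_mul' _ _ (ENNReal.rpow_ne_top_of_ne_zero hτ0 ENNReal.ofReal_ne_top)]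
        congr 1
        have : ∀ s, {z : ℝ × ℝ | z.1 < z.2}.indicator (fun z => G z.1) (s, τ)
            = (Iio τ).indicator G s := fun s => rfl
        simp only [this]
        rw [setLIntegral_indicator measurableSet_Iio, inter_comm, Ioi_inter_Iio]
    _ = c ^ (Q - 1) * ∫⁻ s in Ioi (0 : ℝ), ∫⁻ τ in Ioi (0 : ℝ), (ENNReal.ofReal τ ^ (b - 2) *
        {z : ℝ × ℝ | z.1 < z.2}.indicator (fun z => G z.1) (s, τ)) := by
        rw [lintegral_lintegral_swap hm.aemeasurable]
    _ = c ^ (Q - 1) * ∫⁻ s in Ioi (0 : ℝ),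
          c * ((ENNReal.ofReal s ^ b * h s) ^ Q / ENNReal.ofReal s) := by
        congr 1
        refine setLIntegral_congr_fun measurableSet_Ioi fun s (hs : 0 < s) => ?_
        have hs0 : ENNReal.ofReal s ≠ 0 := by simpa using hs
        have : ∀ τ, ENNReal.ofReal τ ^ (b - 2) *
            {z : ℝ × ℝ | z.1 < z.2}.indicator (fun z => G z.1) (s, τ)
            = (Ioi s).indicator (fun τ => ENNReal.ofReal τ ^ (b - 2) * G s) τ := by
          intro τ
          by_cases hτ : s < τ
          · rw [indicator_of_mem (show τ ∈ Ioi s from hτ),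
              indicator_of_mem (show (s, τ) ∈ {z : ℝ × ℝ | z.1 < z.2} from hτ)]
          · rw [indicator_of_notMem (show τ ∉ Ioi s from hτ),
              indicator_of_notMem (show (s, τ) ∉ {z : ℝ × ℝ | z.1 < z.2} from hτ), mul_zero]
        simp only [this]
        rw [setLIntegral_indicator measurableSet_Ioi,
          inter_eq_left.2 (Ioi_subset_Ioi hs.le),
          lintegral_mul_const _ (ENNReal.measurable_ofReal.pow_const _),
          lintegral_Ioi_rpow (by linarith) hs, hG, hc, div_eq_mul_inv, div_eq_mul_inv,
          ENNReal.ofReal_mul (Real.rpow_nonneg hs.le _), ← ENNReal.ofReal_rpow_of_pos hs,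
          show -(b - 2 + 1) = 1 - b by ring]
        simp only
        rw [← ENNReal.rpow_neg_one (ENNReal.ofReal s),
          show (-1 : ℝ) = (b - 2 + 1) + (-b) by ring,
          ENNReal.rpow_add (b - 2 + 1) (-b) hs0 ENNReal.ofReal_ne_top]
        ring
    _ = _ := by
        rw [lintegral_const_mul' _ _ hct, ← mul_assoc]
        congr 1
        nth_rewrite 2 [← ENNReal.rpow_one c]
        rw [← ENNReal.rpow_add _ _ hc0 hct]
        simp

/-- The Lorentz functional applied to a function of the measure variable, so that the Lorentz
quasinorm is its value at the decreasing rearrangement. -/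
def lorentzFun (p q : ℝ≥0∞) (h : ℝ → ℝ≥0∞) : ℝ≥0∞ :=
  if q = ∞ then
    ⨆ (t : ℝ) (_ : 0 < t), ENNReal.ofReal t ^ (p.toReal)⁻¹ * h t
  else
    (q / p * ∫⁻ t in Ioi (0 : ℝ),
      (ENNReal.ofReal t ^ (p.toReal)⁻¹ * h t) ^ q.toReal / ENNReal.ofReal t)
        ^ (q.toReal)⁻¹

theorem lorentzQuasinorm_eq (p q : ℝ≥0∞) (f : Rn n → Rn n) :
    lorentzQuasinorm p q f = lorentzFun p q (rearrangement f) := rfl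

theorem lorentzFun_mono {p q : ℝ≥0∞} {h h' : ℝ → ℝ≥0∞} (hh : ∀ t, 0 < t → h t ≤ h' t) :
    lorentzFun p q h ≤ lorentzFun p q h' := by
  unfold lorentzFun
  split_ifs
  · exact iSup₂_mono fun t ht => mul_le_mul_right (hh t ht) _
  · refine ENNReal.rpow_le_rpow (mul_le_mul_right ?_ _) (by positivity)
    refine setLIntegral_mono' measurableSet_Ioi fun t ht => ?_
    refine ENNReal.div_le_div_right (ENNReal.rpow_le_rpow ?_ ENNReal.toReal_nonneg) _
    exact mul_le_mul_right (hh t ht) _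

theorem lorentzFun_const_mul {p q : ℝ≥0∞} (hq : 1 ≤ q) {c : ℝ≥0∞} (hc : c ≠ ∞)
    (h : ℝ → ℝ≥0∞) : lorentzFun p q (fun t => c * h t) = c * lorentzFun p q h := by
  unfold lorentzFun
  split_ifs with hqt
  · simp_rw [ENNReal.mul_iSup, mul_left_comm]
  · have hq0 : 0 < q.toReal := ENNReal.toReal_pos (by positivity) hqt
    have : ∀ t : ℝ, (ENNReal.ofReal t ^ p.toReal⁻¹ * (c * h t)) ^ q.toReal / ENNReal.ofReal t
        = c ^ q.toReal * ((ENNReal.ofReal t ^ p.toReal⁻¹ * h t) ^ q.toReal / ENNReal.ofReal t) := by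
      intro t
      rw [mul_left_comm, ENNReal.mul_rpow_of_nonneg _ _ hq0.le, mul_div_assoc]
    simp_rw [this]
    rw [lintegral_const_mul' _ _ (ENNReal.rpow_ne_top_of_nonneg hq0.le hc), mul_left_comm,
      ENNReal.mul_rpow_of_nonneg _ _ (by positivity), ← ENNReal.rpow_mul,
      mul_inv_cancel₀ hq0.ne', ENNReal.rpow_one]

theorem inv_toReal_lt_one {p : ℝ≥0∞} (hp : 1 < p) : p.toReal⁻¹ < 1 := by
  rcases eq_or_ne p ∞ with h | h
  · simp [h]
  · have : 1 < p.toReal := by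
      have := (ENNReal.toReal_lt_toReal ENNReal.one_ne_top h).2 hp
      simpa using this
    exact inv_lt_one_of_one_lt₀ this

/-- For q = ∞ it suffices to integrate h(s) ≤ N s^{-1/p}, which is integrable at 0 because p > 1;
the other case is Hardy's inequality with b = 1/p. -/
theorem lorentzFun_hardy {p q : ℝ≥0∞} (hp : 1 < p) (hq : 1 ≤ q) {h : ℝ → ℝ≥0∞}
    (hh : Measurable h) :
    lorentzFun p q (fun τ => (∫⁻ s in Ioo 0 τ, h s) / ENNReal.ofReal τ) ≤
      ENNReal.ofReal (1 - p.toReal⁻¹)⁻¹ * lorentzFun p q h := by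
  have hb1 := inv_toReal_lt_one hp
  unfold lorentzFun
  split_ifs with hqt
  · set N := ⨆ (t : ℝ) (_ : 0 < t), ENNReal.ofReal t ^ (p.toReal)⁻¹ * h t with hN
    refine iSup₂_le fun t ht => ?_
    have hle : ∀ s : ℝ, 0 < s → h s ≤ N * ENNReal.ofReal s ^ (-p.toReal⁻¹) := by
      intro s hs
      have hs0 : ENNReal.ofReal s ≠ 0 := by simpa using hs
      have h1 : ENNReal.ofReal s ^ (p.toReal)⁻¹ * h s ≤ N :=
        le_iSup₂ (f := fun (t : ℝ) (_ : 0 < t) => ENNReal.ofReal t ^ (p.toReal)⁻¹ * h t) s hs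
      calc h s = ENNReal.ofReal s ^ (p.toReal)⁻¹ * h s * ENNReal.ofReal s ^ (-p.toReal⁻¹) := by
            rw [mul_right_comm, ← ENNReal.rpow_add _ _ hs0 ENNReal.ofReal_ne_top]; simp
        _ ≤ _ := mul_le_mul_left h1 _
    have ht0 : ENNReal.ofReal t ≠ 0 := by simpa using ht
    have h2 : ∫⁻ s in Ioo 0 t, h s ≤
        N * (ENNReal.ofReal t ^ (-p.toReal⁻¹ + 1) * ENNReal.ofReal (1 - p.toReal⁻¹)⁻¹) := by
      calc ∫⁻ s in Ioo 0 t, h s ≤ ∫⁻ s in Ioo 0 t, N * ENNReal.ofReal s ^ (-p.toReal⁻¹) :=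
            setLIntegral_mono' measurableSet_Ioo fun s hs => hle s hs.1
        _ = _ := by
            rw [lintegral_const_mul _ (ENNReal.measurable_ofReal.pow_const _),
              lintegral_Ioo_rpow (by linarith) ht, div_eq_mul_inv,
              ENNReal.ofReal_mul (Real.rpow_nonneg ht.le _), ENNReal.ofReal_rpow_of_pos ht,
              neg_add_eq_sub]
    calc _ ≤ ENNReal.ofReal t ^ p.toReal⁻¹ * ((N * (ENNReal.ofReal t ^ (-p.toReal⁻¹ + 1) *
            ENNReal.ofReal (1 - p.toReal⁻¹)⁻¹)) / ENNReal.ofReal t) :=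
          mul_le_mul_right (ENNReal.div_le_div_right h2 _) _
      _ = ENNReal.ofReal (1 - p.toReal⁻¹)⁻¹ * N * (ENNReal.ofReal t ^ p.toReal⁻¹ *
            ENNReal.ofReal t ^ (-p.toReal⁻¹ + 1) * ENNReal.ofReal t ^ (-1 : ℝ)) := by
          rw [div_eq_mul_inv, ENNReal.rpow_neg_one]; ring
      _ = _ := by
          rw [← ENNReal.rpow_add _ _ ht0 ENNReal.ofReal_ne_top,
            ← ENNReal.rpow_add _ _ ht0 ENNReal.ofReal_ne_top]
          simp
  · have hq0 : 0 < q.toReal := ENNReal.toReal_pos (by positivity) hqt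
    have hq1 : 1 ≤ q.toReal := by
      have := (ENNReal.toReal_le_toReal ENNReal.one_ne_top hqt).2 hq
      simpa using this
    calc _ ≤ (q / p * (ENNReal.ofReal (1 - p.toReal⁻¹)⁻¹ ^ q.toReal * ∫⁻ t in Ioi (0 : ℝ),
            (ENNReal.ofReal t ^ p.toReal⁻¹ * h t) ^ q.toReal / ENNReal.ofReal t)) ^ q.toReal⁻¹ := by
          gcongr
          exact hardy_inequality hb1 hq1 hh
      _ = _ := by
          rw [mul_left_comm, ENNReal.mul_rpow_of_nonneg _ _ (by positivity), ← ENNReal.rpow_mul,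
            mul_inv_cancel₀ hq0.ne', ENNReal.rpow_one]

/-! ### The Lorentz quasinorm through the K-functional -/

theorem lorentzQuasinorm_le_kFun {p q : ℝ≥0∞} {g : Rn n → Rn n} (hg : Measurable g) :
    lorentzQuasinorm p q g ≤ lorentzFun p q (fun τ => kFun g τ / ENNReal.ofReal τ) := by
  rw [lorentzQuasinorm_eq]
  refine lorentzFun_mono fun τ hτ => ?_
  rw [ENNReal.le_div_iff_mul_le (Or.inl (by simpa using hτ)) (Or.inl ENNReal.ofReal_ne_top),
    mul_comm]
  exact mul_rearrangement_le_kFun hg τ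

/-- Hardy's inequality for h = f*. The functional on the left then replaces the quasinorm as the
size of f, since estimates at fixed τ can be inserted into it. -/
theorem lorentzFun_kFun_ne_top {p q : ℝ≥0∞} (hp : 1 < p) (hq : 1 ≤ q) {f : Rn n → Rn n}
    (hf : Measurable f) (hfpq : lorentzQuasinorm p q f < ∞) :
    lorentzFun p q (fun τ => kFun f τ / ENNReal.ofReal τ) ≠ ∞ := by
  refine ne_top_of_le_ne_top (ENNReal.mul_ne_top ENNReal.ofReal_ne_top hfpq.ne)
    (le_trans (lorentzFun_mono fun τ _ => ?_)
      (lorentzFun_hardy hp hq (measurable_rearrangement f)))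
  exact ENNReal.div_le_div_right (kFun_le_lintegral_rearrangement hf τ) _

/-- The transfer principle: boundedness at every τ with one constant c becomes boundedness in every
Lorentz space at once. -/
theorem lorentzQuasinorm_le_of_kFun_le {p q : ℝ≥0∞} (hq : 1 ≤ q) {f g : Rn n → Rn n}
    (hg : Measurable g) {c : ℝ≥0∞} (hc : c ≠ ∞) (h : ∀ τ, 0 < τ → kFun g τ ≤ c * kFun f τ) :
    lorentzQuasinorm p q g ≤ c * lorentzFun p q (fun τ => kFun f τ / ENNReal.ofReal τ) := by
  refine (lorentzQuasinorm_le_kFun hg).trans ?_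
  rw [← lorentzFun_const_mul hq hc]
  refine lorentzFun_mono fun τ hτ => ?_
  rw [← mul_div_assoc]
  exact ENNReal.div_le_div_right (h τ hτ) _

/-- This growth rate is all that is used of f ∈ L^{r,∞}. For r = ∞ the exponent is 1, since
`r.toReal⁻¹` is 0. -/
theorem exists_kFun_le_rpow {r : ℝ≥0∞} (hr : 1 < r) {f : Rn n → Rn n}
    (hf : Measurable f) (hfr : lorentzQuasinorm r ∞ f < ∞) :
    ∃ M : ℝ, 0 < M ∧ ∀ τ : ℝ, 0 < τ →
      kFun f τ ≤ ENNReal.ofReal (M * τ ^ (1 - r.toReal⁻¹)) := by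
  have h := lorentzFun_kFun_ne_top hr le_top hf hfr
  set N := lorentzFun r ∞ (fun τ => kFun f τ / ENNReal.ofReal τ) with hN
  -- The added 1 keeps the constant positive even when f vanishes.
  refine ⟨N.toReal + 1, by positivity, fun τ hτ => ?_⟩
  have hτ0 : ENNReal.ofReal τ ≠ 0 := by simpa using hτ
  have h1 : ENNReal.ofReal τ ^ r.toReal⁻¹ * (kFun f τ / ENNReal.ofReal τ) ≤ N := by
    rw [hN, lorentzFun, if_pos rfl]
    exact le_iSup₂ (f := fun (t : ℝ) (_ : 0 < t) =>
      ENNReal.ofReal t ^ r.toReal⁻¹ * (kFun f t / ENNReal.ofReal t)) τ hτ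
  calc kFun f τ = ENNReal.ofReal τ ^ r.toReal⁻¹ * (kFun f τ / ENNReal.ofReal τ) *
        ENNReal.ofReal τ ^ (1 - r.toReal⁻¹) := by
        rw [mul_right_comm, ← ENNReal.rpow_add _ _ hτ0 ENNReal.ofReal_ne_top, add_sub_cancel,
          ENNReal.rpow_one, ENNReal.mul_div_cancel hτ0 ENNReal.ofReal_ne_top]
    _ ≤ N * ENNReal.ofReal τ ^ (1 - r.toReal⁻¹) := mul_le_mul_left h1 _
    _ ≤ _ := by
        rw [ENNReal.ofReal_rpow_of_pos hτ, ← ENNReal.ofReal_toReal h,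
          ← ENNReal.ofReal_mul ENNReal.toReal_nonneg]
        refine ENNReal.ofReal_le_ofReal (mul_le_mul_of_nonneg_right ?_ (by positivity))
        rw [ENNReal.toReal_ofReal ENNReal.toReal_nonneg]
        linarith

theorem lintegral_Ioi_inv_eq_top :
    ∫⁻ t in Ioi (1 : ℝ), (ENNReal.ofReal t)⁻¹ = ∞ := by
  by_contra h
  refine not_integrableOn_Ioi_inv (a := 1) ⟨measurable_inv.aestronglyMeasurable, ?_⟩
  rw [hasFiniteIntegral_iff_enorm]
  refine lt_of_le_of_lt (le_of_eq ?_) (lt_top_iff_ne_top.2 h)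
  refine setLIntegral_congr_fun measurableSet_Ioi fun t (ht : 1 < t) => ?_
  have ht0 : 0 < t := by linarith
  rw [Real.enorm_eq_ofReal (by positivity), ENNReal.ofReal_inv_of_pos ht0]

/-- If λ(y) were infinite, f* would stay above y, and the integral of t^{q/p} y^q dt/t diverges at
infinity. For q = ∞ nonzero constants show that this can fail when p = ∞. -/
theorem distribFun_ne_top {p q : ℝ≥0∞} (hp1 : 1 ≤ p) (hp : p ≠ ∞) (hq1 : 1 ≤ q) (hq : q ≠ ∞)
    {f : Rn n → Rn n}
    (hf : lorentzQuasinorm p q f < ∞) {y : ℝ} (hy : 0 < y) : distribFun f y ≠ ∞ := by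
  intro htop
  have hq0 : 0 < q.toReal := ENNReal.toReal_pos (by positivity) hq
  have hr : ∀ t : ℝ, ENNReal.ofReal y ≤ rearrangement f t := fun t =>
    le_rearrangement hy (by rw [htop]; exact ENNReal.ofReal_lt_top)
  rw [lorentzQuasinorm, if_neg hq] at hf
  refine hf.ne ?_
  have hI : ∫⁻ t in Ioi (0 : ℝ), (ENNReal.ofReal t ^ (p.toReal)⁻¹ * rearrangement f t) ^ q.toReal
      / ENNReal.ofReal t = ∞ := by
    rw [eq_top_iff]
    calc ∞ = ENNReal.ofReal y ^ q.toReal * ∫⁻ t in Ioi (1 : ℝ), (ENNReal.ofReal t)⁻¹ := by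
          rw [lintegral_Ioi_inv_eq_top, ENNReal.mul_top]
          simp [ENNReal.rpow_eq_zero_iff, hy]
      _ = ∫⁻ t in Ioi (1 : ℝ), ENNReal.ofReal y ^ q.toReal * (ENNReal.ofReal t)⁻¹ :=
          (lintegral_const_mul' _ _ (ENNReal.rpow_ne_top_of_nonneg hq0.le
            ENNReal.ofReal_ne_top)).symm
      _ ≤ ∫⁻ t in Ioi (1 : ℝ), (ENNReal.ofReal t ^ (p.toReal)⁻¹ * rearrangement f t) ^ q.toReal
            / ENNReal.ofReal t := by
          refine setLIntegral_mono' measurableSet_Ioi fun t (ht : 1 < t) => ?_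
          rw [div_eq_mul_inv]
          refine mul_le_mul_left (ENNReal.rpow_le_rpow ?_ hq0.le) _
          calc ENNReal.ofReal y = 1 * ENNReal.ofReal y := (one_mul _).symm
            _ ≤ _ := by
              refine mul_le_mul' (ENNReal.one_le_rpow ?_ ?_) (hr t)
              · simpa using ht.le
              · exact inv_pos.2 (ENNReal.toReal_pos (by positivity) hp)
      _ ≤ _ := lintegral_mono_set (Ioi_subset_Ioi zero_le_one)
  rw [hI, ENNReal.mul_top, ENNReal.top_rpow_of_pos (by positivity)]
  simp [ENNReal.div_eq_zero_iff, hp]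
  positivity

/-- The indicator of the level set is an admissible weight at τ = λ(y). -/
theorem lintegral_indicator_lt_norm_ne_top {f : Rn n → Rn n} (hf : Measurable f) {y : ℝ}
    (hd : distribFun f y ≠ ∞) (hk : ∀ τ, kFun f τ ≠ ∞) :
    ∫⁻ x, ‖{x | y < ‖f x‖}.indicator f x‖ₑ ≠ ∞ := by
  have hS := measurableSet_lt_norm hf y
  have hφ : ({x | y < ‖f x‖}.indicator fun _ => (1 : ℝ≥0∞)) ∈
      massFns n (distribFun f y).toReal := by
    refine ⟨measurable_const.indicator hS, fun x => indicator_apply_le' (fun _ => le_rfl)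
      (fun _ => zero_le_one), ?_⟩
    rw [lintegral_indicator_const hS, one_mul, ENNReal.ofReal_toReal hd]
    rfl
  refine ne_top_of_le_ne_top (hk _) (le_trans (le_of_eq ?_) (lintegral_le_kFun hφ f))
  refine lintegral_congr fun x => ?_
  by_cases hx : x ∈ {x | y < ‖f x‖}
  · simp [indicator_of_mem hx]
  · simp [indicator_of_notMem hx]

/-- Dominated convergence in τ, with the majorant built from C K(f,τ)/τ. It needs a genuine
integral, hence q < ∞. -/
theorem tendsto_lorentzQuasinorm_of_kFun {ι : Type*} {l : Filter ι} [l.IsCountablyGenerated]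
    {p q : ℝ≥0∞} (hp1 : 1 ≤ p) (hp : p ≠ ∞) (hq1 : 1 ≤ q) (hq : q ≠ ∞) {f : Rn n → Rn n}
    (hf : lorentzFun p q (fun τ => kFun f τ / ENNReal.ofReal τ) ≠ ∞) {G : ι → Rn n → Rn n}
    (hG : ∀ᶠ i in l, Measurable (G i)) {C : ℝ≥0∞} (hC : C ≠ ∞)
    (hbd : ∀ᶠ i in l, ∀ τ, 0 < τ → kFun (G i) τ ≤ C * kFun f τ)
    (hlim : ∀ τ, 0 < τ → Tendsto (fun i => kFun (G i) τ) l (𝓝 0)) :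
    Tendsto (fun i => lorentzQuasinorm p q (G i)) l (𝓝 0) := by
  have hq0 : 0 < q.toReal := ENNReal.toReal_pos (by positivity) hq
  have hqp0 : q / p ≠ 0 := by
    simp [ENNReal.div_eq_zero_iff, hp]
    positivity
  have hqpt : q / p ≠ ∞ := ENNReal.div_ne_top hq (by positivity)
  have hCf := ENNReal.mul_ne_top hC hf
  rw [← lorentzFun_const_mul hq1 hC, lorentzFun, if_neg hq] at hCf
  have hI : ∫⁻ t in Ioi (0 : ℝ), (ENNReal.ofReal t ^ (p.toReal)⁻¹ *
      (C * (kFun f t / ENNReal.ofReal t))) ^ q.toReal / ENNReal.ofReal t ≠ ∞ := by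
    intro h
    rw [h, ENNReal.mul_top hqp0, ENNReal.top_rpow_of_pos (by positivity)] at hCf
    exact hCf rfl
  have key : Tendsto (fun i => lorentzFun p q (fun τ => kFun (G i) τ / ENNReal.ofReal τ)) l
      (𝓝 0) := by
    simp only [lorentzFun, if_neg hq]
    have h1 : Tendsto (fun i => ∫⁻ t in Ioi (0 : ℝ), (ENNReal.ofReal t ^ (p.toReal)⁻¹ *
        (kFun (G i) t / ENNReal.ofReal t)) ^ q.toReal / ENNReal.ofReal t) l
        (𝓝 (∫⁻ t in Ioi (0 : ℝ), 0)) := by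
      refine tendsto_lintegral_filter_of_dominated_convergence _ ?_ ?_ hI ?_
      · refine Eventually.of_forall fun i => ?_
        exact (((ENNReal.measurable_ofReal.pow_const _).mul
          ((kFun_mono (G i)).measurable.div ENNReal.measurable_ofReal)).pow_const _).div
          ENNReal.measurable_ofReal
      · filter_upwards [hbd] with i hi
        refine (ae_restrict_iff' measurableSet_Ioi).2 (ae_of_all _ fun t ht => ?_)
        refine ENNReal.div_le_div_right (ENNReal.rpow_le_rpow ?_ hq0.le) _
        refine mul_le_mul_right ?_ _
        rw [← mul_div_assoc]
        exact ENNReal.div_le_div_right (hi t ht) _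
      · refine (ae_restrict_iff' measurableSet_Ioi).2 (ae_of_all _ fun t (ht : 0 < t) => ?_)
        have ht0 : ENNReal.ofReal t ≠ 0 := by simpa using ht
        have hc : ENNReal.ofReal t ^ p.toReal⁻¹ ≠ ∞ :=
          ENNReal.rpow_ne_top_of_ne_zero ht0 ENNReal.ofReal_ne_top
        have h2 := ENNReal.Tendsto.div_const (hlim t ht) (b := ENNReal.ofReal t) (Or.inr ht0)
        have h3 := ENNReal.Tendsto.const_mul h2 (Or.inr hc)
        have h4 := (ENNReal.continuous_rpow_const (y := q.toReal)).tendsto _ |>.comp h3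
        have h5 := ENNReal.Tendsto.div_const h4 (b := ENNReal.ofReal t) (Or.inr ht0)
        simpa [hq0, Function.comp_def] using h5
    rw [lintegral_zero] at h1
    have h2 := ENNReal.Tendsto.const_mul h1 (Or.inr hqpt)
    have h3 := (ENNReal.continuous_rpow_const (y := q.toReal⁻¹)).tendsto _ |>.comp h2
    simpa [hq0, Function.comp_def] using h3
  refine tendsto_of_tendsto_of_tendsto_of_le_of_le' tendsto_const_nhds key
    (Eventually.of_forall fun _ => bot_le) ?_
  filter_upwards [hG] with i hi
  exact lorentzQuasinorm_le_kFun hi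

/-! ### Continuity of translations -/

theorem tendsto_lintegral_translate_sub {f : Rn n → Rn n} (hf : Integrable f) :
    Tendsto (fun z : Rn n => ∫⁻ x, ‖f (x - z) - f x‖ₑ) (𝓝 0) (𝓝 0) := by
  have hf1 : MemLp f 1 := memLp_one_iff_integrable.2 hf
  let g : Rn n → C(Rn n, Rn n) := fun z => ⟨fun x => x - z, by fun_prop⟩
  have hg : Continuous g := ContinuousMap.continuous_of_continuous_uncurry _
    (by simp only [Function.uncurry_def, g, ContinuousMap.coe_mk]; fun_prop)
  have hgm : ∀ z, MeasurePreserving (g z) volume volume := fun z =>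
    measurePreserving_sub_right volume z
  have h := Filter.Tendsto.compMeasurePreservingLp (l := 𝓝 (0 : Rn n))
    (tendsto_const_nhds (x := hf1.toLp f)) (hg.tendsto 0) hgm (hgm 0) ENNReal.one_ne_top
  rw [tendsto_iff_edist_tendsto_0] at h
  refine h.congr fun z => ?_
  rw [Lp.toLp_compMeasurePreserving, Lp.toLp_compMeasurePreserving, Lp.edist_toLp_toLp,
    eLpNorm_one_eq_lintegral_enorm]
  simp [g]

theorem kFun_translate (f : Rn n → Rn n) (z : Rn n) (τ : ℝ) :
    kFun (fun x => f (x - z)) τ ≤ kFun f τ :=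
  kFun_le_iff.2 fun _ hφ => lintegral_translate_le_kFun hφ f z

theorem kFun_translate_sub_le {f : Rn n → Rn n} (hf : Measurable f) (z : Rn n) (τ : ℝ) :
    kFun (fun x => f (x - z) - f x) τ ≤ 2 * kFun f τ := by
  rw [two_mul]
  exact (kFun_sub_le (hf.comp (measurable_id.sub_const z))).trans
    (add_le_add_left (kFun_translate f z τ) _)

/-- Cut f at height δ. The part above δ is integrable, so its translations are continuous in L¹; the
part below contributes at most 2δτ to K. -/
theorem tendsto_kFun_translate_sub {f : Rn n → Rn n} (hf : Measurable f)
    (hd : ∀ y, 0 < y → distribFun f y ≠ ∞) (hk : ∀ τ, kFun f τ ≠ ∞) (τ : ℝ) :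
    Tendsto (fun z : Rn n => kFun (fun x => f (x - z) - f x) τ) (𝓝 0) (𝓝 0) := by
  rw [ENNReal.tendsto_nhds_zero]
  intro ε hε
  obtain ⟨δ, hδ0, hδ⟩ : ∃ δ : ℝ, 0 < δ ∧
      ENNReal.ofReal τ * (ENNReal.ofReal δ + ENNReal.ofReal δ) ≤ ε / 2 := by
    rcases eq_or_ne ε ∞ with rfl | hεt
    · exact ⟨1, one_pos, by simp [ENNReal.top_div]⟩
    · have hε' : 0 < ε.toReal := ENNReal.toReal_pos hε.ne' hεt
      -- Here 2δτ ≤ ε/2; using |τ| + 1 avoids a division by zero.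
      refine ⟨ε.toReal / (4 * (|τ| + 1)), by positivity, ?_⟩
      rw [← ENNReal.ofReal_add (by positivity) (by positivity),
        ← ENNReal.ofReal_mul' (by positivity), ← ENNReal.ofReal_toReal hεt,
        ENNReal.toReal_ofReal hε'.le, ← ENNReal.ofReal_ofNat, ← ENNReal.ofReal_div_of_pos two_pos]
      refine ENNReal.ofReal_le_ofReal ?_
      have h1 : τ ≤ |τ| + 1 := by linarith [le_abs_self τ]
      have h2 : (0 : ℝ) < |τ| + 1 := by positivity
      have h3 : ε.toReal / (4 * (|τ| + 1)) + ε.toReal / (4 * (|τ| + 1))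
          = (ε.toReal / 2) / (|τ| + 1) := by field_simp; ring
      rw [h3]
      calc τ * (ε.toReal / 2 / (|τ| + 1)) ≤ (|τ| + 1) * (ε.toReal / 2 / (|τ| + 1)) :=
            mul_le_mul_of_nonneg_right h1 (by positivity)
        _ = _ := by field_simp
  set S := {x | δ < ‖f x‖} with hSdef
  have hS : MeasurableSet S := measurableSet_lt_norm hf δ
  set f₁ := S.indicator f with hf₁
  set f₂ := Sᶜ.indicator f with hf₂
  have hfi : Integrable f₁ := by
    refine ⟨(hf.indicator hS).aestronglyMeasurable, ?_⟩
    rw [hasFiniteIntegral_iff_enorm]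
    exact lt_top_iff_ne_top.2 (lintegral_indicator_lt_norm_ne_top hf (hd δ hδ0) hk)
  have hf₂b : ∀ x, ‖f₂ x‖ₑ ≤ ENNReal.ofReal δ := by
    intro x
    rw [← ofReal_norm]
    refine ENNReal.ofReal_le_ofReal ?_
    by_cases hx : x ∈ S
    · simp [hf₂, hx, hδ0.le]
    · have : ‖f x‖ ≤ δ := not_lt.1 hx
      simpa [hf₂, hx] using this
  have hsum : ∀ x, f x = f₁ x + f₂ x := fun x => by
    rw [hf₁, hf₂]; exact (congrFun (indicator_self_add_compl S f) x).symm
  have h1 := (ENNReal.tendsto_nhds_zero.1 (tendsto_lintegral_translate_sub hfi)) (ε / 2)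
    (ENNReal.half_pos hε.ne')
  filter_upwards [h1] with z hz
  have heq : (fun x => f (x - z) - f x) =
      (fun x => f₁ (x - z) - f₁ x) + fun x => f₂ (x - z) - f₂ x := by
    funext x
    simp only [Pi.add_apply, hsum]
    abel
  rw [heq]
  have hm₁ : Measurable f₁ := hf.indicator hS
  calc _ ≤ kFun (fun x => f₁ (x - z) - f₁ x) τ + kFun (fun x => f₂ (x - z) - f₂ x) τ :=
        kFun_add_le ((hm₁.comp (measurable_id.sub_const z)).sub hm₁)
    _ ≤ ε / 2 + ε / 2 := by
        refine add_le_add (kFun_le_lintegral.trans hz) ((kFun_le_of_bound fun x => ?_).trans hδ)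
        exact (enorm_sub_le).trans (add_le_add (hf₂b _) (hf₂b _))
    _ = ε := ENNReal.add_halves ε

/-! ### The heat kernel -/

theorem heatKernel_nonneg {t : ℝ} (ht : 0 ≤ t) (x : Rn n) : 0 ≤ heatKernel t x := by
  unfold heatKernel; positivity

theorem measurable_heatKernel : Measurable fun z : ℝ × Rn n => heatKernel z.1 z.2 := by
  unfold heatKernel
  fun_prop

theorem continuous_heatKernel (t : ℝ) : Continuous fun x : Rn n => heatKernel t x := by
  unfold heatKernel
  fun_prop

theorem continuousAt_heatKernel {t : ℝ} (ht : 0 < t) (x : Rn n) :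
    ContinuousAt (fun s => heatKernel s x) t := by
  unfold heatKernel
  refine ContinuousAt.mul ?_ ?_
  · refine ContinuousAt.rpow_const (by fun_prop) (Or.inl (by positivity))
  · refine Real.continuous_exp.continuousAt.comp (ContinuousAt.div ?_ ?_ (by positivity))
    · fun_prop
    · fun_prop

theorem heatKernel_le {t : ℝ} (ht : 0 < t) (x : Rn n) :
    heatKernel t x ≤ (4 * Real.pi * t) ^ (-(n : ℝ) / 2) := by
  unfold heatKernel
  refine mul_le_of_le_one_right (by positivity) (Real.exp_le_one_iff.2 ?_)
  rw [neg_div]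
  exact neg_nonpos.2 (by positivity)

theorem integral_heatKernel {t : ℝ} (ht : 0 < t) : ∫ x : Rn n, heatKernel t x = 1 := by
  unfold heatKernel
  rw [integral_const_mul]
  have h := GaussianFourier.integral_rexp_neg_mul_sq_norm (V := Rn n) (b := (4 * t)⁻¹)
    (by positivity)
  have h2 : ∀ x : Rn n, Real.exp (-‖x‖ ^ 2 / (4 * t)) = Real.exp (-(4 * t)⁻¹ * ‖x‖ ^ 2) := by
    intro x; congr 1; field_simp
  simp_rw [h2, h, finrank_euclideanSpace_fin, div_inv_eq_mul]
  rw [show Real.pi * (4 * t) = 4 * Real.pi * t by ring, ← Real.rpow_add (by positivity)]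
  simp [neg_div]

theorem integrable_heatKernel {t : ℝ} (ht : 0 < t) : Integrable fun x : Rn n => heatKernel t x := by
  by_contra h
  have := integral_heatKernel (n := n) ht
  rw [integral_undef h] at this
  exact zero_ne_one this

theorem lintegral_heatKernel {t : ℝ} (ht : 0 < t) :
    ∫⁻ x : Rn n, ENNReal.ofReal (heatKernel t x) = 1 := by
  rw [← ofReal_integral_eq_lintegral_ofReal (integrable_heatKernel ht)
    (ae_of_all _ fun x => heatKernel_nonneg ht.le x), integral_heatKernel ht, ENNReal.ofReal_one]

/-- Half of the Gaussian exponent is set free to absorb polynomial factors, while the other half is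
a heat kernel at time 2t, still of integral one. -/
theorem heatKernel_eq_double {t : ℝ} (ht : 0 < t) (x : Rn n) :
    heatKernel t x = 2 ^ ((n : ℝ) / 2) * Real.exp (-(‖x‖ ^ 2 / (8 * t))) *
      heatKernel (2 * t) x := by
  unfold heatKernel
  rw [show 4 * Real.pi * (2 * t) = 2 * (4 * Real.pi * t) by ring,
    Real.mul_rpow two_pos.le (by positivity)]
  have h1 : Real.exp (-‖x‖ ^ 2 / (4 * t)) =
      Real.exp (-(‖x‖ ^ 2 / (8 * t))) * Real.exp (-‖x‖ ^ 2 / (4 * (2 * t))) := by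
    rw [← Real.exp_add]; congr 1; field_simp; ring
  have h2 : (2 : ℝ) ^ ((n : ℝ) / 2) * 2 ^ (-(n : ℝ) / 2) = 1 := by
    rw [← Real.rpow_add two_pos]; simp [neg_div]
  rw [h1]
  linear_combination (-(4 * Real.pi * t) ^ (-(n : ℝ) / 2) *
    Real.exp (-(‖x‖ ^ 2 / (8 * t))) * Real.exp (-‖x‖ ^ 2 / (4 * (2 * t)))) * h2

theorem pow_mul_exp_neg_sq_le (m : ℕ) (ρ : ℝ) :
    ρ ^ m * Real.exp (-(ρ ^ 2 / 8)) ≤ 1 + 8 ^ m * m.factorial := by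
  have h1 : ρ ^ m ≤ 1 + (ρ ^ 2) ^ m := by
    rw [← pow_mul, mul_comm, pow_mul]
    nlinarith [sq_nonneg (ρ ^ m - 1)]
  have h2 : (ρ ^ 2) ^ m ≤ 8 ^ m * m.factorial * Real.exp (ρ ^ 2 / 8) := by
    have := Real.pow_div_factorial_le_exp (ρ ^ 2 / 8) (by positivity) m
    rw [div_le_iff₀ (by positivity), div_pow, div_le_iff₀ (by positivity)] at this
    linarith
  have he : Real.exp (-(ρ ^ 2 / 8)) ≤ 1 := Real.exp_le_one_iff.2 (neg_nonpos.2 (by positivity))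
  have he2 : Real.exp (ρ ^ 2 / 8) * Real.exp (-(ρ ^ 2 / 8)) = 1 := by
    rw [← Real.exp_add]; simp
  calc ρ ^ m * Real.exp (-(ρ ^ 2 / 8))
      ≤ (1 + 8 ^ m * m.factorial * Real.exp (ρ ^ 2 / 8)) * Real.exp (-(ρ ^ 2 / 8)) := by
        gcongr; linarith
    _ = Real.exp (-(ρ ^ 2 / 8)) + 8 ^ m * m.factorial *
        (Real.exp (ρ ^ 2 / 8) * Real.exp (-(ρ ^ 2 / 8))) := by ring
    _ ≤ _ := by rw [he2]; linarith

/-- The constant in the absorption of polynomial factors by the heat kernel. -/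
def heatConst (n m : ℕ) : ℝ := 2 ^ ((n : ℝ) / 2) * (1 + 8 ^ m * m.factorial)

theorem heatConst_pos (n m : ℕ) : 0 < heatConst n m := by unfold heatConst; positivity

/-- In the variable ρ = |x|/√t the freed factor e^{-ρ²/8} bounds ρ^m, so a polynomial of degree m
costs t^{m/2}. -/
theorem norm_pow_mul_heatKernel_le (m : ℕ) {t : ℝ} (ht : 0 < t) (x : Rn n) :
    ‖x‖ ^ m * heatKernel t x ≤ heatConst n m * t ^ ((m : ℝ) / 2) * heatKernel (2 * t) x := by
  have h := pow_mul_exp_neg_sq_le m (‖x‖ / √t)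
  have hs : (‖x‖ / √t) ^ 2 / 8 = ‖x‖ ^ 2 / (8 * t) := by
    rw [div_pow, Real.sq_sqrt ht.le]; field_simp
  have hm : t ^ ((m : ℝ) / 2) = √t ^ m := by
    rw [Real.sqrt_eq_rpow, ← Real.rpow_natCast, ← Real.rpow_mul ht.le]; congr 1; ring
  have hst : 0 < √t := Real.sqrt_pos.2 ht
  rw [hs, div_pow, div_mul_eq_mul_div, div_le_iff₀ (by positivity)] at h
  rw [heatKernel_eq_double ht x, hm, heatConst]
  have hk := heatKernel_nonneg (n := n) (t := 2 * t) (by positivity) x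
  calc ‖x‖ ^ m * (2 ^ ((n : ℝ) / 2) * Real.exp (-(‖x‖ ^ 2 / (8 * t))) * heatKernel (2 * t) x)
      = 2 ^ ((n : ℝ) / 2) * heatKernel (2 * t) x *
        (‖x‖ ^ m * Real.exp (-(‖x‖ ^ 2 / (8 * t)))) := by ring
    _ ≤ 2 ^ ((n : ℝ) / 2) * heatKernel (2 * t) x * ((1 + 8 ^ m * m.factorial) * √t ^ m) := by
        gcongr
    _ = _ := by ring

theorem hasDerivAt_heatKernel_line (s : ℝ) (x h : Rn n) (θ : ℝ) :
    HasDerivAt (fun θ : ℝ => heatKernel s (x + θ • h))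
      (-(inner ℝ (x + θ • h) h / (2 * s)) * heatKernel s (x + θ • h)) θ := by
  unfold heatKernel
  have h1 : HasDerivAt (fun θ : ℝ => x + θ • h) h θ := by
    simpa using ((hasDerivAt_id θ).smul_const h).const_add x
  have h2 := h1.norm_sq
  have h3 := ((h2.neg.div_const (4 * s)).exp).const_mul ((4 * Real.pi * s) ^ (-(n : ℝ) / 2))
  refine h3.congr_deriv ?_
  simp only [Pi.neg_apply]
  ring_nf

/-! ### Translation estimates in `L¹` -/

/-- Fundamental theorem of calculus along the segment from x to x + h; every slice in θ has the same
integral by translation invariance. D is the directional derivative, so it already contains the size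
of h. -/
theorem lintegral_shift_sub_le {E : Type*} [NormedAddCommGroup E] [NormedSpace ℝ E]
    [CompleteSpace E] {g D : Rn n → E} {h : Rn n}
    (hd : ∀ x : Rn n, ∀ θ : ℝ, HasDerivAt (fun θ : ℝ => g (x + θ • h)) (D (x + θ • h)) θ)
    (hD : Continuous D) :
    ∫⁻ x, ‖g (x + h) - g x‖ₑ ≤ ∫⁻ x, ‖D x‖ₑ := by
  have hm : Measurable (Function.uncurry fun (x : Rn n) (θ : ℝ) => ‖D (x + θ • h)‖ₑ) := by
    have : Continuous (Function.uncurry fun (x : Rn n) (θ : ℝ) => ‖D (x + θ • h)‖ₑ) := by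
      simp only [Function.uncurry_def]; fun_prop
    exact this.measurable
  calc ∫⁻ x, ‖g (x + h) - g x‖ₑ ≤ ∫⁻ x, ∫⁻ θ in Ioc (0 : ℝ) 1, ‖D (x + θ • h)‖ₑ := by
        refine lintegral_mono fun x => ?_
        have hI : IntervalIntegrable (fun θ : ℝ => D (x + θ • h)) volume 0 1 :=
          Continuous.intervalIntegrable (by fun_prop) _ _
        have := intervalIntegral.integral_eq_sub_of_hasDerivAt (fun θ _ => hd x θ) hI
        simp only [one_smul, zero_smul, add_zero] at this
        rw [← this, intervalIntegral.integral_of_le zero_le_one]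
        exact enorm_integral_le_lintegral_enorm _
    _ = ∫⁻ θ in Ioc (0 : ℝ) 1, ∫⁻ x, ‖D (x + θ • h)‖ₑ := lintegral_lintegral_swap hm.aemeasurable
    _ = ∫⁻ θ in Ioc (0 : ℝ) 1, ∫⁻ x, ‖D x‖ₑ := by
        refine lintegral_congr fun θ => ?_
        exact lintegral_add_right_eq_self (fun x => ‖D x‖ₑ) (θ • h)
    _ = _ := by simp

theorem norm_shift_sub_le {E : Type*} [NormedAddCommGroup E] [NormedSpace ℝ E]
    {g D : Rn n → E} {h : Rn n}
    (hd : ∀ x : Rn n, ∀ θ : ℝ, HasDerivAt (fun θ : ℝ => g (x + θ • h)) (D (x + θ • h)) θ)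
    {C : ℝ} (hC : ∀ x, ‖D x‖ ≤ C) (x : Rn n) : ‖g (x + h) - g x‖ ≤ C := by
  have := norm_image_sub_le_of_norm_deriv_le_segment_01' (f := fun θ : ℝ => g (x + θ • h))
    (f' := fun θ => D (x + θ • h)) (C := C) (fun θ _ => (hd x θ).hasDerivWithinAt)
    (fun θ _ => hC _)
  simpa using this

theorem lintegral_const_mul_heatKernel {c s : ℝ} (hc : 0 ≤ c) (hs : 0 < s) :
    ∫⁻ x : Rn n, ENNReal.ofReal (c * heatKernel s x) = ENNReal.ofReal c := by
  simp_rw [ENNReal.ofReal_mul hc]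
  rw [lintegral_const_mul' _ _ ENNReal.ofReal_ne_top, lintegral_heatKernel hs, mul_one]

theorem norm_heatKernel_lineDeriv_le {s : ℝ} (hs : 0 < s) (h x : Rn n) :
    ‖-(inner ℝ x h / (2 * s)) * heatKernel s x‖ ≤
      heatConst n 1 * s ^ (-(1 / 2) : ℝ) * ‖h‖ * heatKernel (2 * s) x := by
  have hk := heatKernel_nonneg hs.le x
  have h1 := norm_pow_mul_heatKernel_le 1 hs x
  have h2 : s ^ (((1 : ℕ) : ℝ) / 2) = s * s ^ (-(1 / 2) : ℝ) := by
    nth_rewrite 2 [← Real.rpow_one s]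
    rw [← Real.rpow_add hs]; norm_num
  rw [h2] at h1
  rw [norm_mul, norm_neg, norm_div, Real.norm_of_nonneg hk, Real.norm_of_nonneg (by positivity : 0 ≤ 2 * s)]
  have hk2 := heatKernel_nonneg (n := n) (t := 2 * s) (by positivity) x
  have hc := heatConst_pos n 1
  calc ‖inner ℝ x h‖ / (2 * s) * heatKernel s x ≤ ‖x‖ * ‖h‖ / (2 * s) * heatKernel s x := by
        gcongr; exact norm_inner_le_norm x h
    _ = ‖h‖ / (2 * s) * (‖x‖ ^ 1 * heatKernel s x) := by ring
    _ ≤ ‖h‖ / (2 * s) * (heatConst n 1 * (s * s ^ (-(1 / 2) : ℝ)) * heatKernel (2 * s) x) := by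
        gcongr
    _ = (1 / 2) * (heatConst n 1 * s ^ (-(1 / 2) : ℝ) * ‖h‖ * heatKernel (2 * s) x) := by
        field_simp
    _ ≤ _ := by
        have : 0 ≤ heatConst n 1 * s ^ (-(1 / 2) : ℝ) * ‖h‖ * heatKernel (2 * s) x := by positivity
        linarith

theorem lintegral_heatKernel_shift_le {s : ℝ} (hs : 0 < s) (h : Rn n) :
    ∫⁻ x, ‖heatKernel s (x + h) - heatKernel s x‖ₑ ≤
      ENNReal.ofReal (heatConst n 1 * s ^ (-(1 / 2) : ℝ) * ‖h‖) := by
  have hc := heatConst_pos n 1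
  refine (lintegral_shift_sub_le (D := fun x => -(inner ℝ x h / (2 * s)) * heatKernel s x)
    (fun x θ => hasDerivAt_heatKernel_line s x h θ) ?_).trans ?_
  · have := continuous_heatKernel (n := n) s
    fun_prop
  · rw [← lintegral_const_mul_heatKernel (n := n) (s := 2 * s) (by positivity) (by positivity)]
    refine lintegral_mono fun x => ?_
    rw [← ofReal_norm]
    exact ENNReal.ofReal_le_ofReal (norm_heatKernel_lineDeriv_le hs h x)

theorem norm_heatKernel_shift_le {s : ℝ} (hs : 0 < s) (h x : Rn n) :
    ‖heatKernel s (x + h) - heatKernel s x‖ ≤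
      heatConst n 1 * s ^ (-(1 / 2) : ℝ) * (4 * Real.pi * (2 * s)) ^ (-(n : ℝ) / 2) * ‖h‖ := by
  have hc := heatConst_pos n 1
  refine norm_shift_sub_le (D := fun x => -(inner ℝ x h / (2 * s)) * heatKernel s x)
    (fun x θ => hasDerivAt_heatKernel_line s x h θ) (fun x => ?_) x
  refine (norm_heatKernel_lineDeriv_le hs h x).trans ?_
  refine (mul_le_mul_of_nonneg_left (heatKernel_le (t := 2 * s) (by positivity) x)
    (by positivity)).trans (le_of_eq ?_)
  ring

theorem tendsto_lintegral_heatKernel_sub {t₀ : ℝ} (ht₀ : 0 < t₀) :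
    Tendsto (fun t => ∫⁻ x : Rn n, ‖heatKernel t x - heatKernel t₀ x‖ₑ) (𝓝 t₀) (𝓝 0) := by
  -- For t > t₀/2 one has t^{-n/2} ≤ 4^{n/2} (2t₀)^{-n/2}, and for t < 2t₀ the exponential is below
  -- the one at 2t₀: one integrable majorant serves near t₀.
  have hdom : ∀ t ∈ Ioo (t₀ / 2) (2 * t₀), ∀ x : Rn n,
      heatKernel t x ≤ 4 ^ ((n : ℝ) / 2) * heatKernel (2 * t₀) x := by
    intro t ht x
    have ht0 : 0 < t := by linarith [ht.1]
    unfold heatKernel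
    rw [← mul_assoc]
    refine mul_le_mul ?_ (Real.exp_le_exp.2 ?_) (Real.exp_nonneg _) (by positivity)
    · have h4 : (4 : ℝ) ^ ((n : ℝ) / 2) = (4⁻¹ : ℝ) ^ (-(n : ℝ) / 2) := by
        rw [Real.inv_rpow (by norm_num), neg_div, Real.rpow_neg (by norm_num), inv_inv]
      rw [h4, ← Real.mul_rpow (by norm_num) (by positivity)]
      refine Real.rpow_le_rpow_of_nonpos (by positivity) ?_ ?_
      · have := Real.pi_pos
        nlinarith [ht.1]
      · rw [neg_div]; exact neg_nonpos.2 (by positivity)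
    · rw [neg_div, neg_div]
      refine neg_le_neg ?_
      gcongr
      exact ht.2.le
  have hev : ∀ᶠ t in 𝓝 t₀, t ∈ Ioo (t₀ / 2) (2 * t₀) :=
    Ioo_mem_nhds (by linarith) (by linarith)
  have h := tendsto_lintegral_filter_of_dominated_convergence (μ := (volume : Measure (Rn n)))
    (l := 𝓝 t₀) (F := fun t x => ‖heatKernel t x - heatKernel t₀ x‖ₑ) (f := fun _ => 0)
    (fun x => ENNReal.ofReal (4 ^ ((n : ℝ) / 2) * 2 * heatKernel (2 * t₀) x)) ?_ ?_ ?_ ?_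
  · simpa using h
  · exact Eventually.of_forall fun t =>
      ((continuous_heatKernel t).sub (continuous_heatKernel t₀)).measurable.enorm
  · filter_upwards [hev] with t ht
    refine ae_of_all _ fun x => ?_
    rw [← ofReal_norm]
    refine ENNReal.ofReal_le_ofReal ?_
    have h1 := hdom t ht x
    have h2 := hdom t₀ ⟨by linarith, by linarith⟩ x
    have h3 := heatKernel_nonneg (n := n) (t := t) (by linarith [ht.1]) x
    have h4 := heatKernel_nonneg (n := n) ht₀.le x
    rw [Real.norm_eq_abs, abs_le]
    constructor <;> linarith
  · rw [lintegral_const_mul_heatKernel (by positivity) (by positivity)]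
    exact ENNReal.ofReal_ne_top
  · refine ae_of_all _ fun x => ?_
    have h1 : Tendsto (fun t => heatKernel t x - heatKernel t₀ x) (𝓝 t₀) (𝓝 0) := by
      have := (continuousAt_heatKernel ht₀ x).tendsto.sub_const (heatKernel t₀ x)
      simpa using this
    simpa using h1.enorm

/-! ### Third derivatives of the heat kernel -/

/-- Three-index tensors. -/
abbrev Tensor3 (n : ℕ) : Type := Fin n → Fin n → Fin n → ℝ

/-- The Kronecker symbol. -/
def kron (i j : Fin n) : ℝ := if i = j then 1 else 0

theorem abs_kron_le (i j : Fin n) : |kron i j| ≤ 1 := by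
  unfold kron; split_ifs <;> simp

theorem abs_coord_le (x : Rn n) (i : Fin n) : |x i| ≤ ‖x‖ := by
  simpa using PiLp.norm_apply_le x i

/-- The polynomial factor of `∂ᵢ∂ⱼ∂ₖ` of the heat kernel. -/
def heatPoly (i j k : Fin n) (s : ℝ) (x : Rn n) : ℝ :=
  -(x i * x j * x k) / (8 * s ^ 3) +
    (kron i j * x k + kron i k * x j + kron j k * x i) / (4 * s ^ 2)

/-- The derivative of `heatPoly` in the direction `h`. -/
def heatPolyDeriv (i j k : Fin n) (s : ℝ) (h x : Rn n) : ℝ :=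
  -(h i * x j * x k + x i * h j * x k + x i * x j * h k) / (8 * s ^ 3) +
    (kron i j * h k + kron i k * h j + kron j k * h i) / (4 * s ^ 2)

/-- The third derivatives `∂ᵢ∂ⱼ∂ₖ` of the heat kernel. -/
def heatThird (i j k : Fin n) (s : ℝ) (x : Rn n) : ℝ := heatPoly i j k s x * heatKernel s x

/-- The derivative of `heatThird` in the direction `h`. -/
def heatThirdDeriv (i j k : Fin n) (s : ℝ) (h x : Rn n) : ℝ :=
  heatPolyDeriv i j k s h x * heatKernel s x +
    heatPoly i j k s x * (-(inner ℝ x h / (2 * s)) * heatKernel s x)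

theorem hasDerivAt_coord_line (x h : Rn n) (i : Fin n) (θ : ℝ) :
    HasDerivAt (fun θ : ℝ => (x + θ • h) i) (h i) θ := by
  simpa using ((hasDerivAt_id θ).mul_const (h i)).const_add (x i)

theorem hasDerivAt_heatPoly_line (i j k : Fin n) (s : ℝ) (x h : Rn n) (θ : ℝ) :
    HasDerivAt (fun θ : ℝ => heatPoly i j k s (x + θ • h))
      (heatPolyDeriv i j k s h (x + θ • h)) θ := by
  have hi := hasDerivAt_coord_line x h i θ
  have hj := hasDerivAt_coord_line x h j θ
  have hk := hasDerivAt_coord_line x h k θ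
  have h1 := (((hi.mul hj).mul hk).neg.div_const (8 * s ^ 3)).add
    ((((hk.const_mul (kron i j)).add (hj.const_mul (kron i k))).add
      (hi.const_mul (kron j k))).div_const (4 * s ^ 2))
  refine h1.congr_deriv ?_
  simp only [heatPolyDeriv, Pi.mul_apply]
  ring

theorem hasDerivAt_heatThird_line (i j k : Fin n) (s : ℝ) (x h : Rn n) (θ : ℝ) :
    HasDerivAt (fun θ : ℝ => heatThird i j k s (x + θ • h))
      (heatThirdDeriv i j k s h (x + θ • h)) θ :=
  (hasDerivAt_heatPoly_line i j k s x h θ).mul (hasDerivAt_heatKernel_line s x h θ)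

theorem abs_heatPoly_le (i j k : Fin n) {s : ℝ} (hs : 0 < s) (x : Rn n) :
    |heatPoly i j k s x| ≤ ‖x‖ ^ 3 / (8 * s ^ 3) + 3 * ‖x‖ / (4 * s ^ 2) := by
  have hi := abs_coord_le x i
  have hj := abs_coord_le x j
  have hk := abs_coord_le x k
  unfold heatPoly
  refine (abs_add_le _ _).trans (add_le_add ?_ ?_)
  · rw [abs_div, abs_neg, abs_mul, abs_mul, abs_of_pos (by positivity : 0 < 8 * s ^ 3)]
    gcongr
    calc |x i| * |x j| * |x k| ≤ ‖x‖ * ‖x‖ * ‖x‖ := by gcongr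
      _ = _ := by ring
  · rw [abs_div, abs_of_pos (by positivity : 0 < 4 * s ^ 2)]
    gcongr
    refine (abs_add_three _ _ _).trans ?_
    rw [abs_mul, abs_mul, abs_mul]
    calc _ ≤ 1 * ‖x‖ + 1 * ‖x‖ + 1 * ‖x‖ := by
          gcongr <;> exact abs_kron_le _ _
      _ = _ := by ring

theorem abs_heatPolyDeriv_le (i j k : Fin n) {s : ℝ} (hs : 0 < s) (h x : Rn n) :
    |heatPolyDeriv i j k s h x| ≤
      ‖h‖ * (3 * ‖x‖ ^ 2 / (8 * s ^ 3) + 3 / (4 * s ^ 2)) := by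
  have hi := abs_coord_le x i
  have hj := abs_coord_le x j
  have hk := abs_coord_le x k
  have hi' := abs_coord_le h i
  have hj' := abs_coord_le h j
  have hk' := abs_coord_le h k
  unfold heatPolyDeriv
  rw [mul_add]
  refine (abs_add_le _ _).trans (add_le_add ?_ ?_)
  · rw [abs_div, abs_neg, abs_of_pos (by positivity : 0 < 8 * s ^ 3), ← mul_div_assoc]
    gcongr
    refine (abs_add_three _ _ _).trans ?_
    simp only [abs_mul]
    calc _ ≤ ‖h‖ * ‖x‖ * ‖x‖ + ‖x‖ * ‖h‖ * ‖x‖ + ‖x‖ * ‖x‖ * ‖h‖ := by gcongr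
      _ = _ := by ring
  · rw [abs_div, abs_of_pos (by positivity : 0 < 4 * s ^ 2), ← mul_div_assoc]
    gcongr
    refine (abs_add_three _ _ _).trans ?_
    rw [abs_mul, abs_mul, abs_mul]
    calc _ ≤ 1 * ‖h‖ + 1 * ‖h‖ + 1 * ‖h‖ := by
          gcongr <;> exact abs_kron_le _ _
      _ = _ := by ring

/-- The constant in the bounds for the third and fourth derivatives of the heat kernel. -/
def thirdConst (n : ℕ) : ℝ :=
  heatConst n 0 + heatConst n 1 + heatConst n 2 + heatConst n 3 + heatConst n 4

theorem thirdConst_pos (n : ℕ) : 0 < thirdConst n := by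
  have h0 := heatConst_pos n 0
  have h1 := heatConst_pos n 1
  have h2 := heatConst_pos n 2
  have h3 := heatConst_pos n 3
  have h4 := heatConst_pos n 4
  unfold thirdConst; positivity

/-- Both |x|³/s³ and |x|/s² scale like s^{-3/2} once |x| is traded for √s. -/
theorem abs_heatThird_le (i j k : Fin n) {s : ℝ} (hs : 0 < s) (x : Rn n) :
    |heatThird i j k s x| ≤ thirdConst n * s ^ (-(3 / 2) : ℝ) * heatKernel (2 * s) x := by
  have hk := heatKernel_nonneg (n := n) hs.le x
  have hk2 := heatKernel_nonneg (n := n) (t := 2 * s) (by positivity) x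
  have h1 := norm_pow_mul_heatKernel_le 1 hs x
  have h3 := norm_pow_mul_heatKernel_le 3 hs x
  have e1 : s ^ (((1 : ℕ) : ℝ) / 2) = s ^ 2 * s ^ (-(3 / 2) : ℝ) := by
    rw [← Real.rpow_natCast, ← Real.rpow_add hs]; norm_num
  have e3 : s ^ (((3 : ℕ) : ℝ) / 2) = s ^ 3 * s ^ (-(3 / 2) : ℝ) := by
    rw [← Real.rpow_natCast, ← Real.rpow_add hs]; norm_num
  rw [e1, pow_one] at h1
  rw [e3] at h3
  have c0 := heatConst_pos n 0
  have c1 := heatConst_pos n 1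
  have c2 := heatConst_pos n 2
  have c3 := heatConst_pos n 3
  have c4 := heatConst_pos n 4
  have hP : 0 ≤ s ^ (-(3 / 2) : ℝ) * heatKernel (2 * s) x := by positivity
  rw [heatThird, abs_mul, abs_of_nonneg hk]
  calc |heatPoly i j k s x| * heatKernel s x
      ≤ (‖x‖ ^ 3 / (8 * s ^ 3) + 3 * ‖x‖ / (4 * s ^ 2)) * heatKernel s x := by
        gcongr; exact abs_heatPoly_le i j k hs x
    _ = 1 / (8 * s ^ 3) * (‖x‖ ^ 3 * heatKernel s x) +
        3 / (4 * s ^ 2) * (‖x‖ * heatKernel s x) := by ring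
    _ ≤ 1 / (8 * s ^ 3) * (heatConst n 3 * (s ^ 3 * s ^ (-(3 / 2) : ℝ)) * heatKernel (2 * s) x) +
        3 / (4 * s ^ 2) * (heatConst n 1 * (s ^ 2 * s ^ (-(3 / 2) : ℝ)) *
          heatKernel (2 * s) x) := by gcongr
    _ = (1 / 8 * heatConst n 3 + 3 / 4 * heatConst n 1) *
        (s ^ (-(3 / 2) : ℝ) * heatKernel (2 * s) x) := by field_simp
    _ ≤ thirdConst n * (s ^ (-(3 / 2) : ℝ) * heatKernel (2 * s) x) := by
        gcongr
        unfold thirdConst; linarith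
    _ = _ := by ring

theorem abs_heatThirdDeriv_le (i j k : Fin n) {s : ℝ} (hs : 0 < s) (h x : Rn n) :
    |heatThirdDeriv i j k s h x| ≤
      thirdConst n * s ^ (-2 : ℝ) * ‖h‖ * heatKernel (2 * s) x := by
  have hk := heatKernel_nonneg (n := n) hs.le x
  have hk2 := heatKernel_nonneg (n := n) (t := 2 * s) (by positivity) x
  have h0 := norm_pow_mul_heatKernel_le 0 hs x
  have h2 := norm_pow_mul_heatKernel_le 2 hs x
  have h4 := norm_pow_mul_heatKernel_le 4 hs x
  have e0 : s ^ (((0 : ℕ) : ℝ) / 2) = s ^ 2 * s ^ (-2 : ℝ) := by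
    rw [← Real.rpow_natCast, ← Real.rpow_add hs]; norm_num
  have e2 : s ^ (((2 : ℕ) : ℝ) / 2) = s ^ 3 * s ^ (-2 : ℝ) := by
    rw [← Real.rpow_natCast, ← Real.rpow_add hs]; norm_num
  have e4 : s ^ (((4 : ℕ) : ℝ) / 2) = s ^ 4 * s ^ (-2 : ℝ) := by
    rw [← Real.rpow_natCast, ← Real.rpow_add hs]; norm_num
  rw [e0, pow_zero, one_mul] at h0
  rw [e2] at h2
  rw [e4] at h4
  have c0 := heatConst_pos n 0
  have c1 := heatConst_pos n 1
  have c2 := heatConst_pos n 2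
  have c3 := heatConst_pos n 3
  have c4 := heatConst_pos n 4
  have hin : |(inner ℝ x h : ℝ)| ≤ ‖x‖ * ‖h‖ := abs_real_inner_le_norm x h
  have hP : 0 ≤ s ^ (-2 : ℝ) * ‖h‖ * heatKernel (2 * s) x := by positivity
  calc |heatThirdDeriv i j k s h x|
      ≤ |heatPolyDeriv i j k s h x| * heatKernel s x +
        |heatPoly i j k s x| * (|(inner ℝ x h : ℝ)| / (2 * s) * heatKernel s x) := by
        unfold heatThirdDeriv
        refine (abs_add_le _ _).trans (le_of_eq ?_)
        rw [abs_mul, abs_mul, abs_mul, abs_neg, abs_div, abs_of_nonneg hk,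
          abs_of_pos (by positivity : 0 < 2 * s)]
    _ ≤ ‖h‖ * (3 * ‖x‖ ^ 2 / (8 * s ^ 3) + 3 / (4 * s ^ 2)) * heatKernel s x +
        (‖x‖ ^ 3 / (8 * s ^ 3) + 3 * ‖x‖ / (4 * s ^ 2)) *
          (‖x‖ * ‖h‖ / (2 * s) * heatKernel s x) := by
        gcongr
        · exact abs_heatPolyDeriv_le i j k hs h x
        · exact abs_heatPoly_le i j k hs x
    _ = ‖h‖ * (1 / (16 * s ^ 4) * (‖x‖ ^ 4 * heatKernel s x) +
        3 / (4 * s ^ 3) * (‖x‖ ^ 2 * heatKernel s x) + 3 / (4 * s ^ 2) * heatKernel s x) := by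
        field_simp; ring
    _ ≤ ‖h‖ * (1 / (16 * s ^ 4) *
          (heatConst n 4 * (s ^ 4 * s ^ (-2 : ℝ)) * heatKernel (2 * s) x) +
        3 / (4 * s ^ 3) * (heatConst n 2 * (s ^ 3 * s ^ (-2 : ℝ)) * heatKernel (2 * s) x) +
        3 / (4 * s ^ 2) * (heatConst n 0 * (s ^ 2 * s ^ (-2 : ℝ)) * heatKernel (2 * s) x)) := by
        gcongr
    _ = (1 / 16 * heatConst n 4 + 3 / 4 * heatConst n 2 + 3 / 4 * heatConst n 0) *
        (s ^ (-2 : ℝ) * ‖h‖ * heatKernel (2 * s) x) := by field_simp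
    _ ≤ thirdConst n * (s ^ (-2 : ℝ) * ‖h‖ * heatKernel (2 * s) x) := by
        gcongr
        unfold thirdConst; linarith
    _ = _ := by ring

/-! ### The density of the gradient of the Oseen kernel -/

/-- The function of `s` whose integral over `(t,∞)` is the gradient of the Oseen kernel. -/
def oseenDensity (s : ℝ) (x : Rn n) : Tensor3 n := fun i j k =>
  heatThird i j k s x - kron i j * ∑ l, heatThird l l k s x

/-- The derivative of `oseenDensity` in the direction `h`. -/
def oseenDensityDeriv (s : ℝ) (h x : Rn n) : Tensor3 n := fun i j k =>
  heatThirdDeriv i j k s h x - kron i j * ∑ l, heatThirdDeriv l l k s h x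

/-- The constant in the bounds for `oseenDensity`. -/
def densityConst (n : ℕ) : ℝ := (1 + n) * thirdConst n

theorem densityConst_pos (n : ℕ) : 0 < densityConst n := by
  have := thirdConst_pos n
  unfold densityConst; positivity

theorem abs_sub_kron_sum_le {a : ℝ} {b : Fin n → ℝ} {c : ℝ} (i j : Fin n)
    (ha : |a| ≤ c) (hb : ∀ l, |b l| ≤ c) : |a - kron i j * ∑ l, b l| ≤ (1 + n) * c := by
  calc |a - kron i j * ∑ l, b l| ≤ |a| + |kron i j| * |∑ l, b l| := by
        rw [← abs_mul]; exact abs_sub _ _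
    _ ≤ c + 1 * ∑ l : Fin n, c := by
        gcongr
        · exact abs_kron_le i j
        · exact (Finset.abs_sum_le_sum_abs _ _).trans (Finset.sum_le_sum fun l _ => hb l)
    _ = _ := by simp; ring

theorem norm_oseenDensity_le {s : ℝ} (hs : 0 < s) (x : Rn n) :
    ‖oseenDensity s x‖ ≤ densityConst n * s ^ (-(3 / 2) : ℝ) * heatKernel (2 * s) x := by
  have hk2 := heatKernel_nonneg (n := n) (t := 2 * s) (by positivity) x
  have hc := thirdConst_pos n
  have h1 : densityConst n * s ^ (-(3 / 2) : ℝ) * heatKernel (2 * s) x =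
      (1 + n) * (thirdConst n * s ^ (-(3 / 2) : ℝ) * heatKernel (2 * s) x) := by
    unfold densityConst; ring
  rw [h1]
  have h2 : 0 ≤ (1 + (n : ℝ)) * (thirdConst n * s ^ (-(3 / 2) : ℝ) * heatKernel (2 * s) x) := by
    positivity
  refine (pi_norm_le_iff_of_nonneg h2).2 fun i => (pi_norm_le_iff_of_nonneg h2).2 fun j =>
    (pi_norm_le_iff_of_nonneg h2).2 fun k => ?_
  exact abs_sub_kron_sum_le i j (abs_heatThird_le i j k hs x)
    (fun l => abs_heatThird_le l l k hs x)

theorem norm_oseenDensityDeriv_le {s : ℝ} (hs : 0 < s) (h x : Rn n) :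
    ‖oseenDensityDeriv s h x‖ ≤
      densityConst n * s ^ (-2 : ℝ) * ‖h‖ * heatKernel (2 * s) x := by
  have hk2 := heatKernel_nonneg (n := n) (t := 2 * s) (by positivity) x
  have hc := thirdConst_pos n
  have h1 : densityConst n * s ^ (-2 : ℝ) * ‖h‖ * heatKernel (2 * s) x =
      (1 + n) * (thirdConst n * s ^ (-2 : ℝ) * ‖h‖ * heatKernel (2 * s) x) := by
    unfold densityConst; ring
  rw [h1]
  have h2 : 0 ≤ (1 + (n : ℝ)) * (thirdConst n * s ^ (-2 : ℝ) * ‖h‖ * heatKernel (2 * s) x) := by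
    positivity
  refine (pi_norm_le_iff_of_nonneg h2).2 fun i => (pi_norm_le_iff_of_nonneg h2).2 fun j =>
    (pi_norm_le_iff_of_nonneg h2).2 fun k => ?_
  exact abs_sub_kron_sum_le i j (abs_heatThirdDeriv_le i j k hs h x)
    (fun l => abs_heatThirdDeriv_le l l k hs h x)

theorem hasDerivAt_oseenDensity_line (s : ℝ) (h x : Rn n) (θ : ℝ) :
    HasDerivAt (fun θ : ℝ => oseenDensity s (x + θ • h))
      (oseenDensityDeriv s h (x + θ • h)) θ := by
  refine hasDerivAt_pi.2 fun i => hasDerivAt_pi.2 fun j => hasDerivAt_pi.2 fun k => ?_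
  refine (hasDerivAt_heatThird_line i j k s x h θ).sub (HasDerivAt.const_mul _ ?_)
  exact HasDerivAt.fun_sum fun l _ => hasDerivAt_heatThird_line l l k s x h θ

theorem continuous_heatThirdDeriv (i j k : Fin n) (s : ℝ) (h : Rn n) :
    Continuous (heatThirdDeriv i j k s h) := by
  have := continuous_heatKernel (n := n) s
  unfold heatThirdDeriv heatPoly heatPolyDeriv
  fun_prop

theorem continuous_oseenDensityDeriv (s : ℝ) (h : Rn n) : Continuous (oseenDensityDeriv s h) := by
  unfold oseenDensityDeriv
  refine continuous_pi fun i => continuous_pi fun j => continuous_pi fun k => ?_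
  exact (continuous_heatThirdDeriv i j k s h).sub (continuous_const.mul
    (continuous_finsetSum _ fun l _ => continuous_heatThirdDeriv l l k s h))

theorem measurable_heatThird (i j k : Fin n) :
    Measurable fun z : ℝ × Rn n => heatThird i j k z.1 z.2 := by
  have := measurable_heatKernel (n := n)
  unfold heatThird heatPoly
  refine Measurable.mul ?_ this
  fun_prop

theorem measurable_oseenDensity : Measurable fun z : ℝ × Rn n => oseenDensity z.1 z.2 := by
  unfold oseenDensity
  refine measurable_pi_lambda _ fun i => measurable_pi_lambda _ fun j =>
    measurable_pi_lambda _ fun k => ?_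
  exact (measurable_heatThird i j k).sub (measurable_const.mul
    (Finset.measurable_sum _ fun l _ => measurable_heatThird l l k))

theorem lintegral_oseenDensity_le {s : ℝ} (hs : 0 < s) :
    ∫⁻ x : Rn n, ‖oseenDensity s x‖ₑ ≤ ENNReal.ofReal (densityConst n * s ^ (-(3 / 2) : ℝ)) := by
  have hc := densityConst_pos n
  rw [← lintegral_const_mul_heatKernel (n := n) (s := 2 * s) (by positivity) (by positivity)]
  refine lintegral_mono fun x => ?_
  rw [← ofReal_norm]
  exact ENNReal.ofReal_le_ofReal (norm_oseenDensity_le hs x)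

/-- Interpolation of a size bound with a Lipschitz bound, giving a Hölder bound of exponent α. -/
theorem min_le_mul_rpow {A u α : ℝ} (hA : 0 ≤ A) (hu : 0 ≤ u) (hα : 0 ≤ α)
    (hα1 : α ≤ 1) : min (2 * A) (A * u) ≤ 2 * A * u ^ α := by
  rcases le_total 1 u with h | h
  · refine (min_le_left _ _).trans ?_
    nlinarith [Real.one_le_rpow h hα]
  · refine (min_le_right _ _).trans ?_
    have : u ≤ u ^ α := by
      simpa using Real.rpow_le_rpow_of_exponent_ge_of_imp hu h hα1 (fun _ h => absurd h one_ne_zero)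
    nlinarith [Real.rpow_nonneg hu α]

/-- The trivial bound of order s^{-3/2} and the gradient bound of order |h| s^{-2} differ by the
factor u = |h| s^{-1/2}, in which they are interpolated. -/
theorem lintegral_oseenDensity_shift_le {s : ℝ} (hs : 0 < s) (h : Rn n) {α : ℝ} (hα : 0 ≤ α)
    (hα1 : α ≤ 1) :
    ∫⁻ x : Rn n, ‖oseenDensity s (x + h) - oseenDensity s x‖ₑ ≤
      ENNReal.ofReal (2 * densityConst n * ‖h‖ ^ α * s ^ (-(3 / 2) - α / 2 : ℝ)) := by
  have hc := densityConst_pos n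
  have h1 : ∫⁻ x : Rn n, ‖oseenDensity s (x + h) - oseenDensity s x‖ₑ ≤
      ENNReal.ofReal (2 * (densityConst n * s ^ (-(3 / 2) : ℝ))) := by
    have hm : Measurable fun x : Rn n => ‖oseenDensity s (x + h)‖ₑ :=
      (measurable_oseenDensity.comp
        (measurable_const.prodMk (measurable_id.add_const h))).enorm
    calc _ ≤ ∫⁻ x : Rn n, (‖oseenDensity s (x + h)‖ₑ + ‖oseenDensity s x‖ₑ) :=
          lintegral_mono fun x => enorm_sub_le
      _ = (∫⁻ x : Rn n, ‖oseenDensity s (x + h)‖ₑ) + ∫⁻ x : Rn n, ‖oseenDensity s x‖ₑ :=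
          lintegral_add_left hm _
      _ ≤ ENNReal.ofReal (densityConst n * s ^ (-(3 / 2) : ℝ)) +
          ENNReal.ofReal (densityConst n * s ^ (-(3 / 2) : ℝ)) := by
          refine add_le_add ?_ (lintegral_oseenDensity_le hs)
          rw [lintegral_add_right_eq_self (fun x : Rn n => ‖oseenDensity s x‖ₑ) h]
          exact lintegral_oseenDensity_le hs
      _ = _ := by rw [← ENNReal.ofReal_add (by positivity) (by positivity), two_mul]
  have hs2 : s ^ (-2 : ℝ) = s ^ (-(3 / 2) : ℝ) * s ^ (-(1 / 2) : ℝ) := by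
    rw [← Real.rpow_add hs]; norm_num
  have h2 : ∫⁻ x : Rn n, ‖oseenDensity s (x + h) - oseenDensity s x‖ₑ ≤
      ENNReal.ofReal ((densityConst n * s ^ (-(3 / 2) : ℝ)) * (‖h‖ * s ^ (-(1 / 2) : ℝ))) := by
    refine (lintegral_shift_sub_le (fun x θ => hasDerivAt_oseenDensity_line s h x θ)
      (continuous_oseenDensityDeriv s h)).trans ?_
    rw [← lintegral_const_mul_heatKernel (n := n) (s := 2 * s) (by positivity) (by positivity)]
    refine lintegral_mono fun x => ?_
    rw [← ofReal_norm]
    refine ENNReal.ofReal_le_ofReal ((norm_oseenDensityDeriv_le hs h x).trans (le_of_eq ?_))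
    rw [hs2]; ring
  refine (le_min h1 h2).trans ?_
  rw [← ENNReal.ofReal_min]
  refine ENNReal.ofReal_le_ofReal ((min_le_mul_rpow (by positivity) (by positivity) hα hα1).trans
    (le_of_eq ?_))
  rw [Real.mul_rpow (norm_nonneg _) (by positivity), ← Real.rpow_mul hs.le, sub_eq_add_neg,
    Real.rpow_add hs, show -(1 / 2) * α = -(α / 2) by ring]
  ring

/-! ### Estimates for the gradient of the Oseen kernel -/

/-- The time singularity `r^{-1/2-γ}`, extended by zero to `r ≤ 0`. -/
def timeKer (γ r : ℝ) : ℝ := if 0 < r then r ^ (-(1 / 2) - γ) else 0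

theorem timeKer_nonneg (γ r : ℝ) : 0 ≤ timeKer γ r := by
  unfold timeKer; split_ifs with h
  · positivity
  · exact le_rfl

theorem timeKer_of_pos (γ : ℝ) {r : ℝ} (hr : 0 < r) : timeKer γ r = r ^ (-(1 / 2) - γ) := if_pos hr

theorem timeKer_of_nonpos (γ : ℝ) {r : ℝ} (hr : r ≤ 0) : timeKer γ r = 0 := if_neg hr.not_gt

theorem measurable_timeKer (γ : ℝ) : Measurable (timeKer γ) :=
  Measurable.ite measurableSet_Ioi (measurable_id.pow_const _) measurable_const

/-- The gradient of the Oseen kernel as an integral of third derivatives of the heat kernel,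
extended by zero to nonpositive times. -/
def oseenGrad (t : ℝ) (x : Rn n) : Tensor3 n :=
  if 0 < t then ∫ s in Ioi t, oseenDensity s x else 0

theorem oseenGrad_of_pos {t : ℝ} (ht : 0 < t) (x : Rn n) :
    oseenGrad t x = ∫ s in Ioi t, oseenDensity s x := if_pos ht

theorem oseenGrad_of_nonpos {t : ℝ} (ht : t ≤ 0) (x : Rn n) : oseenGrad t x = 0 := if_neg ht.not_gt

theorem measurable_oseenGrad : Measurable fun z : ℝ × Rn n => oseenGrad z.1 z.2 := by
  unfold oseenGrad
  refine Measurable.ite (measurableSet_lt measurable_const measurable_fst) ?_ measurable_const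
  have h1 : ∀ z : ℝ × Rn n, ∫ s in Ioi z.1, oseenDensity s z.2 =
      ∫ s, {w : (ℝ × Rn n) × ℝ | w.1.1 < w.2}.indicator
        (fun w => oseenDensity w.2 w.1.2) (z, s) := by
    intro z
    rw [← integral_indicator measurableSet_Ioi]
    rfl
  simp_rw [h1]
  have h2 : Measurable ({w : (ℝ × Rn n) × ℝ | w.1.1 < w.2}.indicator
      (fun w => oseenDensity w.2 w.1.2)) := by
    refine Measurable.indicator ?_ (measurableSet_lt (by fun_prop) (by fun_prop))
    exact measurable_oseenDensity.comp (measurable_snd.prodMk (measurable_snd.comp measurable_fst))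
  exact (h2.stronglyMeasurable.integral_prod_right').measurable

theorem integrableOn_oseenDensity {t : ℝ} (ht : 0 < t) (x : Rn n) :
    IntegrableOn (fun s => oseenDensity s x) (Ioi t) := by
  have hc := densityConst_pos n
  refine Integrable.mono' (g := fun s => densityConst n * (8 * Real.pi * t) ^ (-(n : ℝ) / 2) *
    s ^ (-(3 / 2) : ℝ)) ?_ ?_ ?_
  · exact (integrableOn_Ioi_rpow_of_lt (by norm_num) ht).const_mul _
  · exact (measurable_oseenDensity.comp (measurable_id.prodMk measurable_const)).aestronglyMeasurable
  · refine (ae_restrict_iff' measurableSet_Ioi).2 (ae_of_all _ fun s (hs : t < s) => ?_)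
    have hs0 : 0 < s := ht.trans hs
    refine (norm_oseenDensity_le hs0 x).trans ?_
    rw [mul_right_comm]
    refine mul_le_mul_of_nonneg_right (mul_le_mul_of_nonneg_left ?_ hc.le) (by positivity)
    refine (heatKernel_le (by positivity) x).trans ?_
    refine Real.rpow_le_rpow_of_nonpos (by positivity) ?_ ?_
    · have := Real.pi_pos
      nlinarith
    · rw [neg_div]; exact neg_nonpos.2 (by positivity)

theorem lintegral_enorm_setIntegral_le {E : Type*} [NormedAddCommGroup E] [NormedSpace ℝ E]
    [MeasurableSpace E] [OpensMeasurableSpace E]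
    {F : ℝ → Rn n → E} (hF : Measurable (Function.uncurry F)) (I : Set ℝ) :
    ∫⁻ x, ‖∫ s in I, F s x‖ₑ ≤ ∫⁻ s in I, ∫⁻ x, ‖F s x‖ₑ := by
  calc _ ≤ ∫⁻ x, ∫⁻ s in I, ‖F s x‖ₑ :=
        lintegral_mono fun x => enorm_integral_le_lintegral_enorm _
    _ = _ := lintegral_lintegral_swap (hF.comp measurable_swap).enorm.aemeasurable

theorem setLIntegral_Ioi_const_mul_rpow {c b t : ℝ} (hc : 0 ≤ c) (hb : b < -1) (ht : 0 < t) :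
    ∫⁻ s in Ioi t, ENNReal.ofReal (c * s ^ b) = ENNReal.ofReal (c * (t ^ (b + 1) / -(b + 1))) := by
  simp_rw [ENNReal.ofReal_mul hc]
  rw [lintegral_const_mul' _ _ ENNReal.ofReal_ne_top, ← lintegral_Ioi_rpow hb ht]
  congr 1
  exact setLIntegral_congr_fun measurableSet_Ioi fun s (hs : t < s) =>
    (ENNReal.ofReal_rpow_of_pos (ht.trans hs)).symm

/-- Integration of s^{-3/2} over (t,∞) gives 2 t^{-1/2}. -/
theorem lintegral_oseenGrad_le (t : ℝ) :
    ∫⁻ x : Rn n, ‖oseenGrad t x‖ₑ ≤ ENNReal.ofReal (2 * densityConst n * timeKer 0 t) := by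
  have hc := densityConst_pos n
  rcases le_or_gt t 0 with ht | ht
  · simp [oseenGrad_of_nonpos ht]
  simp_rw [oseenGrad_of_pos ht, timeKer_of_pos 0 ht]
  refine (lintegral_enorm_setIntegral_le measurable_oseenDensity _).trans ?_
  calc _ ≤ ∫⁻ s in Ioi t, ENNReal.ofReal (densityConst n * s ^ (-(3 / 2) : ℝ)) :=
        setLIntegral_mono' measurableSet_Ioi fun s (hs : t < s) =>
          lintegral_oseenDensity_le (ht.trans hs)
    _ = _ := by
        rw [setLIntegral_Ioi_const_mul_rpow hc.le (by norm_num) ht]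
        congr 1
        rw [show (-(3 / 2) + 1 : ℝ) = -(1 / 2) - 0 by norm_num]
        ring

theorem lintegral_oseenGrad_shift_le (t : ℝ) (h : Rn n) {α : ℝ} (hα : 0 ≤ α) (hα1 : α ≤ 1) :
    ∫⁻ x : Rn n, ‖oseenGrad t (x + h) - oseenGrad t x‖ₑ ≤
      ENNReal.ofReal (4 * densityConst n * ‖h‖ ^ α * timeKer (α / 2) t) := by
  have hc := densityConst_pos n
  rcases le_or_gt t 0 with ht | ht
  · simp [oseenGrad_of_nonpos ht]
  have h1 : ∀ x : Rn n, oseenGrad t (x + h) - oseenGrad t x =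
      ∫ s in Ioi t, (oseenDensity s (x + h) - oseenDensity s x) := fun x => by
    rw [oseenGrad_of_pos ht, oseenGrad_of_pos ht,
      integral_sub (integrableOn_oseenDensity ht _) (integrableOn_oseenDensity ht _)]
  simp_rw [h1, timeKer_of_pos _ ht]
  refine (lintegral_enorm_setIntegral_le (F := fun s x => oseenDensity s (x + h) - oseenDensity s x)
    ?_ _).trans ?_
  · exact (measurable_oseenDensity.comp (measurable_fst.prodMk (measurable_snd.add_const h))).sub
      measurable_oseenDensity
  calc _ ≤ ∫⁻ s in Ioi t,
        ENNReal.ofReal (2 * densityConst n * ‖h‖ ^ α * s ^ (-(3 / 2) - α / 2 : ℝ)) :=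
        setLIntegral_mono' measurableSet_Ioi fun s (hs : t < s) =>
          lintegral_oseenDensity_shift_le (ht.trans hs) h hα hα1
    _ ≤ _ := by
        rw [setLIntegral_Ioi_const_mul_rpow (by positivity) (by linarith) ht]
        refine ENNReal.ofReal_le_ofReal ?_
        rw [show (-(3 / 2) - α / 2 + 1 : ℝ) = -(1 / 2) - α / 2 by ring]
        have hp : 0 ≤ densityConst n * ‖h‖ ^ α * t ^ (-(1 / 2) - α / 2) := by positivity
        rw [mul_div_assoc', div_le_iff₀ (by linarith)]
        nlinarith

/-- Thanks to the extension by zero, Duhamel integrals at two times can be subtracted under one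
integral over all s > 0. For positive times the difference is the integral of the density over (r,
r₀), bounded by multiples of r^{-1/2} and of (r₀-r) r^{-3/2}, then interpolated. If r ≤ 0 < r₀ only
one kernel remains, and r₀ ≤ r₀ - r supplies the power of |r - r₀|. -/
theorem oseenGrad_sub_le_of_lt {r r₀ γ : ℝ} (hr : r ≤ r₀) (hγ : 0 ≤ γ) (hγ1 : γ ≤ 1) :
    ∫⁻ x : Rn n, ‖oseenGrad r x - oseenGrad r₀ x‖ₑ ≤
      ENNReal.ofReal (2 * densityConst n * |r - r₀| ^ γ * (timeKer γ r + timeKer γ r₀)) := by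
  have hc := densityConst_pos n
  rcases le_or_gt r₀ 0 with hr₀ | hr₀
  · simp [oseenGrad_of_nonpos hr₀, oseenGrad_of_nonpos (hr.trans hr₀)]
  have habs : |r - r₀| = r₀ - r := by rw [abs_sub_comm, abs_of_nonneg (by linarith)]
  rcases le_or_gt r 0 with hr0 | hr0
  · simp_rw [oseenGrad_of_nonpos hr0, zero_sub, enorm_neg]
    refine (lintegral_oseenGrad_le r₀).trans (ENNReal.ofReal_le_ofReal ?_)
    rw [timeKer_of_nonpos γ hr0, zero_add, timeKer_of_pos _ hr₀, timeKer_of_pos _ hr₀, habs,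
      mul_assoc (2 * densityConst n)]
    refine mul_le_mul_of_nonneg_left ?_ (by positivity)
    calc r₀ ^ (-(1 / 2) - 0 : ℝ) = r₀ ^ γ * r₀ ^ (-(1 / 2) - γ) := by
          rw [← Real.rpow_add hr₀]; congr 1; ring
      _ ≤ _ := by
          gcongr
          linarith
  · have hsub : ∀ x : Rn n, oseenGrad r x - oseenGrad r₀ x = ∫ s in Ioc r r₀, oseenDensity s x := by
      intro x
      rw [oseenGrad_of_pos hr0, oseenGrad_of_pos hr₀, ← Ioc_union_Ioi_eq_Ioi hr,
        setIntegral_union (Ioc_disjoint_Ioi le_rfl) measurableSet_Ioi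
          ((integrableOn_oseenDensity hr0 x).mono_set Ioc_subset_Ioi_self)
          (integrableOn_oseenDensity hr₀ x), add_sub_cancel_right]
    simp_rw [hsub]
    have h1 : ∫⁻ x : Rn n, ‖∫ s in Ioc r r₀, oseenDensity s x‖ₑ ≤
        ∫⁻ s in Ioc r r₀, ENNReal.ofReal (densityConst n * s ^ (-(3 / 2) : ℝ)) :=
      (lintegral_enorm_setIntegral_le measurable_oseenDensity _).trans
        (setLIntegral_mono' measurableSet_Ioc fun s hs =>
          lintegral_oseenDensity_le (hr0.trans hs.1))
    have h2 : ∫⁻ s in Ioc r r₀, ENNReal.ofReal (densityConst n * s ^ (-(3 / 2) : ℝ)) ≤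
        ENNReal.ofReal (2 * (densityConst n * r ^ (-(1 / 2) : ℝ))) := by
      refine (lintegral_mono_set Ioc_subset_Ioi_self).trans (le_of_eq ?_)
      rw [setLIntegral_Ioi_const_mul_rpow hc.le (by norm_num) hr0]
      congr 1
      rw [show (-(3 / 2) + 1 : ℝ) = -(1 / 2) by norm_num]
      ring
    have h3 : ∫⁻ s in Ioc r r₀, ENNReal.ofReal (densityConst n * s ^ (-(3 / 2) : ℝ)) ≤
        ENNReal.ofReal ((densityConst n * r ^ (-(1 / 2) : ℝ)) * ((r₀ - r) * r⁻¹)) := by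
      calc _ ≤ ∫⁻ s in Ioc r r₀, ENNReal.ofReal (densityConst n * r ^ (-(3 / 2) : ℝ)) := by
            refine setLIntegral_mono' measurableSet_Ioc fun s hs => ENNReal.ofReal_le_ofReal ?_
            refine mul_le_mul_of_nonneg_left ?_ hc.le
            exact Real.rpow_le_rpow_of_nonpos hr0 hs.1.le (by norm_num)
        _ = _ := by
            rw [setLIntegral_const, Real.volume_Ioc, ← ENNReal.ofReal_mul (by positivity)]
            congr 1
            rw [show (-(3 / 2) : ℝ) = -(1 / 2) + (-1) by norm_num, Real.rpow_add hr0,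
              Real.rpow_neg_one]
            ring
    refine (h1.trans (le_min h2 h3)).trans ?_
    rw [← ENNReal.ofReal_min]
    refine ENNReal.ofReal_le_ofReal ((min_le_mul_rpow (by positivity)
      (mul_nonneg (by linarith) (by positivity)) hγ hγ1).trans ?_)
    rw [habs, timeKer_of_pos _ hr0, Real.mul_rpow (by linarith) (by positivity),
      Real.inv_rpow hr0.le, ← Real.rpow_neg hr0.le,
      show (-(1 / 2) - γ : ℝ) = -(1 / 2) + -γ by ring, Real.rpow_add hr0]
    have h4 := timeKer_nonneg γ r₀
    have h5 : 0 ≤ 2 * densityConst n * (r₀ - r) ^ γ := by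
      have : 0 ≤ r₀ - r := by linarith
      positivity
    calc _ = 2 * densityConst n * (r₀ - r) ^ γ * (r ^ (-(1 / 2) : ℝ) * r ^ (-γ)) := by ring
      _ ≤ _ := mul_le_mul_of_nonneg_left (by linarith) h5

theorem lintegral_oseenGrad_sub_le (r r₀ : ℝ) {γ : ℝ} (hγ : 0 ≤ γ) (hγ1 : γ ≤ 1) :
    ∫⁻ x : Rn n, ‖oseenGrad r x - oseenGrad r₀ x‖ₑ ≤
      ENNReal.ofReal (2 * densityConst n * |r - r₀| ^ γ * (timeKer γ r + timeKer γ r₀)) := by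
  rcases le_total r r₀ with h | h
  · exact oseenGrad_sub_le_of_lt h hγ hγ1
  · have := oseenGrad_sub_le_of_lt (n := n) h hγ hγ1
    rw [abs_sub_comm, add_comm] at this
    simpa only [enorm_sub_rev] using this

/-! ### Gaussian Fourier integrals -/

/-- The damped character `exp(i x·ξ - s|ξ|²)`. -/
def gaussChar (s : ℝ) (x ξ : Rn n) : ℂ :=
  Complex.exp (Complex.I * ((inner ℝ x ξ : ℝ) : ℂ) - ((s * ‖ξ‖ ^ 2 : ℝ) : ℂ))

/-- The Fourier integral of `g` against a Gaussian. -/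
def gaussFourier (s : ℝ) (g : Rn n → ℂ) (x : Rn n) : ℂ := ∫ ξ, gaussChar s x ξ * g ξ

theorem norm_gaussChar (s : ℝ) (x ξ : Rn n) : ‖gaussChar s x ξ‖ = Real.exp (-(s * ‖ξ‖ ^ 2)) := by
  unfold gaussChar
  rw [Complex.norm_exp]
  simp [← Complex.ofReal_pow]

theorem continuous_gaussChar : Continuous fun z : ℝ × Rn n × Rn n => gaussChar z.1 z.2.1 z.2.2 := by
  unfold gaussChar
  fun_prop

/-- Measurable functions dominated by a power of the norm. -/
def PowBounded (m : ℕ) (g : Rn n → ℂ) : Prop :=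
  Measurable g ∧ ∃ C : ℝ, ∀ ξ, ‖g ξ‖ ≤ C * ‖ξ‖ ^ m

theorem integrable_pow_mul_exp (m : ℕ) {s : ℝ} (hs : 0 < s) :
    Integrable fun ξ : Rn n => ‖ξ‖ ^ m * Real.exp (-(s * ‖ξ‖ ^ 2)) := by
  have ht : 0 < 1 / (4 * s) := by positivity
  set t := 1 / (4 * s) with htdef
  have hk : ∀ ξ : Rn n, Real.exp (-(s * ‖ξ‖ ^ 2)) =
      ((4 * Real.pi * t) ^ (-(n : ℝ) / 2))⁻¹ * heatKernel t ξ := by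
    intro ξ
    unfold heatKernel
    rw [inv_mul_cancel_left₀ (by positivity)]
    congr 1
    rw [htdef]
    field_simp
  refine Integrable.mono' (g := fun ξ => ((4 * Real.pi * t) ^ (-(n : ℝ) / 2))⁻¹ *
    (heatConst n m * t ^ ((m : ℝ) / 2) * heatKernel (2 * t) ξ)) ?_ ?_ ?_
  · exact ((integrable_heatKernel (by positivity)).const_mul _).const_mul _
  · exact (Continuous.measurable (by fun_prop)).aestronglyMeasurable
  · refine ae_of_all _ fun ξ => ?_
    rw [Real.norm_of_nonneg (by positivity), hk ξ, mul_left_comm]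
    exact mul_le_mul_of_nonneg_left (norm_pow_mul_heatKernel_le m ht ξ) (by positivity)

theorem PowBounded.integrable {m : ℕ} {g : Rn n → ℂ} (hg : PowBounded m g) {s : ℝ} (hs : 0 < s)
    (x : Rn n) : Integrable fun ξ => gaussChar s x ξ * g ξ := by
  obtain ⟨hm, C, hC⟩ := hg
  refine Integrable.mono' ((integrable_pow_mul_exp m hs).const_mul C) ?_ ?_
  · refine Measurable.aestronglyMeasurable (Measurable.mul ?_ hm)
    exact (continuous_gaussChar.comp (by fun_prop : Continuous fun ξ : Rn n => (s, x, ξ))).measurable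
  · refine ae_of_all _ fun ξ => ?_
    rw [norm_mul, norm_gaussChar]
    calc _ ≤ Real.exp (-(s * ‖ξ‖ ^ 2)) * (C * ‖ξ‖ ^ m) := by gcongr; exact hC ξ
      _ = _ := by ring

theorem PowBounded.mul_inner {m : ℕ} {g : Rn n → ℂ} (hg : PowBounded m g) (h : Rn n) :
    PowBounded (m + 1) fun ξ => Complex.I * ((inner ℝ h ξ : ℝ) : ℂ) * g ξ := by
  obtain ⟨hm, C, hC⟩ := hg
  refine ⟨Measurable.mul (Continuous.measurable (by fun_prop)) hm, ‖h‖ * C, fun ξ => ?_⟩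
  rw [norm_mul, norm_mul, Complex.norm_I, one_mul, Complex.norm_real]
  calc _ ≤ ‖h‖ * ‖ξ‖ * (C * ‖ξ‖ ^ m) := by
        gcongr
        · exact norm_inner_le_norm h ξ
        · exact hC ξ
    _ = _ := by ring

/-- Differentiation under the integral. The modulus of the damped character does not depend on the
point, so |ξ|^{m+1} e^{-s|ξ|²} dominates for all θ. -/
theorem hasDerivAt_gaussFourier_line {m : ℕ} {g : Rn n → ℂ} (hg : PowBounded m g) {s : ℝ}
    (hs : 0 < s) (x h : Rn n) :
    HasDerivAt (fun θ : ℝ => gaussFourier s g (x + θ • h))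
      (gaussFourier s (fun ξ => Complex.I * ((inner ℝ h ξ : ℝ) : ℂ) * g ξ) x) 0 := by
  have hg' := hg.mul_inner h
  obtain ⟨hm', C', hC'⟩ := hg'
  have hmeas : ∀ (y : Rn n) (u : Rn n → ℂ), Measurable u →
      AEStronglyMeasurable (fun ξ => gaussChar s y ξ * u ξ) volume := by
    intro y u hu
    refine Measurable.aestronglyMeasurable (Measurable.mul ?_ hu)
    exact (continuous_gaussChar.comp (by fun_prop : Continuous fun ξ : Rn n => (s, y, ξ))).measurable
  have key := hasDerivAt_integral_of_dominated_loc_of_deriv_le (μ := (volume : Measure (Rn n)))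
    (x₀ := (0 : ℝ)) (s := univ) (F := fun θ ξ => gaussChar s (x + θ • h) ξ * g ξ)
    (F' := fun θ ξ => gaussChar s (x + θ • h) ξ * (Complex.I * ((inner ℝ h ξ : ℝ) : ℂ) * g ξ))
    (bound := fun ξ => C' * (‖ξ‖ ^ (m + 1) * Real.exp (-(s * ‖ξ‖ ^ 2)))) univ_mem
    (Eventually.of_forall fun θ => hmeas _ _ hg.1) (hg.integrable hs _) (hmeas _ _ hm') ?_
    ((integrable_pow_mul_exp (m + 1) hs).const_mul C') ?_
  · simpa [gaussFourier] using key.2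
  · refine ae_of_all _ fun ξ θ _ => ?_
    rw [norm_mul, norm_gaussChar]
    calc _ ≤ Real.exp (-(s * ‖ξ‖ ^ 2)) * (C' * ‖ξ‖ ^ (m + 1)) := by gcongr; exact hC' ξ
      _ = _ := by ring
  · refine ae_of_all _ fun ξ θ _ => ?_
    have h1 : HasDerivAt (fun θ : ℝ => (inner ℝ (x + θ • h) ξ : ℝ)) (inner ℝ h ξ) θ := by
      have h0 : ∀ θ : ℝ, (inner ℝ (x + θ • h) ξ : ℝ) = inner ℝ x ξ + θ * inner ℝ h ξ := by
        intro θ; rw [inner_add_left, real_inner_smul_left]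
      simp_rw [h0]
      simpa using ((hasDerivAt_id θ).mul_const (inner ℝ h ξ : ℝ)).const_add (inner ℝ x ξ : ℝ)
    have h2 := ((h1.ofReal_comp.const_mul Complex.I).sub_const ((s * ‖ξ‖ ^ 2 : ℝ) : ℂ)).cexp
    refine (h2.mul_const (g ξ)).congr_deriv ?_
    unfold gaussChar
    ring

theorem gaussFourier_one {s : ℝ} (hs : 0 < s) (x : Rn n) :
    gaussFourier s (fun _ => 1) x = (((2 * Real.pi) ^ n * heatKernel s x : ℝ) : ℂ) := by
  have h := GaussianFourier.integral_cexp_neg_mul_sq_norm_add (V := Rn n) (b := (s : ℂ))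
    (by simpa using hs) Complex.I x
  have h1 : gaussFourier s (fun _ => 1) x =
      ∫ v : Rn n, Complex.exp (-(s : ℂ) * ‖v‖ ^ 2 + Complex.I * (inner ℝ x v : ℝ)) := by
    unfold gaussFourier gaussChar
    refine integral_congr_ae (ae_of_all _ fun v => ?_)
    simp only [mul_one]
    congr 1
    push_cast
    ring
  rw [h1, h, finrank_euclideanSpace_fin]
  have h2 : ((Real.pi : ℂ) / s) ^ ((n : ℂ) / 2) = (((Real.pi / s) ^ ((n : ℝ) / 2) : ℝ) : ℂ) := by
    rw [Complex.ofReal_cpow (by positivity)]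
    push_cast
    rfl
  have h3 : Complex.exp (Complex.I ^ 2 * ‖x‖ ^ 2 / (4 * s)) =
      ((Real.exp (-‖x‖ ^ 2 / (4 * s)) : ℝ) : ℂ) := by
    rw [Complex.I_sq]
    push_cast
    congr 1
    ring
  have h4 : (Real.pi / s) ^ ((n : ℝ) / 2) =
      (2 * Real.pi) ^ n * (4 * Real.pi * s) ^ (-(n : ℝ) / 2) := by
    have e1 : (2 * Real.pi) ^ n = ((2 * Real.pi) ^ 2) ^ ((n : ℝ) / 2) := by
      rw [← Real.rpow_natCast, ← Real.rpow_natCast, ← Real.rpow_mul (by positivity)]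
      congr 1
      push_cast
      ring
    rw [e1, neg_div, Real.rpow_neg (by positivity), ← div_eq_mul_inv,
      ← Real.div_rpow (by positivity) (by positivity)]
    congr 1
    field_simp
    ring
  rw [h2, h3, ← Complex.ofReal_mul, h4, heatKernel, mul_assoc]

/-- Differentiating both sides of a closed formula multiplies the symbol by iξₖ on the left;
uniqueness of derivatives gives the new formula. Three applications to the Gaussian yield
`gaussFourier_third`. -/
theorem gaussFourier_deriv {m : ℕ} {g : Rn n → ℂ} (hg : PowBounded m g) {s : ℝ} (hs : 0 < s)
    {c : ℝ} {F : Rn n → ℝ} (hF : ∀ x, gaussFourier s g x = ((c * F x : ℝ) : ℂ)) {k : Fin n}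
    {D : Rn n → ℝ} {x : Rn n}
    (hD : HasDerivAt (fun θ : ℝ => F (x + θ • EuclideanSpace.single k 1)) (D x) 0) :
    gaussFourier s (fun ξ => Complex.I * (ξ k : ℂ) * g ξ) x = ((c * D x : ℝ) : ℂ) := by
  have h1 := hasDerivAt_gaussFourier_line hg hs x (EuclideanSpace.single k 1)
  simp only [hF, EuclideanSpace.inner_single_left, map_one, one_mul] at h1
  exact h1.unique (hD.const_mul c).ofReal_comp

theorem inner_single_one (x : Rn n) (k : Fin n) :
    (inner ℝ x (EuclideanSpace.single k (1 : ℝ)) : ℝ) = x k := by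
  simp [EuclideanSpace.inner_single_right]

theorem single_apply_kron (i k : Fin n) : (EuclideanSpace.single k (1 : ℝ) : Rn n) i = kron i k := by
  simp [kron]

theorem PowBounded.mul_coord {m : ℕ} {g : Rn n → ℂ} (hg : PowBounded m g) (k : Fin n) :
    PowBounded (m + 1) fun ξ => Complex.I * (ξ k : ℂ) * g ξ := by
  have := hg.mul_inner (EuclideanSpace.single k (1 : ℝ))
  simpa [EuclideanSpace.inner_single_left] using this

theorem powBounded_one : PowBounded 0 (fun _ : Rn n => (1 : ℂ)) :=
  ⟨measurable_const, 1, fun ξ => by simp⟩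

theorem gaussFourier_third {s : ℝ} (hs : 0 < s) (i j k : Fin n) (x : Rn n) :
    gaussFourier s (fun ξ => Complex.I * (ξ i : ℂ) * (Complex.I * (ξ j : ℂ) *
      (Complex.I * (ξ k : ℂ) * 1))) x = (((2 * Real.pi) ^ n * heatThird i j k s x : ℝ) : ℂ) := by
  have b0 := powBounded_one (n := n)
  have b1 := b0.mul_coord k
  have b2 := b1.mul_coord j
  have d0 : ∀ x : Rn n, HasDerivAt
      (fun θ : ℝ => heatKernel s (x + θ • EuclideanSpace.single k (1 : ℝ)))
      ((fun x : Rn n => -(x k / (2 * s)) * heatKernel s x) x) 0 := by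
    intro x
    simpa [inner_single_one] using hasDerivAt_heatKernel_line s x (EuclideanSpace.single k 1) 0
  have a1 := fun x => gaussFourier_deriv b0 hs (gaussFourier_one hs)
    (D := fun x => -(x k / (2 * s)) * heatKernel s x) (d0 x)
  have d1 : ∀ x : Rn n, HasDerivAt
      (fun θ : ℝ => -((x + θ • EuclideanSpace.single j (1 : ℝ)) k / (2 * s)) *
        heatKernel s (x + θ • EuclideanSpace.single j (1 : ℝ)))
      ((fun x : Rn n => (x j * x k / (4 * s ^ 2) - kron k j / (2 * s)) * heatKernel s x) x) 0 := by
    intro x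
    have h1 := hasDerivAt_coord_line x (EuclideanSpace.single j (1 : ℝ)) k 0
    have h2 := hasDerivAt_heatKernel_line s x (EuclideanSpace.single j 1) 0
    refine ((h1.div_const (2 * s)).neg.mul h2).congr_deriv ?_
    simp only [zero_smul, add_zero, single_apply_kron, inner_single_one, Pi.neg_apply]
    field_simp
    ring
  have a2 := fun x => gaussFourier_deriv b1 hs a1
    (D := fun x => (x j * x k / (4 * s ^ 2) - kron k j / (2 * s)) * heatKernel s x) (d1 x)
  have d2 : ∀ x : Rn n, HasDerivAt
      (fun θ : ℝ => ((x + θ • EuclideanSpace.single i (1 : ℝ)) j *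
        (x + θ • EuclideanSpace.single i (1 : ℝ)) k / (4 * s ^ 2) - kron k j / (2 * s)) *
        heatKernel s (x + θ • EuclideanSpace.single i (1 : ℝ)))
      (heatThird i j k s x) 0 := by
    intro x
    have hj := hasDerivAt_coord_line x (EuclideanSpace.single i (1 : ℝ)) j 0
    have hk := hasDerivAt_coord_line x (EuclideanSpace.single i (1 : ℝ)) k 0
    have h2 := hasDerivAt_heatKernel_line s x (EuclideanSpace.single i 1) 0
    refine ((((hj.mul hk).div_const (4 * s ^ 2)).sub_const (kron k j / (2 * s))).mul
      h2).congr_deriv ?_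
    simp only [zero_smul, add_zero, single_apply_kron, inner_single_one, Pi.mul_apply]
    have e1 : kron j i = kron i j := by simp [kron, eq_comm]
    have e2 : kron k i = kron i k := by simp [kron, eq_comm]
    have e3 : kron k j = kron j k := by simp [kron, eq_comm]
    rw [e1, e2, e3, heatThird, heatPoly]
    field_simp
    ring
  exact gaussFourier_deriv b2 hs a2 (D := heatThird i j k s) (d2 x)

/-! ### Identification of the gradient of the Oseen kernel -/

/-- The symbol of the Leray projection. -/
def leraySymbol (i j : Fin n) (ξ : Rn n) : ℝ :=
  (if i = j then 1 else 0) - ξ i * ξ j / ‖ξ‖ ^ 2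

theorem powBounded_leraySymbol (i j : Fin n) :
    PowBounded 0 (fun ξ : Rn n => (leraySymbol i j ξ : ℂ)) := by
  refine ⟨?_, 2, fun ξ => ?_⟩
  · refine Complex.measurable_ofReal.comp ?_
    unfold leraySymbol
    fun_prop
  · rw [pow_zero, mul_one, Complex.norm_real, Real.norm_eq_abs]
    unfold leraySymbol
    refine (abs_sub _ _).trans ?_
    have h1 := abs_kron_le i j
    have h2 : |ξ i * ξ j / ‖ξ‖ ^ 2| ≤ 1 := by
      rw [abs_div, abs_mul, abs_of_nonneg (by positivity : 0 ≤ ‖ξ‖ ^ 2)]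
      refine div_le_one_of_le₀ ?_ (by positivity)
      rw [sq]
      exact mul_le_mul (abs_coord_le ξ i) (abs_coord_le ξ j) (abs_nonneg _) (norm_nonneg _)
    unfold kron at h1
    linarith

theorem gradOseenKernel_eq_re {t : ℝ} (ht : 0 < t) (i j k : Fin n) (x : Rn n) :
    gradOseenKernel i j k t x = ((((2 * Real.pi : ℝ) : ℂ)⁻¹ ^ n) *
      gaussFourier t (fun ξ => Complex.I * (ξ k : ℂ) * (leraySymbol i j ξ : ℂ)) x).re := by
  have h1 := hasDerivAt_gaussFourier_line (powBounded_leraySymbol i j) ht x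
    (EuclideanSpace.single k 1)
  simp only [EuclideanSpace.inner_single_left, map_one, one_mul] at h1
  have h2 := h1.const_mul (((2 * Real.pi : ℝ) : ℂ)⁻¹ ^ n)
  have h3 := Complex.reCLM.hasFDerivAt.comp_hasDerivAt (0 : ℝ) h2
  unfold gradOseenKernel lineDeriv
  exact h3.deriv

/-- The symbol of the density in the integral representation of the gradient. -/
def densitySymbol (i j k : Fin n) (ξ : Rn n) : ℂ :=
  Complex.I * (ξ k : ℂ) * ((leraySymbol i j ξ * ‖ξ‖ ^ 2 : ℝ) : ℂ)

/-- The factor |ξ|² clears the singularity of the projection: the symbol becomes a cubic polynomial,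
that is, a combination of third derivatives of Φ. -/
theorem gaussFourier_densitySymbol {s : ℝ} (hs : 0 < s) (i j k : Fin n) (x : Rn n) :
    gaussFourier s (densitySymbol i j k) x =
      (((2 * Real.pi) ^ n * oseenDensity s x i j k : ℝ) : ℂ) := by
  have hb : ∀ a b c : Fin n, Integrable fun ξ : Rn n => gaussChar s x ξ *
      (Complex.I * (ξ a : ℂ) * (Complex.I * (ξ b : ℂ) * (Complex.I * (ξ c : ℂ) * 1))) :=
    fun a b c => (((powBounded_one.mul_coord c).mul_coord b).mul_coord a).integrable hs x
  have h1 : ∀ ξ : Rn n, densitySymbol i j k ξ =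
      Complex.I * (ξ i : ℂ) * (Complex.I * (ξ j : ℂ) * (Complex.I * (ξ k : ℂ) * 1)) -
      (kron i j : ℂ) * ∑ l, Complex.I * (ξ l : ℂ) * (Complex.I * (ξ l : ℂ) *
        (Complex.I * (ξ k : ℂ) * 1)) := by
    intro ξ
    -- The identity also holds at ξ = 0, where the quotient is 0 by convention and the factor |ξ|²
    -- annihilates the rest.
    have hn : leraySymbol i j ξ * ‖ξ‖ ^ 2 = kron i j * ∑ l, ξ l ^ 2 - ξ i * ξ j := by
      rcases eq_or_ne ξ 0 with rfl | hξ
      · simp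
      · have : ‖ξ‖ ^ 2 = ∑ l, ξ l ^ 2 := by
          rw [EuclideanSpace.norm_sq_eq]; simp
        have hne : ‖ξ‖ ^ 2 ≠ 0 := by simpa using hξ
        rw [leraySymbol, sub_mul, div_mul_cancel₀ _ hne, this, kron]
    have hI : Complex.I ^ 2 = -1 := Complex.I_sq
    have hsum : ∑ l, Complex.I * (ξ l : ℂ) * (Complex.I * (ξ l : ℂ) *
        (Complex.I * (ξ k : ℂ) * 1)) = -(Complex.I * (ξ k : ℂ)) * ∑ l, (ξ l : ℂ) ^ 2 := by
      rw [Finset.mul_sum]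
      refine Finset.sum_congr rfl fun l _ => ?_
      linear_combination (Complex.I * (ξ k : ℂ) * (ξ l : ℂ) ^ 2) * hI
    rw [densitySymbol, hn, hsum]
    push_cast
    linear_combination (-Complex.I * (ξ k : ℂ) * (ξ i : ℂ) * (ξ j : ℂ)) * hI
  unfold gaussFourier
  have h2 : ∀ ξ : Rn n, gaussChar s x ξ * densitySymbol i j k ξ =
      gaussChar s x ξ * (Complex.I * (ξ i : ℂ) * (Complex.I * (ξ j : ℂ) *
        (Complex.I * (ξ k : ℂ) * 1))) - (kron i j : ℂ) * ∑ l, gaussChar s x ξ *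
        (Complex.I * (ξ l : ℂ) * (Complex.I * (ξ l : ℂ) * (Complex.I * (ξ k : ℂ) * 1))) := by
    intro ξ
    rw [h1, mul_sub, ← Finset.mul_sum]
    ring
  simp_rw [h2]
  rw [integral_sub (hb i j k) ((integrable_finsetSum _ fun l _ => hb l l k).const_mul _),
    integral_const_mul, integral_finsetSum _ fun l _ => hb l l k]
  have h3 := fun a b c : Fin n => gaussFourier_third hs a b c x
  unfold gaussFourier at h3
  simp_rw [h3, oseenDensity]
  push_cast
  rw [← Finset.mul_sum]
  ring

/-- Fubini and e^{-t|ξ|²} = ∫ₜ^∞ |ξ|² e^{-s|ξ|²} ds for ξ ≠ 0. Positive dimension makes the origin a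
null set. -/
theorem gaussFourier_leraySymbol_eq {t : ℝ} (ht : 0 < t) (i j k : Fin n) (x : Rn n)
    [NeZero n] :
    gaussFourier t (fun ξ => Complex.I * (ξ k : ℂ) * (leraySymbol i j ξ : ℂ)) x =
      ∫ s in Ioi t, gaussFourier s (densitySymbol i j k) x := by
  set g : Rn n → ℂ := fun ξ => Complex.I * (ξ k : ℂ) * (leraySymbol i j ξ : ℂ) with hg
  have hgP : PowBounded 1 g := (powBounded_leraySymbol i j).mul_coord k
  have hdm : ∀ ξ, densitySymbol i j k ξ = g ξ * ((‖ξ‖ ^ 2 : ℝ) : ℂ) := by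
    intro ξ; simp only [hg, densitySymbol]; push_cast; ring
  have hne : ∀ᵐ ξ : Rn n, ξ ≠ 0 := by
    simp [ae_iff]
  have hexp : ∀ (s : ℝ) (ξ : Rn n), gaussChar s x ξ =
      Complex.exp (Complex.I * ((inner ℝ x ξ : ℝ) : ℂ)) * ((Real.exp (-(‖ξ‖ ^ 2) * s) : ℝ) : ℂ) := by
    intro s ξ
    unfold gaussChar
    rw [Complex.ofReal_exp, ← Complex.exp_add]
    congr 1
    push_cast
    ring
  have hint : Integrable (Function.uncurry fun (ξ : Rn n) (s : ℝ) =>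
      gaussChar s x ξ * densitySymbol i j k ξ) (volume.prod (volume.restrict (Ioi t))) := by
    have hmeas : Measurable (Function.uncurry fun (ξ : Rn n) (s : ℝ) =>
        gaussChar s x ξ * densitySymbol i j k ξ) := by
      refine Measurable.mul ?_ ?_
      · exact (continuous_gaussChar.comp
          (by fun_prop : Continuous fun z : Rn n × ℝ => (z.2, x, z.1))).measurable
      · simp only [hdm]
        exact (hgP.1.comp measurable_fst).mul (Continuous.measurable (by fun_prop))
    refine (integrable_prod_iff hmeas.aestronglyMeasurable).2 ⟨?_, ?_⟩
    · filter_upwards [hne] with ξ hξ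
      have ha : -(‖ξ‖ ^ 2) < 0 := neg_neg_of_pos (by positivity)
      simp only [Function.uncurry_apply_pair, hexp]
      exact (((integrableOn_exp_mul_Ioi ha t).ofReal).const_mul _).mul_const _
    · obtain ⟨hgm, C, hC⟩ := hgP
      refine Integrable.mono' ((integrable_pow_mul_exp 1 ht).const_mul C) ?_ ?_
      · exact (hmeas.norm.stronglyMeasurable.integral_prod_right').aestronglyMeasurable
      · filter_upwards [hne] with ξ hξ
        have ha : -(‖ξ‖ ^ 2) < 0 := neg_neg_of_pos (by positivity)
        have h1 : ∀ s : ℝ, ‖gaussChar s x ξ * densitySymbol i j k ξ‖ =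
            Real.exp (-(‖ξ‖ ^ 2) * s) * (‖g ξ‖ * ‖ξ‖ ^ 2) := by
          intro s
          rw [norm_mul, norm_gaussChar, hdm, norm_mul, Complex.norm_real,
            Real.norm_of_nonneg (by positivity)]
          congr 2
          ring
        simp only [Function.uncurry_apply_pair, h1]
        rw [integral_mul_const, integral_exp_mul_Ioi ha, Real.norm_of_nonneg]
        · have hn2 : ‖ξ‖ ^ 2 ≠ 0 := by positivity
          calc _ = Real.exp (-(t * ‖ξ‖ ^ 2)) * ‖g ξ‖ := by
                rw [neg_div_neg_eq, neg_mul, mul_comm (‖ξ‖ ^ 2) t]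
                field_simp
            _ ≤ Real.exp (-(t * ‖ξ‖ ^ 2)) * (C * ‖ξ‖ ^ 1) := by gcongr; exact hC ξ
            _ = _ := by ring
        · rw [neg_div_neg_eq]; positivity
  unfold gaussFourier
  rw [← integral_integral_swap hint]
  refine integral_congr_ae ?_
  filter_upwards [hne] with ξ hξ
  have ha : -(‖ξ‖ ^ 2) < 0 := neg_neg_of_pos (by positivity)
  have hn2 : ((‖ξ‖ ^ 2 : ℝ) : ℂ) ≠ 0 := by
    rw [Complex.ofReal_ne_zero]; positivity
  simp only [hexp]
  rw [integral_mul_const, integral_const_mul, integral_complex_ofReal, integral_exp_mul_Ioi ha,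
    hdm, neg_div_neg_eq, Complex.ofReal_div]
  field_simp

theorem gradOseenKernel_eq {t : ℝ} (ht : 0 < t) (i j k : Fin n) (x : Rn n) :
    gradOseenKernel i j k t x = oseenGrad t x i j k := by
  -- The index i excludes dimension zero.
  have : NeZero n := ⟨fun h => by subst h; exact i.elim0⟩
  rw [gradOseenKernel_eq_re ht, gaussFourier_leraySymbol_eq ht, oseenGrad_of_pos ht]
  have h1 : ∫ s in Ioi t, gaussFourier s (densitySymbol i j k) x =
      (((2 * Real.pi) ^ n * ∫ s in Ioi t, oseenDensity s x i j k : ℝ) : ℂ) := by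
    rw [← integral_const_mul, ← integral_complex_ofReal]
    exact setIntegral_congr_fun measurableSet_Ioi fun s (hs : t < s) =>
      gaussFourier_densitySymbol (ht.trans hs) i j k x
  have hI := integrableOn_oseenDensity ht x
  rw [h1, ← Complex.ofReal_inv, ← Complex.ofReal_pow, ← Complex.ofReal_mul, Complex.ofReal_re,
    ← mul_assoc, ← mul_pow, inv_mul_cancel₀ (by positivity), one_pow, one_mul,
    eval_integral fun i => hI.eval i, eval_integral fun j => (hI.eval i).eval j,
    eval_integral fun k => ((hI.eval i).eval j).eval k]

/-! ### Singular time integrals -/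

/-- The constant in the bound for the singular time integral. -/
def betaConst (γ β : ℝ) : ℝ := 2⁻¹ ^ (1 / 2 - γ - β) * ((1 - β)⁻¹ + (1 / 2 - γ)⁻¹)

theorem betaConst_pos {γ β : ℝ} (hγ : γ < 1 / 2) (hβ : β < 1) : 0 < betaConst γ β := by
  have h1 : 0 < 1 - β := by linarith
  have h2 : 0 < 1 / 2 - γ := by linarith
  unfold betaConst; positivity

/-- Split at s = t/2: on each half only one of the two factors is singular, and the other is bounded
by its value at t/2. -/
theorem lintegral_timeKer_le {γ β t : ℝ} (hγ0 : 0 ≤ γ) (hγ : γ < 1 / 2) (hβ0 : 0 ≤ β) (hβ : β < 1)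
    (ht : 0 < t) :
    ∫⁻ s in Ioi (0 : ℝ), ENNReal.ofReal (timeKer γ (t - s) * s ^ (-β)) ≤
      ENNReal.ofReal (betaConst γ β * t ^ (1 / 2 - γ - β)) := by
  have ht2 : 0 < t / 2 := by linarith
  -- The midpoint lies in neither open half; it receives the value ∞, harmless on a null set.
  have hpt : ∀ s ∈ Ioi (0 : ℝ), ENNReal.ofReal (timeKer γ (t - s) * s ^ (-β)) ≤
      (Ioo 0 (t / 2)).indicator (fun s => ENNReal.ofReal (t / 2) ^ (-(1 / 2) - γ) *
        ENNReal.ofReal s ^ (-β)) s +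
      (Ioo 0 (t / 2)).indicator (fun s => ENNReal.ofReal (t / 2) ^ (-β) *
        ENNReal.ofReal s ^ (-(1 / 2) - γ)) (t - s) +
      ({t / 2} : Set ℝ).indicator (fun _ => ∞) s := by
    intro s (hs : 0 < s)
    rcases lt_trichotomy s (t / 2) with h | h | h
    · rw [indicator_of_mem (show s ∈ Ioo 0 (t / 2) from ⟨hs, h⟩), add_assoc]
      refine le_add_right ?_
      rw [timeKer_of_pos γ (by linarith), ENNReal.ofReal_rpow_of_pos ht2,
        ENNReal.ofReal_rpow_of_pos hs, ← ENNReal.ofReal_mul (by positivity)]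
      refine ENNReal.ofReal_le_ofReal (mul_le_mul_of_nonneg_right ?_ (by positivity))
      exact Real.rpow_le_rpow_of_nonpos ht2 (by linarith) (by linarith)
    · simp [h]
    · rcases lt_or_ge s t with hst | hst
      · have hr : 0 < t - s := by linarith
        rw [indicator_of_mem (show t - s ∈ Ioo 0 (t / 2) from ⟨hr, by linarith⟩), add_right_comm]
        refine le_add_left ?_
        rw [timeKer_of_pos γ hr, ENNReal.ofReal_rpow_of_pos ht2, ENNReal.ofReal_rpow_of_pos hr,
          ← ENNReal.ofReal_mul (by positivity)]
        refine ENNReal.ofReal_le_ofReal ?_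
        rw [mul_comm]
        refine mul_le_mul_of_nonneg_right ?_ (by positivity)
        exact Real.rpow_le_rpow_of_nonpos ht2 h.le (by linarith)
      · rw [timeKer_of_nonpos γ (by linarith)]
        simp
  have hm1 : Measurable ((Ioo 0 (t / 2)).indicator (fun s : ℝ =>
      ENNReal.ofReal (t / 2) ^ (-(1 / 2) - γ) * ENNReal.ofReal s ^ (-β))) :=
    ((ENNReal.measurable_ofReal.pow_const _).const_mul _).indicator measurableSet_Ioo
  have hm2 : Measurable ((Ioo 0 (t / 2)).indicator (fun s : ℝ =>
      ENNReal.ofReal (t / 2) ^ (-β) * ENNReal.ofReal s ^ (-(1 / 2) - γ))) :=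
    ((ENNReal.measurable_ofReal.pow_const _).const_mul _).indicator measurableSet_Ioo
  calc _ ≤ _ := setLIntegral_mono' measurableSet_Ioi hpt
    _ ≤ _ := setLIntegral_le_lintegral _ _
    _ = ENNReal.ofReal (t / 2) ^ (-(1 / 2) - γ) *
          ENNReal.ofReal ((t / 2) ^ (-β + 1) / (-β + 1)) +
        ENNReal.ofReal (t / 2) ^ (-β) *
          ENNReal.ofReal ((t / 2) ^ (-(1 / 2) - γ + 1) / (-(1 / 2) - γ + 1)) := by
        rw [lintegral_add_right _ (measurable_const.indicator (measurableSet_singleton _)),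
          lintegral_add_left hm1, lintegral_sub_left_eq_self _ t,
          lintegral_indicator measurableSet_Ioo, lintegral_indicator measurableSet_Ioo,
          lintegral_const_mul _ (ENNReal.measurable_ofReal.pow_const _),
          lintegral_const_mul _ (ENNReal.measurable_ofReal.pow_const _),
          lintegral_Ioo_rpow (by linarith) ht2, lintegral_Ioo_rpow (by linarith) ht2,
          lintegral_indicator (measurableSet_singleton _)]
        simp
    _ = _ := by
        rw [ENNReal.ofReal_rpow_of_pos ht2, ENNReal.ofReal_rpow_of_pos ht2,
          ← ENNReal.ofReal_mul (by positivity), ← ENNReal.ofReal_mul (by positivity),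
          ← ENNReal.ofReal_add]
        · congr 1
          have e1 : (t / 2) ^ (-(1 / 2) - γ) * (t / 2) ^ (-β + 1) =
              2⁻¹ ^ (1 / 2 - γ - β) * t ^ (1 / 2 - γ - β) := by
            rw [← Real.rpow_add ht2, ← Real.mul_rpow (by positivity) ht.le]
            congr 1 <;> ring
          have e2 : (t / 2) ^ (-β) * (t / 2) ^ (-(1 / 2) - γ + 1) =
              2⁻¹ ^ (1 / 2 - γ - β) * t ^ (1 / 2 - γ - β) := by
            rw [← Real.rpow_add ht2, ← Real.mul_rpow (by positivity) ht.le]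
            congr 1 <;> ring
          rw [betaConst, ← mul_div_assoc, ← mul_div_assoc, e1, e2,
            show -β + 1 = 1 - β by ring, show -(1 / 2) - γ + 1 = 1 / 2 - γ by ring]
          ring
        · have : 0 ≤ -β + 1 := by linarith
          positivity
        · have : 0 ≤ -(1 / 2) - γ + 1 := by linarith
          positivity

/-- Since e^{-y} ≤ y^{-δ} for y = λr, a slightly stronger time singularity buys the small factor
λ^{-δ}. -/
theorem timeKer_zero_mul_exp_le {lam δ r : ℝ} (hlam : 0 < lam) (hδ0 : 0 < δ) (hδ1 : δ ≤ 1) :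
    timeKer 0 r * Real.exp (-(lam * r)) ≤ lam ^ (-δ) * timeKer δ r := by
  rcases le_or_gt r 0 with hr | hr
  · simp [timeKer_of_nonpos _ hr]
  have hlr : 0 < lam * r := by positivity
  have h1 : (lam * r) ^ δ ≤ Real.exp (lam * r) := by
    have h2 : (lam * r) ^ δ ≤ 1 + lam * r := by
      calc (lam * r) ^ δ ≤ (1 + lam * r) ^ δ := by gcongr; linarith
        _ ≤ (1 + lam * r) ^ (1 : ℝ) := Real.rpow_le_rpow_of_exponent_le (by linarith) hδ1
        _ = _ := Real.rpow_one _
    linarith [Real.add_one_le_exp (lam * r)]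
  have h3 : Real.exp (-(lam * r)) ≤ lam ^ (-δ) * r ^ (-δ) := by
    rw [← Real.mul_rpow hlam.le hr.le, Real.rpow_neg hlr.le, Real.exp_neg]
    exact inv_anti₀ (by positivity) h1
  rw [timeKer_of_pos _ hr, timeKer_of_pos _ hr]
  calc _ ≤ r ^ (-(1 / 2) - 0 : ℝ) * (lam ^ (-δ) * r ^ (-δ)) := by gcongr
    _ = lam ^ (-δ) * (r ^ (-(1 / 2) - 0 : ℝ) * r ^ (-δ)) := by ring
    _ = _ := by rw [← Real.rpow_add hr]; congr 2; ring

/-- For large λ the weight e^{λt}(1 + εt^{-a}) is contracted by 1/2 under the Volterra operator. One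
λ serves all ε because the terms 1 and εt^{-a} are reproduced separately. -/
theorem exists_exp_weight {a T D : ℝ} (ha : 0 ≤ a) (ha2 : a < 1 / 2) (hT : 0 < T) (hD : 0 ≤ D) :
    ∃ lam : ℝ, 0 < lam ∧ ∀ ε : ℝ, 0 < ε → ∀ t : ℝ, 0 < t → t < T →
      ∫⁻ s in Ioi (0 : ℝ), ENNReal.ofReal (D * timeKer 0 (t - s) * s ^ (-a)) *
          ENNReal.ofReal (Real.exp (lam * s) * (1 + ε * s ^ (-a))) ≤
        ENNReal.ofReal (1 / 2 * (Real.exp (lam * t) * (1 + ε * t ^ (-a)))) := by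
  -- Half of the room 1/2 - a is spent on δ, so that 1/2 - δ - a = δ is still positive.
  set δ := (1 / 2 - a) / 2 with hδ
  have hδ0 : 0 < δ := by rw [hδ]; linarith
  have hδ1 : δ < 1 / 2 := by rw [hδ]; linarith
  set c := betaConst δ a + betaConst δ (2 * a) with hc
  have hc1 : 0 < betaConst δ a := betaConst_pos hδ1 (by linarith)
  have hc2 : 0 < betaConst δ (2 * a) := betaConst_pos hδ1 (by linarith)
  -- X is chosen so that λ^{-δ} = 1/X makes D T^δ c λ^{-δ} at most 1/2.
  set X := 2 * D * T ^ δ * c + 1 with hX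
  have hX0 : 0 < X := by positivity
  refine ⟨X ^ (1 / δ), by positivity, fun ε hε t ht htT => ?_⟩
  set lam := X ^ (1 / δ) with hlam
  have hlam0 : 0 < lam := by positivity
  have hlamδ : lam ^ (-δ) = X⁻¹ := by
    rw [hlam, ← Real.rpow_mul hX0.le, ← Real.rpow_neg_one]; congr 1; field_simp
  have hpt : ∀ s ∈ Ioi (0 : ℝ), ENNReal.ofReal (D * timeKer 0 (t - s) * s ^ (-a)) *
      ENNReal.ofReal (Real.exp (lam * s) * (1 + ε * s ^ (-a))) ≤
      ENNReal.ofReal (Real.exp (lam * t) * D * X⁻¹) *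
        (ENNReal.ofReal (timeKer δ (t - s) * s ^ (-a)) +
          ENNReal.ofReal ε * ENNReal.ofReal (timeKer δ (t - s) * s ^ (-(2 * a)))) := by
    intro s (hs : 0 < s)
    have hk0 := timeKer_nonneg 0 (t - s)
    have hkδ := timeKer_nonneg δ (t - s)
    rw [← ENNReal.ofReal_mul (by positivity), ← ENNReal.ofReal_mul (by positivity),
      ← ENNReal.ofReal_add (by positivity) (by positivity),
      ← ENNReal.ofReal_mul (by positivity)]
    refine ENNReal.ofReal_le_ofReal ?_
    have h1 := timeKer_zero_mul_exp_le (r := t - s) hlam0 hδ0 (by linarith)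
    rw [hlamδ] at h1
    have h2 : Real.exp (lam * s) = Real.exp (lam * t) * Real.exp (-(lam * (t - s))) := by
      rw [← Real.exp_add]; congr 1; ring
    have h3 : s ^ (-(2 * a)) = s ^ (-a) * s ^ (-a) := by
      rw [← Real.rpow_add hs]; congr 1; ring
    rw [h2, h3]
    calc _ = Real.exp (lam * t) * D * (s ^ (-a) * (1 + ε * s ^ (-a))) *
          (timeKer 0 (t - s) * Real.exp (-(lam * (t - s)))) := by ring
      _ ≤ Real.exp (lam * t) * D * (s ^ (-a) * (1 + ε * s ^ (-a))) *
          (X⁻¹ * timeKer δ (t - s)) := by gcongr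
      _ = _ := by ring
  have hm : ∀ β : ℝ, Measurable fun s : ℝ => ENNReal.ofReal (timeKer δ (t - s) * s ^ (-β)) :=
    fun β => (((measurable_timeKer δ).comp (measurable_const.sub measurable_id)).mul
      (measurable_id.pow_const _)).ennreal_ofReal
  calc _ ≤ _ := setLIntegral_mono' measurableSet_Ioi hpt
    _ = ENNReal.ofReal (Real.exp (lam * t) * D * X⁻¹) *
        ((∫⁻ s in Ioi (0 : ℝ), ENNReal.ofReal (timeKer δ (t - s) * s ^ (-a))) +
          ENNReal.ofReal ε *
            ∫⁻ s in Ioi (0 : ℝ), ENNReal.ofReal (timeKer δ (t - s) * s ^ (-(2 * a)))) := by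
        rw [lintegral_const_mul' _ _ ENNReal.ofReal_ne_top, lintegral_add_left (hm a),
          lintegral_const_mul' _ _ ENNReal.ofReal_ne_top]
    _ ≤ ENNReal.ofReal (Real.exp (lam * t) * D * X⁻¹) *
        (ENNReal.ofReal (betaConst δ a * t ^ (1 / 2 - δ - a)) +
          ENNReal.ofReal ε * ENNReal.ofReal (betaConst δ (2 * a) * t ^ (1 / 2 - δ - 2 * a))) := by
        gcongr
        · exact lintegral_timeKer_le hδ0.le hδ1 ha (by linarith) ht
        · exact lintegral_timeKer_le hδ0.le hδ1 (by linarith) (by linarith) ht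
    _ ≤ _ := by
        rw [← ENNReal.ofReal_mul hε.le, ← ENNReal.ofReal_add (by positivity) (by positivity),
          ← ENNReal.ofReal_mul (by positivity)]
        refine ENNReal.ofReal_le_ofReal ?_
        have e1 : t ^ (1 / 2 - δ - a) = t ^ δ := by congr 1; rw [hδ]; ring
        have e2 : t ^ (1 / 2 - δ - 2 * a) = t ^ δ * t ^ (-a) := by
          rw [← Real.rpow_add ht]; congr 1; rw [hδ]; ring
        have htδ : t ^ δ ≤ T ^ δ := by gcongr
        have hDX : D * X⁻¹ * (T ^ δ * c) ≤ 1 / 2 := by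
          rw [mul_right_comm, ← div_eq_mul_inv, div_le_iff₀ hX0, hX]
          linarith
        rw [e1, e2]
        calc _ ≤ Real.exp (lam * t) * D * X⁻¹ *
              (c * T ^ δ + ε * (c * (T ^ δ * t ^ (-a)))) := by
              gcongr
              · rw [hc]; linarith
              · rw [hc]; linarith
          _ = D * X⁻¹ * (T ^ δ * c) * (Real.exp (lam * t) * (1 + ε * t ^ (-a))) := by ring
          _ ≤ _ := by gcongr

/-- L depends on a, T and D only, not on the a priori constant M: M merely guarantees that the
weighted supremum is finite, so that half of it can be absorbed. This independence later makes the
K-functional bounds uniform in τ. -/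
theorem volterra_gronwall {a T D : ℝ} (ha : 0 ≤ a) (ha2 : a < 1 / 2) (hT : 0 < T) (hD : 0 ≤ D) :
    ∃ L : ℝ≥0∞, L ≠ ∞ ∧ ∀ (b : ℝ → ℝ≥0∞) (α : ℝ≥0∞) (M : ℝ),
      (∀ t, 0 < t → t < T → b t ≤ ENNReal.ofReal (M * t ^ (-a))) →
      (∀ t, 0 < t → t < T → b t ≤ α +
        ∫⁻ s in Ioi (0 : ℝ), ENNReal.ofReal (D * timeKer 0 (t - s) * s ^ (-a)) * b s) →
      ∀ t, 0 < t → t < T → b t ≤ L * α := by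
  obtain ⟨lam, hlam, hw⟩ := exists_exp_weight ha ha2 hT hD
  refine ⟨ENNReal.ofReal (2 * Real.exp (lam * T)), ENNReal.ofReal_ne_top, ?_⟩
  intro b α M hM hb t ht htT
  -- With α = ∞ the claim is trivial as L ≠ 0; α must be finite for the limit ε → 0 below.
  rcases eq_or_ne α ∞ with rfl | hα
  · rw [ENNReal.mul_top]
    · exact le_top
    · simpa using Real.exp_pos _
  have key : ∀ ε : ℝ, 0 < ε → ∀ t, 0 < t → t < T →
      b t ≤ 2 * α * ENNReal.ofReal (Real.exp (lam * t) * (1 + ε * t ^ (-a))) := by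
    intro ε hε
    set w : ℝ → ℝ≥0∞ := fun t => ENNReal.ofReal (Real.exp (lam * t) * (1 + ε * t ^ (-a))) with hwdef
    have hw1 : ∀ t, 0 < t → 1 ≤ w t := by
      intro t ht
      rw [hwdef, ENNReal.one_le_ofReal]
      have h1 : 1 ≤ Real.exp (lam * t) := Real.one_le_exp (by positivity)
      have h2 : 0 ≤ ε * t ^ (-a) := by positivity
      nlinarith
    have hwt : ∀ t, w t ≠ ∞ := fun t => ENNReal.ofReal_ne_top
    have hw0 : ∀ t, 0 < t → w t ≠ 0 := fun t ht => (zero_lt_one.trans_le (hw1 t ht)).ne'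
    set N : ℝ≥0∞ := ⨆ (t : ℝ) (_ : 0 < t ∧ t < T), b t / w t with hN
    have hNle : ∀ t, 0 < t → t < T → b t ≤ N * w t := by
      intro t ht htT
      rw [← ENNReal.div_le_iff (hw0 t ht) (hwt t), hN]
      exact le_iSup₂ (f := fun (t : ℝ) (_ : 0 < t ∧ t < T) => b t / w t) t ⟨ht, htT⟩
    -- The summand εt^{-a} of the weight is there for this: it dominates M t^{-a} up to the factor
    -- |M|/ε.
    have hNfin : N ≠ ∞ := by
      refine ne_top_of_le_ne_top (ENNReal.ofReal_ne_top (r := |M| / ε)) (iSup₂_le fun t ht => ?_)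
      rw [ENNReal.div_le_iff (hw0 t ht.1) (hwt t), hwdef, ← ENNReal.ofReal_mul (by positivity)]
      refine (hM t ht.1 ht.2).trans (ENNReal.ofReal_le_ofReal ?_)
      have h1 : 1 ≤ Real.exp (lam * t) := Real.one_le_exp (mul_pos hlam ht.1).le
      have h2 : 0 ≤ t ^ (-a) := Real.rpow_nonneg ht.1.le _
      calc M * t ^ (-a) ≤ |M| * t ^ (-a) := mul_le_mul_of_nonneg_right (le_abs_self M) h2
        _ = |M| / ε * (1 * (0 + ε * t ^ (-a))) := by field_simp; ring
        _ ≤ _ := by gcongr; exact zero_le_one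
    have hN2 : N ≤ α + N / 2 := by
      refine iSup₂_le fun t ht => ?_
      rw [ENNReal.div_le_iff (hw0 t ht.1) (hwt t)]
      calc b t ≤ _ := hb t ht.1 ht.2
        _ ≤ α + ∫⁻ s in Ioi (0 : ℝ), N *
            (ENNReal.ofReal (D * timeKer 0 (t - s) * s ^ (-a)) * w s) := by
            refine add_le_add_right (setLIntegral_mono' measurableSet_Ioi fun s (hs : 0 < s) => ?_) _
            rcases lt_or_ge s t with hst | hst
            · rw [mul_left_comm]
              exact mul_le_mul_right (hNle s hs (hst.trans ht.2)) _
            · rw [timeKer_of_nonpos _ (by linarith)]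
              simp
        _ ≤ α * w t + N * (2⁻¹ * w t) := by
            rw [lintegral_const_mul' _ _ hNfin]
            refine add_le_add ?_ (mul_le_mul_right ?_ _)
            · simpa using mul_le_mul_right (hw1 t ht.1) α
            · refine (hw ε hε t ht.1 ht.2).trans (le_of_eq ?_)
              rw [ENNReal.ofReal_mul (by norm_num)]
              congr 1
              rw [one_div, ENNReal.ofReal_inv_of_pos two_pos]
              simp
        _ = _ := by rw [add_mul, div_eq_mul_inv, mul_assoc]
    have hN3 : N ≤ 2 * α := by
      have h1 : N / 2 + N / 2 ≤ α + N / 2 := by rwa [ENNReal.add_halves]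
      have hh : N / 2 ≠ ∞ := ENNReal.div_ne_top hNfin two_ne_zero
      have h2 : N / 2 ≤ α := (ENNReal.add_le_add_iff_right hh).1 h1
      rw [← ENNReal.add_halves N, two_mul]
      exact add_le_add h2 h2
    intro t ht htT
    exact (hNle t ht htT).trans (mul_le_mul_left hN3 _)
  -- The bound by 2α has lost |M|/ε, so ε → 0 removes the singular part of the weight.
  have hlim : Tendsto (fun ε : ℝ => 2 * α *
      ENNReal.ofReal (Real.exp (lam * t) * (1 + ε * t ^ (-a)))) (𝓝[>] 0)
      (𝓝 (2 * α * ENNReal.ofReal (Real.exp (lam * t) * (1 + 0 * t ^ (-a))))) := by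
    refine ENNReal.Tendsto.const_mul ?_ (Or.inr (ENNReal.mul_ne_top ENNReal.ofNat_ne_top hα))
    refine ENNReal.tendsto_ofReal (Tendsto.mono_left ?_ nhdsWithin_le_nhds)
    exact Continuous.tendsto (by fun_prop) 0
  have h1 : b t ≤ 2 * α * ENNReal.ofReal (Real.exp (lam * t) * (1 + 0 * t ^ (-a))) := by
    refine ge_of_tendsto hlim ?_
    filter_upwards [self_mem_nhdsWithin] with ε hε
    exact key ε hε t ht htT
  refine h1.trans ?_
  rw [zero_mul, add_zero, mul_one, ENNReal.ofReal_mul two_pos.le, ENNReal.ofReal_ofNat,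
    mul_right_comm]
  refine mul_le_mul_left (mul_le_mul_right (ENNReal.ofReal_le_ofReal ?_) _) _
  exact Real.exp_le_exp.2 (mul_le_mul_of_nonneg_left htT.le hlam.le)

/-! ### The bilinear operator with a general kernel -/

/-- Contraction of a three-index tensor with two vectors. -/
def mulT (K : Tensor3 n) (v w : Rn n) : Rn n :=
  WithLp.toLp 2 fun i => ∑ j, ∑ k, K i j k * v j * w k

theorem mulT_apply (K : Tensor3 n) (v w : Rn n) (i : Fin n) :
    mulT K v w i = ∑ j, ∑ k, K i j k * v j * w k := rfl

theorem mulT_sub_left (K K' : Tensor3 n) (v w : Rn n) :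
    mulT (K - K') v w = mulT K v w - mulT K' v w := by
  ext i
  simp [mulT_apply, sub_mul, Finset.sum_sub_distrib]

theorem mulT_sub_mid (K : Tensor3 n) (v v' w : Rn n) :
    mulT K (v - v') w = mulT K v w - mulT K v' w := by
  ext i
  simp [mulT_apply, sub_mul, mul_sub, Finset.sum_sub_distrib]

theorem mulT_sub_right (K : Tensor3 n) (v w w' : Rn n) :
    mulT K v (w - w') = mulT K v w - mulT K v w' := by
  ext i
  simp [mulT_apply, mul_sub, Finset.sum_sub_distrib]

theorem norm_le_of_coord_le {x : Rn n} {c : ℝ} (hc : 0 ≤ c) (h : ∀ i, |x i| ≤ c) :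
    ‖x‖ ≤ n * c := by
  have h1 : ‖x‖ ^ 2 ≤ (n * c) ^ 2 := by
    rw [EuclideanSpace.norm_sq_eq]
    calc ∑ i, ‖x i‖ ^ 2 ≤ ∑ _i : Fin n, c ^ 2 := Finset.sum_le_sum fun i _ => by
          rw [Real.norm_eq_abs]
          have := h i
          gcongr
      _ = n * c ^ 2 := by simp
      _ ≤ n ^ 2 * c ^ 2 := by
          gcongr
          exact_mod_cast Nat.le_self_pow two_ne_zero n
      _ = _ := by ring
  exact le_of_sq_le_sq h1 (by positivity)

theorem norm_mulT_le (K : Tensor3 n) (v w : Rn n) :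
    ‖mulT K v w‖ ≤ (n : ℝ) ^ 3 * ‖K‖ * ‖v‖ * ‖w‖ := by
  have h : ∀ i, |mulT K v w i| ≤ (n : ℝ) ^ 2 * (‖K‖ * ‖v‖ * ‖w‖) := by
    intro i
    rw [mulT_apply]
    calc |∑ j, ∑ k, K i j k * v j * w k| ≤ ∑ j, ∑ k, |K i j k * v j * w k| :=
          (Finset.abs_sum_le_sum_abs _ _).trans
            (Finset.sum_le_sum fun j _ => Finset.abs_sum_le_sum_abs _ _)
      _ ≤ ∑ _j : Fin n, ∑ _k : Fin n, ‖K‖ * ‖v‖ * ‖w‖ := by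
          refine Finset.sum_le_sum fun j _ => Finset.sum_le_sum fun k _ => ?_
          rw [abs_mul, abs_mul]
          have h1 : |K i j k| ≤ ‖K‖ :=
            ((norm_le_pi_norm (K i j) k).trans (norm_le_pi_norm (K i) j)).trans (norm_le_pi_norm K i)
          exact mul_le_mul (mul_le_mul h1 (abs_coord_le v j) (abs_nonneg _) (norm_nonneg _))
            (abs_coord_le w k) (abs_nonneg _) (by positivity)
      _ = _ := by simp; ring
  refine (norm_le_of_coord_le (by positivity) h).trans (le_of_eq ?_)
  ring

theorem enorm_mulT_le (K : Tensor3 n) (v w : Rn n) :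
    ‖mulT K v w‖ₑ ≤ ENNReal.ofReal ((n : ℝ) ^ 3) * (‖K‖ₑ * (‖v‖ₑ * ‖w‖ₑ)) := by
  simp_rw [← ofReal_norm]
  rw [← ENNReal.ofReal_mul (norm_nonneg _), ← ENNReal.ofReal_mul (norm_nonneg _),
    ← ENNReal.ofReal_mul (by positivity)]
  refine ENNReal.ofReal_le_ofReal ((norm_mulT_le K v w).trans (le_of_eq ?_))
  ring

theorem continuous_mulT : Continuous fun z : Tensor3 n × Rn n × Rn n => mulT z.1 z.2.1 z.2.2 := by
  unfold mulT
  refine (PiLp.continuous_toLp 2 _).comp (continuous_pi fun i => ?_)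
  fun_prop

/-- Space-time with positive times. -/
def timeSpace (n : ℕ) : Measure (ℝ × Rn n) :=
  (volume.restrict (Ioi (0 : ℝ))).prod volume

/-- The bilinear operator with kernel `J`, evaluated at `x`. -/
def kernelOp (J : ℝ → Rn n → Tensor3 n) (u w : ℝ → Rn n → Rn n) (x : Rn n) : Rn n :=
  ∫ z, mulT (J z.1 (x - z.2)) (u z.1 z.2) (w z.1 z.2) ∂(timeSpace n)

theorem measurable_kernelOp_integrand {J : ℝ → Rn n → Tensor3 n} {u w : ℝ → Rn n → Rn n}
    (hJ : Measurable (Function.uncurry J)) (hu : Measurable (Function.uncurry u))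
    (hw : Measurable (Function.uncurry w)) (x : Rn n) :
    Measurable fun z : ℝ × Rn n => mulT (J z.1 (x - z.2)) (u z.1 z.2) (w z.1 z.2) :=
  continuous_mulT.measurable.comp
    ((hJ.comp (measurable_fst.prodMk (measurable_const.sub measurable_snd))).prodMk
      (hu.prodMk hw))

theorem lintegral_kernelOp_le {J : ℝ → Rn n → Tensor3 n} {u w : ℝ → Rn n → Rn n}
    (hJ : Measurable (Function.uncurry J)) (hu : Measurable (Function.uncurry u))
    (hw : Measurable (Function.uncurry w)) (x : Rn n) :
    ∫⁻ z, ‖mulT (J z.1 (x - z.2)) (u z.1 z.2) (w z.1 z.2)‖ₑ ∂(timeSpace n) ≤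
      ENNReal.ofReal ((n : ℝ) ^ 3) *
        ∫⁻ s in Ioi (0 : ℝ), ∫⁻ y, ‖J s (x - y)‖ₑ * (‖u s y‖ₑ * ‖w s y‖ₑ) := by
  unfold timeSpace
  rw [lintegral_prod _ (measurable_kernelOp_integrand hJ hu hw x).enorm.aemeasurable,
    ← lintegral_const_mul' _ _ ENNReal.ofReal_ne_top]
  refine lintegral_mono fun s => ?_
  simp only
  rw [← lintegral_const_mul' _ _ ENNReal.ofReal_ne_top]
  exact lintegral_mono fun y => enorm_mulT_le _ _ _

theorem lintegral_kernelOp_le_of_bound {J : ℝ → Rn n → Tensor3 n} {u w : ℝ → Rn n → Rn n}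
    (hJ : Measurable (Function.uncurry J)) (hu : Measurable (Function.uncurry u))
    (hw : Measurable (Function.uncurry w)) {ρ : ℝ → ℝ}
    (hρ : ∀ s, 0 < s → ∫⁻ y, ‖J s y‖ₑ ≤ ENNReal.ofReal (ρ s)) {β : ℝ → ℝ≥0∞}
    (hβ : ∀ s, 0 < s → ∀ y, ‖u s y‖ₑ * ‖w s y‖ₑ ≤ β s) (x : Rn n) :
    ∫⁻ z, ‖mulT (J z.1 (x - z.2)) (u z.1 z.2) (w z.1 z.2)‖ₑ ∂(timeSpace n) ≤
      ENNReal.ofReal ((n : ℝ) ^ 3) * ∫⁻ s in Ioi (0 : ℝ), ENNReal.ofReal (ρ s) * β s := by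
  refine (lintegral_kernelOp_le hJ hu hw x).trans (mul_le_mul_right ?_ _)
  refine setLIntegral_mono' measurableSet_Ioi fun s hs => ?_
  have hJs : Measurable fun y => ‖J s (x - y)‖ₑ :=
    (hJ.comp (measurable_const.prodMk (measurable_const.sub measurable_id))).enorm
  calc ∫⁻ y, ‖J s (x - y)‖ₑ * (‖u s y‖ₑ * ‖w s y‖ₑ) ≤ ∫⁻ y, ‖J s (x - y)‖ₑ * β s :=
        lintegral_mono fun y => mul_le_mul_right (hβ s hs y) _
    _ = (∫⁻ y, ‖J s y‖ₑ) * β s := by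
        rw [lintegral_mul_const _ hJs, lintegral_sub_left_eq_self (fun y => ‖J s y‖ₑ) x]
    _ ≤ _ := mul_le_mul_left (hρ s hs) _

theorem enorm_kernelOp_le {J : ℝ → Rn n → Tensor3 n} {u w : ℝ → Rn n → Rn n}
    (hJ : Measurable (Function.uncurry J)) (hu : Measurable (Function.uncurry u))
    (hw : Measurable (Function.uncurry w)) {ρ : ℝ → ℝ}
    (hρ : ∀ s, 0 < s → ∫⁻ y, ‖J s y‖ₑ ≤ ENNReal.ofReal (ρ s)) {β : ℝ → ℝ≥0∞}
    (hβ : ∀ s, 0 < s → ∀ y, ‖u s y‖ₑ * ‖w s y‖ₑ ≤ β s) (x : Rn n) :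
    ‖kernelOp J u w x‖ₑ ≤
      ENNReal.ofReal ((n : ℝ) ^ 3) * ∫⁻ s in Ioi (0 : ℝ), ENNReal.ofReal (ρ s) * β s :=
  (enorm_integral_le_lintegral_enorm _).trans (lintegral_kernelOp_le_of_bound hJ hu hw hρ hβ x)

theorem integrable_kernelOp {J : ℝ → Rn n → Tensor3 n} {u w : ℝ → Rn n → Rn n}
    (hJ : Measurable (Function.uncurry J)) (hu : Measurable (Function.uncurry u))
    (hw : Measurable (Function.uncurry w)) {ρ : ℝ → ℝ}
    (hρ : ∀ s, 0 < s → ∫⁻ y, ‖J s y‖ₑ ≤ ENNReal.ofReal (ρ s)) {β : ℝ → ℝ≥0∞}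
    (hβ : ∀ s, 0 < s → ∀ y, ‖u s y‖ₑ * ‖w s y‖ₑ ≤ β s)
    (hfin : ∫⁻ s in Ioi (0 : ℝ), ENNReal.ofReal (ρ s) * β s ≠ ∞) (x : Rn n) :
    Integrable (fun z : ℝ × Rn n => mulT (J z.1 (x - z.2)) (u z.1 z.2) (w z.1 z.2))
      (timeSpace n) := by
  refine ⟨(measurable_kernelOp_integrand hJ hu hw x).aestronglyMeasurable, ?_⟩
  rw [hasFiniteIntegral_iff_enorm]
  exact (lintegral_kernelOp_le_of_bound hJ hu hw hρ hβ x).trans_lt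
    (ENNReal.mul_lt_top ENNReal.ofReal_lt_top (lt_top_iff_ne_top.2 hfin))

/-- One factor is estimated by its supremum and the other by its K-functional, so the quadratic term
becomes linear in the K-functional and Gronwall applies. -/
theorem kFun_kernelOp_le {J : ℝ → Rn n → Tensor3 n} {u w : ℝ → Rn n → Rn n}
    (hJ : Measurable (Function.uncurry J)) (hu : Measurable (Function.uncurry u))
    (hw : Measurable (Function.uncurry w)) {ρ : ℝ → ℝ}
    (hρ : ∀ s, 0 < s → ∫⁻ y, ‖J s y‖ₑ ≤ ENNReal.ofReal (ρ s)) {μ : ℝ → ℝ≥0∞}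
    (hμ : ∀ s, 0 < s → ∀ y, ‖u s y‖ₑ ≤ μ s) (τ : ℝ) :
    kFun (kernelOp J u w) τ ≤ ENNReal.ofReal ((n : ℝ) ^ 3) *
      ∫⁻ s in Ioi (0 : ℝ), ENNReal.ofReal (ρ s) * (μ s * kFun (w s) τ) := by
  refine kFun_le_iff.2 fun φ hφ => ?_
  have hm : Measurable (Function.uncurry fun (x : Rn n) (z : ℝ × Rn n) =>
      φ x * (‖J z.1 (x - z.2)‖ₑ * (‖u z.1 z.2‖ₑ * ‖w z.1 z.2‖ₑ))) := by
    have hJ' : Measurable fun a : Rn n × ℝ × Rn n => ‖J a.2.1 (a.1 - a.2.2)‖ₑ :=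
      (hJ.comp ((measurable_fst.comp measurable_snd).prodMk
        (measurable_fst.sub (measurable_snd.comp measurable_snd)))).enorm
    exact (hφ.1.comp measurable_fst).mul (hJ'.mul ((hu.comp measurable_snd).enorm.mul
      (hw.comp measurable_snd).enorm))
  have hm1 : ∀ x s, Measurable fun y => ‖J s (x - y)‖ₑ * (‖u s y‖ₑ * ‖w s y‖ₑ) := fun x s =>
    ((hJ.comp (measurable_const.prodMk (measurable_const.sub measurable_id))).enorm).mul
      (((hu.comp (measurable_const.prodMk measurable_id)).enorm).mul
        ((hw.comp (measurable_const.prodMk measurable_id)).enorm))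
  have hm2 : ∀ x, Measurable fun s => ∫⁻ y, ‖J s (x - y)‖ₑ * (‖u s y‖ₑ * ‖w s y‖ₑ) := by
    intro x
    refine Measurable.lintegral_prod_right' (f := fun z : ℝ × Rn n =>
      ‖J z.1 (x - z.2)‖ₑ * (‖u z.1 z.2‖ₑ * ‖w z.1 z.2‖ₑ)) ?_
    exact ((hJ.comp (measurable_fst.prodMk (measurable_const.sub measurable_snd))).enorm).mul
      (hu.enorm.mul hw.enorm)
  calc ∫⁻ x, φ x * ‖kernelOp J u w x‖ₑ
      ≤ ∫⁻ x, ENNReal.ofReal ((n : ℝ) ^ 3) * ∫⁻ s in Ioi (0 : ℝ), ∫⁻ y,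
          φ x * (‖J s (x - y)‖ₑ * (‖u s y‖ₑ * ‖w s y‖ₑ)) := by
        refine lintegral_mono fun x => ?_
        have h1 : ‖kernelOp J u w x‖ₑ ≤ _ :=
          (enorm_integral_le_lintegral_enorm _).trans (lintegral_kernelOp_le hJ hu hw x)
        refine (mul_le_mul_right h1 _).trans (le_of_eq ?_)
        rw [mul_left_comm, ← lintegral_const_mul _ (hm2 x)]
        congr 1
        exact lintegral_congr fun s => (lintegral_const_mul _ (hm1 x s)).symm
    _ = ENNReal.ofReal ((n : ℝ) ^ 3) * ∫⁻ x, ∫⁻ s in Ioi (0 : ℝ), ∫⁻ y,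
          φ x * (‖J s (x - y)‖ₑ * (‖u s y‖ₑ * ‖w s y‖ₑ)) :=
        lintegral_const_mul' _ _ ENNReal.ofReal_ne_top
    _ = ENNReal.ofReal ((n : ℝ) ^ 3) * ∫⁻ s in Ioi (0 : ℝ), ∫⁻ x, ∫⁻ y,
          φ x * (‖J s (x - y)‖ₑ * (‖u s y‖ₑ * ‖w s y‖ₑ)) := by
        congr 1
        refine lintegral_lintegral_swap (Measurable.aemeasurable ?_)
        refine Measurable.lintegral_prod_right' (f := fun z : (Rn n × ℝ) × Rn n =>
          φ z.1.1 * (‖J z.1.2 (z.1.1 - z.2)‖ₑ * (‖u z.1.2 z.2‖ₑ * ‖w z.1.2 z.2‖ₑ))) ?_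
        exact hm.comp ((measurable_fst.comp measurable_fst).prodMk
          ((measurable_snd.comp measurable_fst).prodMk measurable_snd))
    _ ≤ _ := by
        refine mul_le_mul_right (setLIntegral_mono' measurableSet_Ioi fun s hs => ?_) _
        have hJs : Measurable fun y => ‖J s y‖ₑ :=
          (hJ.comp (measurable_const.prodMk measurable_id)).enorm
        have hws : Measurable (w s) := hw.comp (measurable_const.prodMk measurable_id)
        have hJws : ∀ x, Measurable fun y => ‖J s (x - y)‖ₑ * ‖w s y‖ₑ := fun x =>
          (hJs.comp (measurable_const.sub measurable_id)).mul hws.enorm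
        calc ∫⁻ x, ∫⁻ y, φ x * (‖J s (x - y)‖ₑ * (‖u s y‖ₑ * ‖w s y‖ₑ))
            ≤ ∫⁻ x, μ s * (φ x * ∫⁻ y, ‖J s (x - y)‖ₑ * ‖w s y‖ₑ) := by
              refine lintegral_mono fun x => ?_
              rw [← lintegral_const_mul _ (hJws x), ← lintegral_const_mul _
                ((hJws x).const_mul _)]
              refine lintegral_mono fun y => ?_
              calc φ x * (‖J s (x - y)‖ₑ * (‖u s y‖ₑ * ‖w s y‖ₑ))
                  = ‖u s y‖ₑ * (φ x * (‖J s (x - y)‖ₑ * ‖w s y‖ₑ)) := by ring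
                _ ≤ _ := mul_le_mul_left (hμ s hs y) _
          _ = μ s * ∫⁻ x, φ x * ∫⁻ y, ‖J s (x - y)‖ₑ * ‖w s y‖ₑ := by
              refine lintegral_const_mul _ (hφ.1.mul ?_)
              refine Measurable.lintegral_prod_right' (f := fun z : Rn n × Rn n =>
                ‖J s (z.1 - z.2)‖ₑ * ‖w s z.2‖ₑ) ?_
              exact (hJs.comp (measurable_fst.sub measurable_snd)).mul
                (hws.comp measurable_snd).enorm
          _ ≤ μ s * ((∫⁻ y, ‖J s y‖ₑ) * kFun (w s) τ) :=
              mul_le_mul_right (lintegral_mul_conv_le hJs hws hφ) _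
          _ ≤ μ s * (ENNReal.ofReal (ρ s) * kFun (w s) τ) := by
              gcongr; exact hρ s hs
          _ = _ := mul_left_comm _ _ _

theorem measurable_kernelOp {ι : Type*} [MeasurableSpace ι] {J : ι → ℝ → Rn n → Tensor3 n}
    {X : ι → Rn n} {u w : ℝ → Rn n → Rn n}
    (hJ : Measurable fun z : ι × ℝ × Rn n => J z.1 z.2.1 z.2.2) (hX : Measurable X)
    (hu : Measurable (Function.uncurry u)) (hw : Measurable (Function.uncurry w)) :
    Measurable fun a => kernelOp (J a) u w (X a) := by
  unfold kernelOp
  have h : Measurable fun z : ι × (ℝ × Rn n) =>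
      mulT (J z.1 z.2.1 (X z.1 - z.2.2)) (u z.2.1 z.2.2) (w z.2.1 z.2.2) := by
    refine continuous_mulT.measurable.comp (Measurable.prodMk ?_ (Measurable.prodMk ?_ ?_))
    · exact hJ.comp (measurable_fst.prodMk ((measurable_fst.comp measurable_snd).prodMk
        ((hX.comp measurable_fst).sub (measurable_snd.comp measurable_snd))))
    · exact hu.comp measurable_snd
    · exact hw.comp measurable_snd
  have hs : SFinite (timeSpace n) := by unfold timeSpace; infer_instance
  exact (h.stronglyMeasurable.integral_prod_right').measurable

/-! ### The Duhamel operator -/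

/-- Measurable paths with `‖u(s)‖_∞ ≤ M s^{-a}`. -/
def PathIn (a M : ℝ) (u : ℝ → Rn n → Rn n) : Prop :=
  Measurable (Function.uncurry u) ∧ ∀ s, 0 < s → ∀ y, ‖u s y‖ₑ ≤ ENNReal.ofReal (M * s ^ (-a))

/-- The bilinear operator in terms of the extended kernel `oseenGrad`. -/
def duhamel (u w : ℝ → Rn n → Rn n) (t : ℝ) (x : Rn n) : Rn n :=
  kernelOp (fun s => oseenGrad (t - s)) u w x

/-- The constant in the estimates for the Duhamel operator. -/
def duhamelConst (n : ℕ) : ℝ := (n : ℝ) ^ 3 * (2 * densityConst n)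

theorem duhamelConst_nonneg (n : ℕ) : 0 ≤ duhamelConst n := by
  have := densityConst_pos n
  unfold duhamelConst; positivity

theorem measurable_oseenGrad_comp (t : ℝ) :
    Measurable (Function.uncurry fun (s : ℝ) (y : Rn n) => oseenGrad (t - s) y) :=
  measurable_oseenGrad.comp ((measurable_const.sub measurable_fst).prodMk measurable_snd)

theorem PathIn.mul_le {a M M' : ℝ} (hM : 0 ≤ M) {u w : ℝ → Rn n → Rn n} (hu : PathIn a M u)
    (hw : PathIn a M' w) (s : ℝ) (hs : 0 < s) (y : Rn n) :
    ‖u s y‖ₑ * ‖w s y‖ₑ ≤ ENNReal.ofReal (M * M' * s ^ (-(2 * a))) := by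
  refine (mul_le_mul' (hu.2 s hs y) (hw.2 s hs y)).trans (le_of_eq ?_)
  rw [← ENNReal.ofReal_mul (by positivity)]
  congr 1
  rw [show -(2 * a) = -a + -a by ring, Real.rpow_add hs]
  ring

theorem lintegral_const_timeKer_le {c M γ β t : ℝ} (hc : 0 ≤ c) (hM : 0 ≤ M) (hγ0 : 0 ≤ γ)
    (hγ : γ < 1 / 2) (hβ0 : 0 ≤ β) (hβ : β < 1) (ht : 0 < t) :
    ∫⁻ s in Ioi (0 : ℝ), ENNReal.ofReal (c * timeKer γ (t - s)) * ENNReal.ofReal (M * s ^ (-β)) ≤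
      ENNReal.ofReal (c * M * betaConst γ β * t ^ (1 / 2 - γ - β)) := by
  have h1 : ∀ s : ℝ, ENNReal.ofReal (c * timeKer γ (t - s)) * ENNReal.ofReal (M * s ^ (-β)) =
      ENNReal.ofReal (c * M) * ENNReal.ofReal (timeKer γ (t - s) * s ^ (-β)) := by
    intro s
    rw [← ENNReal.ofReal_mul (mul_nonneg hc (timeKer_nonneg _ _)),
      ← ENNReal.ofReal_mul (by positivity)]
    congr 1
    ring
  simp_rw [h1]
  rw [lintegral_const_mul' _ _ ENNReal.ofReal_ne_top, mul_assoc (c * M),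
    ENNReal.ofReal_mul (p := c * M) (by positivity)]
  exact mul_le_mul_right (lintegral_timeKer_le hγ0 hγ hβ0 hβ ht) _

theorem duhamel_integrable {a M M' : ℝ} (ha : 0 ≤ a) (ha2 : a < 1 / 2) (hM : 0 ≤ M) (hM' : 0 ≤ M')
    {u w : ℝ → Rn n → Rn n} (hu : PathIn a M u) (hw : PathIn a M' w) {t : ℝ} (ht : 0 < t)
    (x : Rn n) :
    Integrable (fun z : ℝ × Rn n => mulT (oseenGrad (t - z.1) (x - z.2)) (u z.1 z.2) (w z.1 z.2))
      (timeSpace n) := by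
  have hc := densityConst_pos n
  refine integrable_kernelOp (J := fun s => oseenGrad (t - s)) (measurable_oseenGrad_comp t)
    hu.1 hw.1 (fun s _ => lintegral_oseenGrad_le (t - s)) (hu.mul_le hM hw) ?_ x
  exact ne_top_of_le_ne_top ENNReal.ofReal_ne_top (lintegral_const_timeKer_le (by positivity)
    (by positivity) le_rfl (by norm_num) (by linarith) (by linarith) ht)

theorem enorm_duhamel_le {a M M' : ℝ} (ha : 0 ≤ a) (ha2 : a < 1 / 2) (hM : 0 ≤ M) (hM' : 0 ≤ M')
    {u w : ℝ → Rn n → Rn n} (hu : PathIn a M u) (hw : PathIn a M' w) {t : ℝ} (ht : 0 < t)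
    (x : Rn n) :
    ‖duhamel u w t x‖ₑ ≤ ENNReal.ofReal
      (duhamelConst n * (M * M') * betaConst 0 (2 * a) * t ^ (1 / 2 - 2 * a)) := by
  have hc := densityConst_pos n
  refine (enorm_kernelOp_le (measurable_oseenGrad_comp t) hu.1 hw.1
    (fun s _ => lintegral_oseenGrad_le (t - s)) (hu.mul_le hM hw) x).trans ?_
  refine (mul_le_mul_right (lintegral_const_timeKer_le (by positivity)
    (by positivity) le_rfl (by norm_num) (by linarith) (by linarith) ht) _).trans (le_of_eq ?_)
  rw [← ENNReal.ofReal_mul (by positivity), duhamelConst, sub_zero]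
  congr 1
  ring

theorem ofReal_cube_mul_lintegral (M a : ℝ) {ρ : ℝ → ℝ} (hρ : ∀ s, 0 ≤ ρ s)
    (b : ℝ → ℝ≥0∞) :
    ENNReal.ofReal ((n : ℝ) ^ 3) *
        ∫⁻ s in Ioi (0 : ℝ), ENNReal.ofReal (2 * densityConst n * ρ s) *
          (ENNReal.ofReal (M * s ^ (-a)) * b s) =
      ∫⁻ s in Ioi (0 : ℝ), ENNReal.ofReal (duhamelConst n * M * ρ s * s ^ (-a)) * b s := by
  have hc := densityConst_pos n
  rw [← lintegral_const_mul' _ _ ENNReal.ofReal_ne_top]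
  refine setLIntegral_congr_fun measurableSet_Ioi fun s (hs : 0 < s) => ?_
  have hk := hρ s
  rw [← mul_assoc, ← mul_assoc, ← ENNReal.ofReal_mul (by positivity),
    ← ENNReal.ofReal_mul (by positivity), duhamelConst]
  congr 2
  ring

theorem enorm_duhamel_le_lintegral {a M : ℝ}
    {u w : ℝ → Rn n → Rn n} (hu : Measurable (Function.uncurry u))
    (hw : Measurable (Function.uncurry w)) {b : ℝ → ℝ≥0∞}
    (hb : ∀ s, 0 < s → ∀ y, ‖u s y‖ₑ * ‖w s y‖ₑ ≤ ENNReal.ofReal (M * s ^ (-a)) * b s)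
    (t : ℝ) (x : Rn n) :
    ‖duhamel u w t x‖ₑ ≤ ∫⁻ s in Ioi (0 : ℝ),
      ENNReal.ofReal (duhamelConst n * M * timeKer 0 (t - s) * s ^ (-a)) * b s := by
  rw [← ofReal_cube_mul_lintegral M a (fun s => timeKer_nonneg 0 (t - s))]
  exact enorm_kernelOp_le (measurable_oseenGrad_comp t) hu hw
    (fun s _ => lintegral_oseenGrad_le (t - s)) hb x

theorem kFun_duhamel_le_lintegral {a M : ℝ} {u w : ℝ → Rn n → Rn n}
    (hu : PathIn a M u) (hw : Measurable (Function.uncurry w)) (t τ : ℝ) :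
    kFun (duhamel u w t) τ ≤ ∫⁻ s in Ioi (0 : ℝ),
      ENNReal.ofReal (duhamelConst n * M * timeKer 0 (t - s) * s ^ (-a)) * kFun (w s) τ := by
  rw [← ofReal_cube_mul_lintegral M a (fun s => timeKer_nonneg 0 (t - s))]
  exact kFun_kernelOp_le (measurable_oseenGrad_comp t) hu.1 hw
    (fun s _ => lintegral_oseenGrad_le (t - s)) (fun s hs y => hu.2 s hs y) τ

/-- The positive power t^{1/2-a} makes the Duhamel term vanish in K as t → 0, as needed for the
initial value. -/
theorem kFun_duhamel_le {a M : ℝ} (ha : 0 ≤ a) (ha2 : a < 1 / 2) (hM : 0 ≤ M)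
    {u w : ℝ → Rn n → Rn n} (hu : PathIn a M u) (hw : Measurable (Function.uncurry w)) {τ : ℝ}
    {Λ : ℝ≥0∞} (hΛ : ∀ s, 0 < s → kFun (w s) τ ≤ Λ) {t : ℝ} (ht : 0 < t) :
    kFun (duhamel u w t) τ ≤
      ENNReal.ofReal (duhamelConst n * M * betaConst 0 a * t ^ (1 / 2 - a)) * Λ := by
  have hC := duhamelConst_nonneg n
  refine (kFun_duhamel_le_lintegral hu hw t τ).trans ?_
  have hm : Measurable fun s : ℝ =>
      ENNReal.ofReal (duhamelConst n * M * timeKer 0 (t - s) * s ^ (-a)) :=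
    ((((measurable_timeKer 0).comp (measurable_const.sub measurable_id)).const_mul _).mul
      (measurable_id.pow_const _)).ennreal_ofReal
  calc _ ≤ ∫⁻ s in Ioi (0 : ℝ),
        ENNReal.ofReal (duhamelConst n * M * timeKer 0 (t - s) * s ^ (-a)) * Λ :=
        setLIntegral_mono' measurableSet_Ioi fun s hs => mul_le_mul_right (hΛ s hs) _
    _ = (∫⁻ s in Ioi (0 : ℝ), ENNReal.ofReal (duhamelConst n * M) *
          ENNReal.ofReal (timeKer 0 (t - s) * s ^ (-a))) * Λ := by
        rw [lintegral_mul_const _ hm]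
        congr 1
        refine lintegral_congr fun s => ?_
        rw [← ENNReal.ofReal_mul (by positivity), mul_assoc (duhamelConst n * M)]
    _ ≤ _ := by
        rw [lintegral_const_mul' _ _ ENNReal.ofReal_ne_top, mul_assoc (duhamelConst n * M),
          ENNReal.ofReal_mul (p := duhamelConst n * M) (by positivity)]
        have := lintegral_timeKer_le (γ := 0) le_rfl (by norm_num) ha (by linarith) ht
        rw [sub_zero] at this
        gcongr

theorem duhamel_sub {a M M' : ℝ} (ha : 0 ≤ a) (ha2 : a < 1 / 2) (hM : 0 ≤ M) (hM' : 0 ≤ M')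
    {u u' w w' : ℝ → Rn n → Rn n} (hu : PathIn a M u) (hw : PathIn a M' w)
    (hu' : PathIn a M u') (hw' : PathIn a M' w') {t : ℝ} (ht : 0 < t) (x : Rn n) :
    duhamel u w t x - duhamel u' w' t x =
      duhamel (u - u') w t x + duhamel u' (w - w') t x := by
  have i1 := duhamel_integrable ha ha2 hM hM' hu hw ht x
  have i2 := duhamel_integrable ha ha2 hM hM' hu' hw ht x
  have i3 := duhamel_integrable ha ha2 hM hM' hu' hw' ht x
  unfold duhamel kernelOp
  simp only [Pi.sub_apply, mulT_sub_mid, mulT_sub_right]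
  rw [integral_sub i1 i2, integral_sub i2 i3]
  abel

theorem measurable_duhamel {u w : ℝ → Rn n → Rn n} (hu : Measurable (Function.uncurry u))
    (hw : Measurable (Function.uncurry w)) :
    Measurable (Function.uncurry (duhamel u w)) := by
  refine measurable_kernelOp (J := fun (a : ℝ × Rn n) s => oseenGrad (a.1 - s)) ?_
    measurable_snd hu hw
  exact measurable_oseenGrad.comp (((measurable_fst.comp measurable_fst).sub
    (measurable_fst.comp measurable_snd)).prodMk (measurable_snd.comp measurable_snd))

/-! ### Time and space regularity of the Duhamel operator -/

theorem measurable_oseenGrad_time_sub (t t₀ : ℝ) : Measurable (Function.uncurry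
    fun (s : ℝ) (y : Rn n) => oseenGrad (t - s) y - oseenGrad (t₀ - s) y) :=
  (measurable_oseenGrad_comp t).sub (measurable_oseenGrad_comp t₀)

theorem duhamel_time_sub {a M M' : ℝ} (ha : 0 ≤ a) (ha2 : a < 1 / 2) (hM : 0 ≤ M) (hM' : 0 ≤ M')
    {u w : ℝ → Rn n → Rn n} (hu : PathIn a M u) (hw : PathIn a M' w) {t t₀ : ℝ} (ht : 0 < t)
    (ht₀ : 0 < t₀) (x : Rn n) :
    duhamel u w t x - duhamel u w t₀ x =
      kernelOp (fun s y => oseenGrad (t - s) y - oseenGrad (t₀ - s) y) u w x := by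
  unfold duhamel kernelOp
  rw [← integral_sub (duhamel_integrable ha ha2 hM hM' hu hw ht x)
    (duhamel_integrable ha ha2 hM hM' hu hw ht₀ x)]
  simp only [mulT_sub_left]

theorem lintegral_two_timeKer_le {M γ β t t₀ : ℝ} (hM : 0 ≤ M) (hγ0 : 0 ≤ γ)
    (hγ : γ < 1 / 2) (hβ0 : 0 ≤ β) (hβ : β < 1) (ht : 0 < t) (ht₀ : 0 < t₀) :
    ENNReal.ofReal ((n : ℝ) ^ 3) * ∫⁻ s in Ioi (0 : ℝ), ENNReal.ofReal
        (2 * densityConst n * |t - s - (t₀ - s)| ^ γ *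
          (timeKer γ (t - s) + timeKer γ (t₀ - s))) * ENNReal.ofReal (M * s ^ (-β)) ≤
      ENNReal.ofReal (duhamelConst n * M * betaConst γ β * |t - t₀| ^ γ *
        (t ^ (1 / 2 - γ - β) + t₀ ^ (1 / 2 - γ - β))) := by
  have hc := densityConst_pos n
  have hB := betaConst_pos hγ hβ
  set c := 2 * densityConst n * |t - t₀| ^ γ with hcdef
  have hc0 : 0 ≤ c := by positivity
  have h1 : ∀ s : ℝ, ENNReal.ofReal (2 * densityConst n * |t - s - (t₀ - s)| ^ γ *
      (timeKer γ (t - s) + timeKer γ (t₀ - s))) * ENNReal.ofReal (M * s ^ (-β)) =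
      ENNReal.ofReal (c * timeKer γ (t - s)) * ENNReal.ofReal (M * s ^ (-β)) +
        ENNReal.ofReal (c * timeKer γ (t₀ - s)) * ENNReal.ofReal (M * s ^ (-β)) := by
    intro s
    rw [sub_sub_sub_cancel_right, ← add_mul, ← ENNReal.ofReal_add
      (mul_nonneg hc0 (timeKer_nonneg _ _)) (mul_nonneg hc0 (timeKer_nonneg _ _)), ← mul_add]
  have hm : Measurable fun s : ℝ => ENNReal.ofReal (c * timeKer γ (t - s)) *
      ENNReal.ofReal (M * s ^ (-β)) :=
    (((measurable_timeKer γ).comp (measurable_const.sub measurable_id)).const_mul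
      c).ennreal_ofReal.mul ((measurable_id.pow_const _).const_mul M).ennreal_ofReal
  simp_rw [h1]
  rw [lintegral_add_left hm]
  calc _ ≤ ENNReal.ofReal ((n : ℝ) ^ 3) *
        (ENNReal.ofReal (c * M * betaConst γ β * t ^ (1 / 2 - γ - β)) +
          ENNReal.ofReal (c * M * betaConst γ β * t₀ ^ (1 / 2 - γ - β))) := by
        gcongr
        · exact lintegral_const_timeKer_le hc0 hM hγ0 hγ hβ0 hβ ht
        · exact lintegral_const_timeKer_le hc0 hM hγ0 hγ hβ0 hβ ht₀
    _ = _ := by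
        rw [← ENNReal.ofReal_add (by positivity) (by positivity),
          ← ENNReal.ofReal_mul (by positivity), hcdef, duhamelConst]
        congr 1
        ring

/-- Time regularity of order γ strengthens the singularity to (t-s)^{-1/2-γ}, integrable for γ <
1/2. -/
theorem enorm_duhamel_time_sub_le {a M M' γ : ℝ} (ha : 0 ≤ a) (ha2 : a < 1 / 2) (hM : 0 ≤ M)
    (hM' : 0 ≤ M') {u w : ℝ → Rn n → Rn n} (hu : PathIn a M u) (hw : PathIn a M' w) {t t₀ : ℝ}
    (ht : 0 < t) (ht₀ : 0 < t₀) (hγ0 : 0 ≤ γ) (hγ : γ < 1 / 2) (x : Rn n) :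
    ‖duhamel u w t x - duhamel u w t₀ x‖ₑ ≤
      ENNReal.ofReal (duhamelConst n * (M * M') * betaConst γ (2 * a) * |t - t₀| ^ γ *
        (t ^ (1 / 2 - γ - 2 * a) + t₀ ^ (1 / 2 - γ - 2 * a))) := by
  rw [duhamel_time_sub ha ha2 hM hM' hu hw ht ht₀]
  exact (enorm_kernelOp_le (measurable_oseenGrad_time_sub t t₀) hu.1 hw.1
    (fun s _ => lintegral_oseenGrad_sub_le (t - s) (t₀ - s) hγ0 (by linarith))
    (hu.mul_le hM hw) x).trans
    (lintegral_two_timeKer_le (by positivity) hγ0 hγ (by linarith) (by linarith) ht ht₀)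

theorem kFun_duhamel_time_sub_le {a M M' γ : ℝ} (ha : 0 ≤ a) (ha2 : a < 1 / 2) (hM : 0 ≤ M)
    (hM' : 0 ≤ M') {u w : ℝ → Rn n → Rn n} (hu : PathIn a M u) (hw : PathIn a M' w) {τ : ℝ}
    {Λ : ℝ≥0∞} (hΛ : ∀ s, 0 < s → kFun (w s) τ ≤ Λ) {t t₀ : ℝ}
    (ht : 0 < t) (ht₀ : 0 < t₀) (hγ0 : 0 ≤ γ) (hγ : γ < 1 / 2) :
    kFun (duhamel u w t - duhamel u w t₀) τ ≤
      ENNReal.ofReal (duhamelConst n * M * betaConst γ a * |t - t₀| ^ γ *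
        (t ^ (1 / 2 - γ - a) + t₀ ^ (1 / 2 - γ - a))) * Λ := by
  have h1 : duhamel u w t - duhamel u w t₀ =
      kernelOp (fun s y => oseenGrad (t - s) y - oseenGrad (t₀ - s) y) u w :=
    funext fun x => duhamel_time_sub ha ha2 hM hM' hu hw ht ht₀ x
  rw [h1]
  refine (kFun_kernelOp_le (measurable_oseenGrad_time_sub t t₀) hu.1 hw.1
    (fun s _ => lintegral_oseenGrad_sub_le (t - s) (t₀ - s) hγ0 (by linarith))
    (fun s hs y => hu.2 s hs y) τ).trans ?_
  refine le_trans ?_ (mul_le_mul_left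
    (lintegral_two_timeKer_le (n := n) hM hγ0 hγ ha (by linarith) ht ht₀) Λ)
  rw [mul_assoc]
  refine mul_le_mul_right ?_ _
  have hm : Measurable fun s : ℝ => ENNReal.ofReal
      (2 * densityConst n * |t - s - (t₀ - s)| ^ γ *
        (timeKer γ (t - s) + timeKer γ (t₀ - s))) * ENNReal.ofReal (M * s ^ (-a)) := by
    have h2 : ∀ r : ℝ, Measurable fun s : ℝ => timeKer γ (r - s) := fun r =>
      (measurable_timeKer γ).comp (measurable_const.sub measurable_id)
    simp only [sub_sub_sub_cancel_right]
    exact (((h2 t).add (h2 t₀)).const_mul _).ennreal_ofReal.mul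
      ((measurable_id.pow_const _).const_mul M).ennreal_ofReal
  rw [← lintegral_mul_const _ hm]
  refine setLIntegral_mono' measurableSet_Ioi fun s hs => ?_
  rw [← mul_assoc]
  exact mul_le_mul_right (hΛ s hs) _

theorem enorm_duhamel_shift_le {a M M' α : ℝ} (ha : 0 ≤ a) (ha2 : a < 1 / 2) (hM : 0 ≤ M)
    (hM' : 0 ≤ M') {u w : ℝ → Rn n → Rn n} (hu : PathIn a M u) (hw : PathIn a M' w) {t : ℝ}
    (ht : 0 < t) (hα0 : 0 ≤ α) (hα : α < 1) (x h : Rn n) :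
    ‖duhamel u w t (x + h) - duhamel u w t x‖ₑ ≤
      ENNReal.ofReal (2 * duhamelConst n * (M * M') * betaConst (α / 2) (2 * a) * ‖h‖ ^ α *
        t ^ (1 / 2 - α / 2 - 2 * a)) := by
  have hc := densityConst_pos n
  have h1 : duhamel u w t (x + h) - duhamel u w t x =
      kernelOp (fun s y => oseenGrad (t - s) (y + h) - oseenGrad (t - s) y) u w x := by
    have i1 := duhamel_integrable ha ha2 hM hM' hu hw ht (x + h)
    have i2 := duhamel_integrable ha ha2 hM hM' hu hw ht x
    unfold duhamel kernelOp
    rw [← integral_sub i1 i2]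
    simp only [mulT_sub_left, sub_add_eq_add_sub]
  have hJ : Measurable (Function.uncurry fun (s : ℝ) (y : Rn n) =>
      oseenGrad (t - s) (y + h) - oseenGrad (t - s) y) := by
    refine Measurable.sub ?_ (measurable_oseenGrad_comp t)
    exact measurable_oseenGrad.comp ((measurable_const.sub measurable_fst).prodMk
      (measurable_snd.add_const h))
  rw [h1]
  refine (enorm_kernelOp_le hJ hu.1 hw.1
    (fun s _ => lintegral_oseenGrad_shift_le (t - s) h hα0 hα.le) (hu.mul_le hM hw) x).trans ?_
  refine (mul_le_mul_right (lintegral_const_timeKer_le (by positivity)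
    (by positivity) (by linarith) (by linarith) (by linarith) (by linarith) ht) _).trans
    (le_of_eq ?_)
  rw [← ENNReal.ofReal_mul (by positivity), duhamelConst]
  congr 1
  ring

/-! ### Identification with the bilinear operator -/

/-- Agreement almost everywhere on almost every slice suffices, since u enters only under the
integral. This allows a Borel version v in place of a solution that is merely almost everywhere
measurable. -/
theorem bilinearOp_eq_duhamel {a M : ℝ} (ha : 0 ≤ a) (ha2 : a < 1 / 2) (hM : 0 ≤ M)
    {u v : ℝ → Rn n → Rn n} (hv : PathIn a M v) {t : ℝ} (ht : 0 < t)
    (huv : ∀ᵐ s ∂(volume.restrict (Ioo 0 t)), u s =ᵐ[volume] v s) (x : Rn n) (i : Fin n) :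
    bilinearOp u u i t x = duhamel v v t x i := by
  have hint := duhamel_integrable ha ha2 hM hM hv hv ht x
  have hinti : Integrable (fun z : ℝ × Rn n =>
      mulT (oseenGrad (t - z.1) (x - z.2)) (v z.1 z.2) (v z.1 z.2) i) (timeSpace n) :=
    (EuclideanSpace.proj (𝕜 := ℝ) i).integrable_comp hint
  have h1 : duhamel v v t x i = ∫ z, mulT (oseenGrad (t - z.1) (x - z.2)) (v z.1 z.2) (v z.1 z.2) i
      ∂(timeSpace n) :=
    ((EuclideanSpace.proj (𝕜 := ℝ) i).integral_comp_comm hint).symm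
  rw [h1]
  unfold timeSpace at hinti ⊢
  rw [integral_prod _ hinti, setIntegral_eq_of_subset_of_forall_sdiff_eq_zero measurableSet_Ioi
    (Ioo_subset_Ioi_self : Ioo 0 t ⊆ Ioi 0)]
  · unfold bilinearOp
    rw [intervalIntegral.integral_of_le ht.le, integral_Ioc_eq_integral_Ioo]
    refine integral_congr_ae ?_
    filter_upwards [huv, ae_restrict_mem measurableSet_Ioo] with s hs hst
    refine integral_congr_ae ?_
    filter_upwards [hs] with y hy
    rw [mulT_apply, hy]
    refine Finset.sum_congr rfl fun j _ => Finset.sum_congr rfl fun k _ => ?_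
    rw [gradOseenKernel_eq (by linarith [hst.2])]
  · intro s hs
    have hts : t - s ≤ 0 := by
      by_contra hcon
      exact hs.2 ⟨hs.1, by linarith⟩
    simp only [oseenGrad_of_nonpos hts]
    simp [mulT_apply]

/-! ### The heat semigroup -/

/-- The heat map as a vector-valued integral. -/
def heatVec (f : Rn n → Rn n) (t : ℝ) (x : Rn n) : Rn n := ∫ y, heatKernel t (x - y) • f y

theorem enorm_heatKernel {t : ℝ} (ht : 0 < t) (x : Rn n) :
    ‖heatKernel t x‖ₑ = ENNReal.ofReal (heatKernel t x) :=
  Real.enorm_eq_ofReal (heatKernel_nonneg ht.le x)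

theorem lintegral_enorm_heatKernel {t : ℝ} (ht : 0 < t) : ∫⁻ x : Rn n, ‖heatKernel t x‖ₑ = 1 := by
  simp_rw [enorm_heatKernel ht]
  exact lintegral_heatKernel ht

/-- The volume scale of the heat kernel. -/
def heatVol (n : ℕ) (t : ℝ) : ℝ := (4 * Real.pi * t) ^ ((n : ℝ) / 2)

theorem heatVol_pos (n : ℕ) {t : ℝ} (ht : 0 < t) : 0 < heatVol n t := by
  unfold heatVol; positivity

theorem inv_heatVol {t : ℝ} (ht : 0 < t) : (heatVol n t)⁻¹ = (4 * Real.pi * t) ^ (-(n : ℝ) / 2) := by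
  rw [heatVol, neg_div, Real.rpow_neg (by positivity)]

theorem lintegral_conv_kernel_le {k : Rn n → ℝ} (hk : Continuous k) {A B : ℝ} (hA : 0 < A)
    (hkA : ∀ x, ‖k x‖ ≤ A) (hkB : ∫⁻ x, ‖k x‖ₑ ≤ ENNReal.ofReal B) (f : Rn n → Rn n) (x : Rn n) :
    ∫⁻ y, ‖k (x - y) • f y‖ₑ ≤ ENNReal.ofReal A * kFun f (B / A) := by
  simp_rw [enorm_smul]
  refine lintegral_kernel_mul_le ?_ (by simpa using hA) ENNReal.ofReal_ne_top (fun y => ?_) ?_ f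
  · exact (hk.comp (continuous_const.sub continuous_id)).measurable.enorm
  · rw [← ofReal_norm]
    exact ENNReal.ofReal_le_ofReal (hkA _)
  · rw [lintegral_sub_left_eq_self (fun y => ‖k y‖ₑ) x, ← ENNReal.ofReal_mul hA.le,
      mul_div_cancel₀ _ hA.ne']
    exact hkB

/-- The heat kernel is at most 1/V and has mass one, so the natural mass parameter is τ = V. -/
theorem lintegral_heatVec_le (f : Rn n → Rn n) {t : ℝ} (ht : 0 < t) (x : Rn n) :
    ∫⁻ y, ‖heatKernel t (x - y) • f y‖ₑ ≤
      ENNReal.ofReal (heatVol n t)⁻¹ * kFun f (heatVol n t) := by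
  have hV := heatVol_pos n ht
  have h := lintegral_conv_kernel_le (continuous_heatKernel t) (A := (heatVol n t)⁻¹) (B := 1)
    (by positivity) (fun x => ?_) ?_ f x
  · simpa using h
  · rw [Real.norm_of_nonneg (heatKernel_nonneg ht.le x), inv_heatVol ht]
    exact heatKernel_le ht x
  · rw [lintegral_enorm_heatKernel ht, ENNReal.ofReal_one]

theorem integrable_heatVec {f : Rn n → Rn n} (hf : Measurable f) (hk : ∀ τ, kFun f τ ≠ ∞) {t : ℝ}
    (ht : 0 < t) (x : Rn n) : Integrable fun y => heatKernel t (x - y) • f y := by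
  refine ⟨?_, ?_⟩
  · exact (((continuous_heatKernel t).comp
      (continuous_const.sub continuous_id)).measurable.smul hf).aestronglyMeasurable
  · rw [hasFiniteIntegral_iff_enorm]
    exact (lintegral_heatVec_le f ht x).trans_lt (ENNReal.mul_lt_top ENNReal.ofReal_lt_top
      (lt_top_iff_ne_top.2 (hk _)))

theorem heatMap_eq_heatVec {f : Rn n → Rn n} (hf : Measurable f) (hk : ∀ τ, kFun f τ ≠ ∞) {t : ℝ}
    (ht : 0 < t) (x : Rn n) (i : Fin n) : heatMap f i t x = heatVec f t x i :=
  (EuclideanSpace.proj (𝕜 := ℝ) i).integral_comp_comm (integrable_heatVec hf hk ht x)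

theorem measurable_heatVec {f : Rn n → Rn n} (hf : Measurable f) :
    Measurable (Function.uncurry (heatVec f)) := by
  unfold heatVec
  have h : Measurable fun z : (ℝ × Rn n) × Rn n => heatKernel z.1.1 (z.1.2 - z.2) • f z.2 := by
    have hk : Measurable fun z : (ℝ × Rn n) × Rn n => heatKernel z.1.1 (z.1.2 - z.2) :=
      measurable_heatKernel.comp ((measurable_fst.comp measurable_fst).prodMk
        ((measurable_snd.comp measurable_fst).sub measurable_snd))
    exact hk.smul (hf.comp measurable_snd)
  exact (h.stronglyMeasurable.integral_prod_right').measurable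

theorem measurable_heatVec_apply {f : Rn n → Rn n} (hf : Measurable f) (t : ℝ) :
    Measurable (heatVec f t) :=
  (measurable_heatVec hf).comp (measurable_const.prodMk measurable_id)

theorem inv_heatVol_mul_rpow {M b t : ℝ} (ht : 0 < t) :
    (heatVol n t)⁻¹ * (M * heatVol n t ^ (1 - b)) =
      M * (4 * Real.pi) ^ (-(n * b / 2) : ℝ) * t ^ (-(n * b / 2) : ℝ) := by
  have hV := heatVol_pos n ht
  rw [mul_assoc M, ← Real.mul_rpow (by positivity) ht.le]
  have h1 : (4 * Real.pi * t) ^ (-(n * b / 2) : ℝ) = heatVol n t ^ (-b) := by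
    rw [heatVol, ← Real.rpow_mul (by positivity)]
    congr 1
    ring
  have h2 : heatVol n t ^ (1 - b) = heatVol n t * heatVol n t ^ (-b) := by
    rw [sub_eq_add_neg, Real.rpow_add hV, Real.rpow_one]
  rw [h1, h2]
  field_simp

/-- Inserting τ = V into K(f,τ) ≤ Mτ^{1-b} gives MV^{-b}; for b = 1/r this is the rate t^{-n/(2r)}.
-/
theorem enorm_heatVec_le {f : Rn n → Rn n} {M b : ℝ}
    (hM : ∀ τ, 0 < τ → kFun f τ ≤ ENNReal.ofReal (M * τ ^ (1 - b))) {t : ℝ} (ht : 0 < t)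
    (x : Rn n) :
    ‖heatVec f t x‖ₑ ≤
      ENNReal.ofReal (M * (4 * Real.pi) ^ (-(n * b / 2) : ℝ) * t ^ (-(n * b / 2) : ℝ)) := by
  have hV := heatVol_pos n ht
  refine (enorm_integral_le_lintegral_enorm _).trans ((lintegral_heatVec_le f ht x).trans ?_)
  refine (mul_le_mul_right (hM _ hV) _).trans (le_of_eq ?_)
  rw [← ENNReal.ofReal_mul (by positivity), inv_heatVol_mul_rpow ht]

theorem kFun_heatVec_le {f : Rn n → Rn n} (hf : Measurable f) {t : ℝ} (ht : 0 < t) (τ : ℝ) :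
    kFun (heatVec f t) τ ≤ kFun f τ := by
  have h := kFun_conv_le (J := fun x => ‖heatKernel t x‖ₑ) (W := heatVec f t)
    (continuous_heatKernel t).measurable.enorm hf (fun x => ?_) τ
  · rwa [lintegral_enorm_heatKernel ht, one_mul] at h
  · refine (enorm_integral_le_lintegral_enorm _).trans (le_of_eq ?_)
    simp_rw [enorm_smul]

theorem heatVec_time_sub {f : Rn n → Rn n} (hf : Measurable f) (hk : ∀ τ, kFun f τ ≠ ∞) {t t₀ : ℝ}
    (ht : 0 < t) (ht₀ : 0 < t₀) (x : Rn n) :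
    heatVec f t x - heatVec f t₀ x =
      ∫ y, (heatKernel t (x - y) - heatKernel t₀ (x - y)) • f y := by
  unfold heatVec
  rw [← integral_sub (integrable_heatVec hf hk ht x) (integrable_heatVec hf hk ht₀ x)]
  simp only [sub_smul]

theorem kFun_heatVec_time_sub_le {f : Rn n → Rn n} (hf : Measurable f) (hk : ∀ τ, kFun f τ ≠ ∞)
    {t t₀ : ℝ} (ht : 0 < t) (ht₀ : 0 < t₀) (τ : ℝ) :
    kFun (heatVec f t - heatVec f t₀) τ ≤
      (∫⁻ x : Rn n, ‖heatKernel t x - heatKernel t₀ x‖ₑ) * kFun f τ := by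
  refine kFun_conv_le (J := fun x => ‖heatKernel t x - heatKernel t₀ x‖ₑ)
    ((continuous_heatKernel t).sub (continuous_heatKernel t₀)).measurable.enorm hf (fun x => ?_) τ
  rw [Pi.sub_apply, heatVec_time_sub hf hk ht ht₀]
  refine (enorm_integral_le_lintegral_enorm _).trans (le_of_eq ?_)
  simp_rw [enorm_smul]

/-- Uniform continuity in time: near t₀ the kernel difference is bounded by a fixed A, and its L¹
norm falls below Aτ, so the difference is at most A K(f,τ), which is small for small τ. -/
theorem eventually_enorm_heatVec_sub_le {f : Rn n → Rn n} (hf : Measurable f)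
    (hk : ∀ τ, kFun f τ ≠ ∞) (hk0 : Tendsto (kFun f) (𝓝[>] 0) (𝓝 0)) {t₀ : ℝ} (ht₀ : 0 < t₀)
    {ε : ℝ≥0∞} (hε : 0 < ε) :
    ∀ᶠ t in 𝓝 t₀, ∀ x, ‖heatVec f t x - heatVec f t₀ x‖ₑ ≤ ε := by
  have hV := heatVol_pos n (t := t₀ / 2) (by linarith)
  -- Each of the two kernels is at most 1/V at time t₀/2 once t > t₀/2.
  set A := 2 * (heatVol n (t₀ / 2))⁻¹ with hAdef
  have hA : 0 < A := by positivity
  have h1 : Tendsto (fun τ => ENNReal.ofReal A * kFun f τ) (𝓝[>] 0) (𝓝 0) := by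
    simpa using ENNReal.Tendsto.const_mul hk0 (Or.inr (ENNReal.ofReal_ne_top (r := A)))
  obtain ⟨τ, hτ, hτ0⟩ := ((ENNReal.tendsto_nhds_zero.1 h1 ε hε).and self_mem_nhdsWithin).exists
  have hτ0 : 0 < τ := hτ0
  have h2 := ENNReal.tendsto_nhds_zero.1 (tendsto_lintegral_heatKernel_sub (n := n) ht₀)
    (ENNReal.ofReal (A * τ)) (by simpa using mul_pos hA hτ0)
  filter_upwards [h2, Ioi_mem_nhds (by linarith : t₀ / 2 < t₀)] with t ht (htt : t₀ / 2 < t) x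
  have ht0 : 0 < t := by linarith
  rw [heatVec_time_sub hf hk ht0 ht₀]
  refine (enorm_integral_le_lintegral_enorm _).trans ((lintegral_conv_kernel_le
    (k := fun x => heatKernel t x - heatKernel t₀ x) (A := A) (B := A * τ)
    ((continuous_heatKernel t).sub (continuous_heatKernel t₀)) hA (fun y => ?_) ht f x).trans ?_)
  · have hb : ∀ s, t₀ / 2 < s → ∀ y : Rn n, ‖heatKernel s y‖ ≤ (heatVol n (t₀ / 2))⁻¹ := by
      intro s hs y
      have hs0 : 0 < s := by linarith
      rw [Real.norm_of_nonneg (heatKernel_nonneg hs0.le y)]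
      refine (heatKernel_le hs0 y).trans ?_
      rw [← inv_heatVol hs0]
      unfold heatVol
      gcongr
    calc ‖heatKernel t y - heatKernel t₀ y‖ ≤ ‖heatKernel t y‖ + ‖heatKernel t₀ y‖ := norm_sub_le _ _
      _ ≤ A := by
        rw [hAdef]
        linarith [hb t htt y, hb t₀ (by linarith) y]
  · rwa [mul_div_cancel_left₀ _ hA.ne']

theorem heatVec_shift_sub {f : Rn n → Rn n} (hf : Measurable f) (hk : ∀ τ, kFun f τ ≠ ∞) {t : ℝ}
    (ht : 0 < t) (x h : Rn n) : heatVec f t (x + h) - heatVec f t x =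
      ∫ y, (heatKernel t (x - y + h) - heatKernel t (x - y)) • f y := by
  unfold heatVec
  rw [← integral_sub (integrable_heatVec hf hk ht (x + h)) (integrable_heatVec hf hk ht x)]
  simp only [sub_smul, sub_add_eq_add_sub]

/-- The L¹ and sup bounds of the shifted difference have ratio V at time 2t, independent of h, so
the whole dependence on h is the linear factor ‖h‖. -/
theorem lintegral_heatVec_shift_le (f : Rn n → Rn n) {t : ℝ} (ht : 0 < t) (x : Rn n) {h : Rn n}
    (hh : h ≠ 0) : ∫⁻ y, ‖(heatKernel t (x - y + h) - heatKernel t (x - y)) • f y‖ₑ ≤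
      ENNReal.ofReal (heatConst n 1 * t ^ (-(1 / 2) : ℝ) * (heatVol n (2 * t))⁻¹ * ‖h‖) *
        kFun f (heatVol n (2 * t)) := by
  have hc := heatConst_pos n 1
  have ht2 : 0 < 2 * t := by linarith
  have hV := heatVol_pos n ht2
  have hh0 : 0 < ‖h‖ := norm_pos_iff.2 hh
  have hp : 0 < t ^ (-(1 / 2) : ℝ) := Real.rpow_pos_of_pos ht _
  have hA : 0 < heatConst n 1 * t ^ (-(1 / 2) : ℝ) * (heatVol n (2 * t))⁻¹ * ‖h‖ := by positivity
  have hcont : Continuous fun x : Rn n => heatKernel t (x + h) - heatKernel t x :=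
    ((continuous_heatKernel t).comp (continuous_id.add continuous_const)).sub
      (continuous_heatKernel t)
  have hb : ∀ y : Rn n, ‖heatKernel t (y + h) - heatKernel t y‖ ≤
      heatConst n 1 * t ^ (-(1 / 2) : ℝ) * (heatVol n (2 * t))⁻¹ * ‖h‖ := fun y => by
    rw [inv_heatVol ht2]
    exact norm_heatKernel_shift_le ht h y
  have h2 := lintegral_conv_kernel_le hcont hA hb (lintegral_heatKernel_shift_le ht h) f x
  have e : heatConst n 1 * t ^ (-(1 / 2) : ℝ) * ‖h‖ /
      (heatConst n 1 * t ^ (-(1 / 2) : ℝ) * (heatVol n (2 * t))⁻¹ * ‖h‖) = heatVol n (2 * t) := by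
    field_simp
  rwa [e] at h2

theorem enorm_heatVec_shift_le {f : Rn n → Rn n} (hf : Measurable f) (hk : ∀ τ, kFun f τ ≠ ∞)
    {M b : ℝ} (hM : ∀ τ, 0 < τ → kFun f τ ≤ ENNReal.ofReal (M * τ ^ (1 - b))) {t : ℝ} (ht : 0 < t)
    (x h : Rn n) :
    ‖heatVec f t (x + h) - heatVec f t x‖ₑ ≤ ENNReal.ofReal (heatConst n 1 * t ^ (-(1 / 2) : ℝ) *
      (M * (4 * Real.pi) ^ (-(n * b / 2) : ℝ) * (2 * t) ^ (-(n * b / 2) : ℝ)) * ‖h‖) := by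
  rcases eq_or_ne h 0 with rfl | hh
  · simp
  have hc := heatConst_pos n 1
  have ht2 : 0 < 2 * t := by linarith
  have hV := heatVol_pos n ht2
  have hp : 0 < t ^ (-(1 / 2) : ℝ) := Real.rpow_pos_of_pos ht _
  rw [heatVec_shift_sub hf hk ht]
  refine (enorm_integral_le_lintegral_enorm _).trans
    ((lintegral_heatVec_shift_le f ht x hh).trans ?_)
  refine (mul_le_mul_right (hM _ hV) _).trans (le_of_eq ?_)
  rw [← ENNReal.ofReal_mul (by positivity), ← inv_heatVol_mul_rpow ht2]
  congr 1
  ring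

theorem heatVec_sub_self {f : Rn n → Rn n} (hf : Measurable f) (hk : ∀ τ, kFun f τ ≠ ∞) {t : ℝ}
    (ht : 0 < t) (x : Rn n) :
    heatVec f t x - f x = ∫ z, heatKernel t z • (f (x - z) - f x) := by
  have h1 : Integrable fun z => heatKernel t z • f (x - z) := by
    have := (integrable_heatVec hf hk ht x).comp_sub_left x
    simpa using this
  have h2 : heatVec f t x = ∫ z, heatKernel t z • f (x - z) := by
    unfold heatVec
    rw [← integral_sub_left_eq_self _ volume x]
    simp
  have h3 : f x = ∫ z : Rn n, heatKernel t z • f x := by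
    rw [integral_smul_const, integral_heatKernel ht, one_smul]
  calc heatVec f t x - f x
      = (∫ z, heatKernel t z • f (x - z)) - ∫ z : Rn n, heatKernel t z • f x := by rw [h2, ← h3]
    _ = _ := by
        rw [← integral_sub h1 ((integrable_heatKernel ht).smul_const _)]
        simp only [smul_sub]

theorem enorm_heatVec_sub_self_le {f : Rn n → Rn n} (hf : Measurable f) (hk : ∀ τ, kFun f τ ≠ ∞)
    {t : ℝ} (ht : 0 < t) (x : Rn n) :
    ‖heatVec f t x - f x‖ₑ ≤ ∫⁻ z, ENNReal.ofReal (heatKernel t z) * ‖f (x - z) - f x‖ₑ := by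
  rw [heatVec_sub_self hf hk ht]
  refine (enorm_integral_le_lintegral_enorm _).trans (le_of_eq ?_)
  simp_rw [enorm_smul, enorm_heatKernel ht]

theorem lintegral_mul_lintegral_swap {φ k : Rn n → ℝ≥0∞} (hφ : Measurable φ) (hk : Measurable k)
    {F : Rn n → Rn n → ℝ≥0∞} (hF : Measurable (Function.uncurry F)) :
    ∫⁻ x, φ x * ∫⁻ z, k z * F x z = ∫⁻ z, k z * ∫⁻ x, φ x * F x z := by
  have hFx : ∀ x, Measurable (F x) := fun x => hF.comp (measurable_const.prodMk measurable_id)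
  have hFz : ∀ z, Measurable fun x => F x z :=
    fun z => hF.comp (measurable_id.prodMk measurable_const)
  have h1 : ∀ x, φ x * ∫⁻ z, k z * F x z = ∫⁻ z, φ x * (k z * F x z) := fun x =>
    (lintegral_const_mul _ (hk.mul (hFx x))).symm
  have h2 : ∀ z, k z * ∫⁻ x, φ x * F x z = ∫⁻ x, φ x * (k z * F x z) := fun z => by
    refine (lintegral_const_mul _ (hφ.mul (hFz z))).symm.trans ?_
    exact lintegral_congr fun x => mul_left_comm _ _ _
  simp_rw [h1, h2]
  exact lintegral_lintegral_swap ((hφ.comp measurable_fst).mul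
    ((hk.comp measurable_snd).mul hF)).aemeasurable

theorem kFun_heatVec_sub_self_le {f : Rn n → Rn n} (hf : Measurable f) (hk : ∀ τ, kFun f τ ≠ ∞)
    {t : ℝ} (ht : 0 < t) (τ : ℝ) :
    kFun (heatVec f t - f) τ ≤
      ∫⁻ z, ENNReal.ofReal (heatKernel t z) * kFun (fun x => f (x - z) - f x) τ := by
  refine kFun_le_iff.2 fun φ hφ => ?_
  have hfm : Measurable (Function.uncurry fun x z : Rn n => ‖f (x - z) - f x‖ₑ) :=
    ((hf.comp (measurable_fst.sub measurable_snd)).sub (hf.comp measurable_fst)).enorm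
  have hkm : Measurable fun z : Rn n => ENNReal.ofReal (heatKernel t z) :=
    (continuous_heatKernel t).measurable.ennreal_ofReal
  refine (lintegral_mono fun x => mul_le_mul_right (enorm_heatVec_sub_self_le hf hk ht x) _).trans ?_
  rw [lintegral_mul_lintegral_swap hφ.1 hkm hfm]
  exact lintegral_mono fun z =>
    mul_le_mul_right (lintegral_le_kFun hφ (fun x => f (x - z) - f x)) _

/-- Approximate identity at fixed τ: for ‖z‖ < δ continuity of translations applies, and for ‖z‖ ≥ δ
the second moment of the kernel, of order t, is divided by δ². -/
theorem tendsto_kFun_heatVec_sub_self {f : Rn n → Rn n} (hf : Measurable f)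
    (hd : ∀ y, 0 < y → distribFun f y ≠ ∞) (hk : ∀ τ, kFun f τ ≠ ∞) (τ : ℝ) :
    Tendsto (fun t => kFun (heatVec f t - f) τ) (𝓝[>] 0) (𝓝 0) := by
  rw [ENNReal.tendsto_nhds_zero]
  intro ε hε
  have h1 := ENNReal.tendsto_nhds_zero.1 (tendsto_kFun_translate_sub hf hd hk τ) (ε / 2)
    (ENNReal.half_pos hε.ne')
  obtain ⟨δ, hδ0, hδ⟩ := Metric.eventually_nhds_iff.1 h1
  have hc := heatConst_pos n 2
  have hlim : Tendsto (fun t : ℝ => 2 * kFun f τ * ENNReal.ofReal (heatConst n 2 / δ ^ 2 * t))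
      (𝓝[>] 0) (𝓝 0) := by
    have h2 : Tendsto (fun t : ℝ => ENNReal.ofReal (heatConst n 2 / δ ^ 2 * t)) (𝓝[>] 0)
        (𝓝 (ENNReal.ofReal (heatConst n 2 / δ ^ 2 * 0))) :=
      ENNReal.tendsto_ofReal (Tendsto.mono_left (Continuous.tendsto (by fun_prop) 0)
        nhdsWithin_le_nhds)
    simpa using ENNReal.Tendsto.const_mul h2
      (Or.inr (ENNReal.mul_ne_top ENNReal.ofNat_ne_top (hk τ)))
  filter_upwards [ENNReal.tendsto_nhds_zero.1 hlim (ε / 2) (ENNReal.half_pos hε.ne'),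
    self_mem_nhdsWithin] with t ht (ht0 : 0 < t)
  have hpt : ∀ z : Rn n, ENNReal.ofReal (heatKernel t z) * kFun (fun x => f (x - z) - f x) τ ≤
      ENNReal.ofReal (heatKernel t z) * (ε / 2) +
        2 * kFun f τ * ENNReal.ofReal (heatConst n 2 / δ ^ 2 * t * heatKernel (2 * t) z) := by
    intro z
    rcases lt_or_ge ‖z‖ δ with hz | hz
    · exact le_add_right (mul_le_mul_right (hδ (by simpa using hz)) _)
    · refine le_add_left ?_
      rw [mul_comm (2 * kFun f τ)]
      refine mul_le_mul' (ENNReal.ofReal_le_ofReal ?_) (kFun_translate_sub_le hf z τ)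
      have h3 := norm_pow_mul_heatKernel_le 2 ht0 z
      have h4 := heatKernel_nonneg ht0.le z
      rw [show ((2 : ℕ) : ℝ) / 2 = 1 by norm_num, Real.rpow_one] at h3
      calc heatKernel t z = (δ ^ 2 * heatKernel t z) / δ ^ 2 := by field_simp
        _ ≤ (‖z‖ ^ 2 * heatKernel t z) / δ ^ 2 := by gcongr
        _ ≤ (heatConst n 2 * t * heatKernel (2 * t) z) / δ ^ 2 := by gcongr
        _ = _ := by ring
  have hkm : Measurable fun z : Rn n => ENNReal.ofReal (heatKernel t z) :=
    (continuous_heatKernel t).measurable.ennreal_ofReal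
  calc _ ≤ _ := kFun_heatVec_sub_self_le hf hk ht0 τ
    _ ≤ _ := lintegral_mono hpt
    _ = ε / 2 + 2 * kFun f τ * ENNReal.ofReal (heatConst n 2 / δ ^ 2 * t) := by
        rw [lintegral_add_left (hkm.mul_const _), lintegral_mul_const _ hkm,
          lintegral_heatKernel ht0, one_mul, lintegral_const_mul' _ _
            (ENNReal.mul_ne_top ENNReal.ofNat_ne_top (hk τ)),
          lintegral_const_mul_heatKernel (by positivity) (by positivity)]
    _ ≤ ε / 2 + ε / 2 := add_le_add_right ht _
    _ = ε := ENNReal.add_halves ε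

/-! ### The integral equation on a bounded time interval -/

/-- The path `u` restricted to the time interval `(0,T)` and extended by zero. -/
def cutPath (T : ℝ) (u : ℝ → Rn n → Rn n) : ℝ → Rn n → Rn n := (Ioo 0 T).indicator u

theorem cutPath_of_mem {T t : ℝ} (u : ℝ → Rn n → Rn n) (ht : 0 < t) (htT : t < T) :
    cutPath T u t = u t := indicator_of_mem (mem_Ioo.2 ⟨ht, htT⟩) u

theorem cutPath_of_notMem {T t : ℝ} (u : ℝ → Rn n → Rn n) (ht : t ∉ Ioo 0 T) :
    cutPath T u t = 0 := indicator_of_notMem ht u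

theorem cutPath_cutPath {S T : ℝ} (hST : S ≤ T) (u : ℝ → Rn n → Rn n) :
    cutPath S (cutPath T u) = cutPath S u := by
  unfold cutPath
  rw [indicator_indicator, inter_eq_left.2 (Ioo_subset_Ioo_right hST)]

theorem cutPath_congr {T : ℝ} {u v : ℝ → Rn n → Rn n} (h : ∀ t, 0 < t → t < T → u t = v t) :
    cutPath T u = cutPath T v :=
  indicator_congr fun t ht => h t ht.1 ht.2

theorem measurable_cutPath {T : ℝ} {u : ℝ → Rn n → Rn n} (hu : Measurable (Function.uncurry u)) :
    Measurable (Function.uncurry (cutPath T u)) := by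
  have h : Function.uncurry (cutPath T u) =
      (Prod.fst ⁻¹' Ioo 0 T).indicator (Function.uncurry u) := by
    funext ⟨s, y⟩
    by_cases hs : s ∈ Ioo 0 T
    · rw [indicator_of_mem (show (s, y) ∈ Prod.fst ⁻¹' Ioo 0 T from hs)]
      exact congrFun (cutPath_of_mem u hs.1 hs.2) y
    · rw [indicator_of_notMem (show (s, y) ∉ Prod.fst ⁻¹' Ioo 0 T from hs)]
      exact congrFun (cutPath_of_notMem u hs) y
  rw [h]
  exact hu.indicator (measurable_fst measurableSet_Ioo)

theorem pathIn_cutPath {a M T : ℝ} {u : ℝ → Rn n → Rn n}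
    (hu : Measurable (Function.uncurry (cutPath T u)))
    (hM : ∀ s, 0 < s → s < T → ∀ y, ‖u s y‖ₑ ≤ ENNReal.ofReal (M * s ^ (-a))) :
    PathIn a M (cutPath T u) := by
  refine ⟨hu, fun s hs y => ?_⟩
  by_cases hsT : s < T
  · rw [cutPath_of_mem u hs hsT]
    exact hM s hs hsT y
  · rw [cutPath_of_notMem u fun h => hsT h.2]
    simp

theorem PathIn.bound_of_cutPath {a M T : ℝ} {u : ℝ → Rn n → Rn n} (hu : PathIn a M (cutPath T u))
    {s : ℝ} (hs : 0 < s) (hsT : s < T) (y : Rn n) :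
    ‖u s y‖ₑ ≤ ENNReal.ofReal (M * s ^ (-a)) := by
  have h := hu.2 s hs y
  rwa [cutPath_of_mem u hs hsT] at h

theorem PathIn.cutPath {a M T : ℝ} {u : ℝ → Rn n → Rn n} (hu : PathIn a M u) :
    PathIn a M (cutPath T u) :=
  pathIn_cutPath (measurable_cutPath hu.1) fun s hs _ => hu.2 s hs

theorem PathIn.mono {a M M' : ℝ} {u : ℝ → Rn n → Rn n} (hu : PathIn a M u) (hM : M ≤ M') :
    PathIn a M' u :=
  ⟨hu.1, fun s hs y => (hu.2 s hs y).trans (ENNReal.ofReal_le_ofReal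
    (mul_le_mul_of_nonneg_right hM (Real.rpow_nonneg hs.le _)))⟩

theorem rpow_neg_le_mul_rpow_neg {a a' s T : ℝ} (haa : a ≤ a') (hs : 0 < s) (hsT : s ≤ T) :
    s ^ (-a) ≤ T ^ (a' - a) * s ^ (-a') := by
  calc s ^ (-a) = s ^ (a' - a) * s ^ (-a') := by
        rw [← Real.rpow_add hs]; congr 1; ring
    _ ≤ _ := by
        have := Real.rpow_le_rpow hs.le hsT (by linarith : 0 ≤ a' - a)
        gcongr

theorem PathIn.mono_exponent {a a' M T : ℝ} (hM : 0 ≤ M) {u : ℝ → Rn n → Rn n}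
    (hu : PathIn a M (LorentzNS.cutPath T u)) (haa : a ≤ a') :
    PathIn a' (M * T ^ (a' - a)) (LorentzNS.cutPath T u) := by
  refine pathIn_cutPath hu.1 fun s hs hsT y => (hu.bound_of_cutPath hs hsT y).trans ?_
  rw [mul_assoc]
  exact ENNReal.ofReal_le_ofReal (mul_le_mul_of_nonneg_left
    (rpow_neg_le_mul_rpow_neg haa hs hsT.le) hM)

theorem PathIn.sub {a M M' : ℝ} (hM : 0 ≤ M) (hM' : 0 ≤ M') {u w : ℝ → Rn n → Rn n}
    (hu : PathIn a M u) (hw : PathIn a M' w) : PathIn a (M + M') (u - w) := by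
  refine ⟨hu.1.sub hw.1, fun s hs y => ?_⟩
  rw [add_mul, ENNReal.ofReal_add (by positivity) (by positivity)]
  exact (enorm_sub_le).trans (add_le_add (hu.2 s hs y) (hw.2 s hs y))

/-- Causality: the extended kernel vanishes for s ≥ t. -/
theorem duhamel_congr {u u' w w' : ℝ → Rn n → Rn n} {t : ℝ}
    (hu : ∀ s, 0 < s → s < t → u s = u' s) (hw : ∀ s, 0 < s → s < t → w s = w' s) (x : Rn n) :
    duhamel u w t x = duhamel u' w' t x := by
  unfold duhamel kernelOp
  refine integral_congr_ae ?_
  have h0 : ∀ᵐ z ∂(timeSpace n), z.1 ∈ Ioi (0 : ℝ) := by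
    have h1 : timeSpace n = (volume.prod volume).restrict (Ioi (0 : ℝ) ×ˢ univ) := by
      rw [timeSpace, ← Measure.prod_restrict, Measure.restrict_univ]
    rw [h1]
    filter_upwards [ae_restrict_mem (measurableSet_Ioi.prod MeasurableSet.univ)] with z hz
    exact hz.1
  filter_upwards [h0] with z hz
  rcases lt_or_ge z.1 t with h | h
  · rw [hu z.1 hz h, hw z.1 hz h]
  · rw [oseenGrad_of_nonpos (by linarith)]
    ext i
    simp [mulT_apply]

/-- Measurable functions `f` with finite K-functional and `‖S[f](t)‖_∞ ≤ K t^{-a}`. -/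
structure IsDatum (a K : ℝ) (f : Rn n → Rn n) : Prop where
  measurable : Measurable f
  kFun_ne_top : ∀ τ, kFun f τ ≠ ∞
  nonneg : 0 ≤ a
  lt_half : a < 1 / 2
  pos : 0 < K
  bound : ∀ t, 0 < t → ∀ x, ‖heatVec f t x‖ₑ ≤ ENNReal.ofReal (K * t ^ (-a))

/-- Solutions of the integral equation on `(0,T)` with `‖u(t)‖_∞ ≤ C t^{-a}`. -/
def IsLocalSol (a : ℝ) (f : Rn n → Rn n) (T : ℝ) (u : ℝ → Rn n → Rn n) : Prop :=
  (∃ M, 0 ≤ M ∧ PathIn a M (cutPath T u)) ∧ ∀ t, 0 < t → t < T → ∀ x,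
    u t x = heatVec f t x - duhamel (cutPath T u) (cutPath T u) t x

theorem IsLocalSol.restrict {a S T : ℝ} {f : Rn n → Rn n} {u : ℝ → Rn n → Rn n}
    (hu : IsLocalSol a f T u) (hST : S ≤ T) : IsLocalSol a f S u := by
  obtain ⟨⟨M, hM, hMu⟩, heq⟩ := hu
  refine ⟨⟨M, hM, ?_⟩, fun t ht htS x => ?_⟩
  · rw [← cutPath_cutPath hST]
    exact hMu.cutPath
  · rw [heq t ht (htS.trans_le hST)]
    have h : ∀ s, 0 < s → s < t → cutPath T u s = cutPath S u s := fun s hs hst => by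
      rw [cutPath_of_mem u hs (by linarith), cutPath_of_mem u hs (by linarith)]
    rw [duhamel_congr h h]

theorem IsLocalSol.congr {a T : ℝ} {f : Rn n → Rn n} {u v : ℝ → Rn n → Rn n}
    (hu : IsLocalSol a f T u) (huv : ∀ t, 0 < t → t < T → u t = v t) : IsLocalSol a f T v := by
  have h := cutPath_congr huv
  refine ⟨h ▸ hu.1, fun t ht htT x => ?_⟩
  rw [← h, ← huv t ht htT]
  exact hu.2 t ht htT x

theorem IsLocalSol.mono_exponent {a a' T : ℝ} {f : Rn n → Rn n} {u : ℝ → Rn n → Rn n}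
    (hT : 0 < T) (hu : IsLocalSol a f T u) (haa : a ≤ a') : IsLocalSol a' f T u := by
  obtain ⟨⟨M, hM, hMu⟩, heq⟩ := hu
  exact ⟨⟨_, by positivity, hMu.mono_exponent hM haa⟩, heq⟩

/-- Writing B[u,u] - B[v,v] = B[u-v,u] + B[v,u-v], the supremum of |u-v| satisfies a homogeneous
Volterra inequality, and Gronwall with α = 0 makes it vanish. -/
theorem IsLocalSol.unique {a T : ℝ} (ha : 0 ≤ a) (ha2 : a < 1 / 2) {f : Rn n → Rn n}
    {u v : ℝ → Rn n → Rn n} (hu : IsLocalSol a f T u) (hv : IsLocalSol a f T v) {t : ℝ}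
    (ht : 0 < t) (htT : t < T) : u t = v t := by
  obtain ⟨⟨M₁, hM₁, hMu⟩, hequ⟩ := hu
  obtain ⟨⟨M₂, hM₂, hMv⟩, heqv⟩ := hv
  have hM : 0 ≤ max M₁ M₂ := le_max_of_le_left hM₁
  replace hMu := hMu.mono (le_max_left M₁ M₂)
  replace hMv := hMv.mono (le_max_right M₁ M₂)
  set M := max M₁ M₂
  set U := cutPath T u with hU
  set V := cutPath T v with hV
  have hC := duhamelConst_nonneg n
  set b : ℝ → ℝ≥0∞ := fun s => ⨆ y, ‖(U - V) s y‖ₑ with hb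
  obtain ⟨L, -, hL⟩ := volterra_gronwall (D := 2 * (duhamelConst n * M)) ha ha2 (ht.trans htT)
    (by positivity)
  have hsub := hMu.sub hM hM hMv
  have hbs : ∀ s y, ‖(U - V) s y‖ₑ ≤ b s := fun s y => le_iSup (fun y => ‖(U - V) s y‖ₑ) y
  have h0 : b t ≤ L * 0 := by
    refine hL b 0 (M + M) (fun s hs _ => iSup_le fun y => hsub.2 s hs y) (fun s hs hsT => ?_)
      t ht htT
    rw [zero_add]
    refine iSup_le fun y => ?_
    have e1 : (U - V) s y = -(duhamel (U - V) U s y + duhamel V (U - V) s y) := by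
      rw [← duhamel_sub ha ha2 hM hM hMu hMu hMv hMv hs, Pi.sub_apply, Pi.sub_apply, hU, hV,
        cutPath_of_mem u hs hsT, cutPath_of_mem v hs hsT, hequ s hs hsT, heqv s hs hsT, ← hU, ← hV]
      abel
    rw [e1, enorm_neg]
    have b1 := enorm_duhamel_le_lintegral (a := a) (M := M) hsub.1 hMu.1 (b := b) (fun r hr z => by
      rw [mul_comm]; exact mul_le_mul' (hMu.2 r hr z) (hbs r z)) s y
    have b2 := enorm_duhamel_le_lintegral (a := a) (M := M) hMv.1 hsub.1 (b := b) (fun r hr z =>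
      mul_le_mul' (hMv.2 r hr z) (hbs r z)) s y
    refine (enorm_add_le _ _).trans ((add_le_add b1 b2).trans (le_of_eq ?_))
    rw [← two_mul, ← lintegral_const_mul' _ _ (by norm_num)]
    refine lintegral_congr fun r => ?_
    rw [← mul_assoc, ← ENNReal.ofReal_ofNat 2, ← ENNReal.ofReal_mul (by norm_num)]
    congr 2
    ring
  rw [mul_zero] at h0
  funext y
  have h1 := (hbs t y).trans h0
  rw [le_zero_iff, enorm_eq_zero, Pi.sub_apply, Pi.sub_apply, hU, hV, cutPath_of_mem u ht htT,
    cutPath_of_mem v ht htT, sub_eq_zero] at h1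
  exact h1

/-! ### Local existence -/

/-- The Picard map. -/
def picardMap (f : Rn n → Rn n) (T : ℝ) (v : ℝ → Rn n → Rn n) : ℝ → Rn n → Rn n :=
  cutPath T fun t x => heatVec f t x - duhamel v v t x

/-- The smallness condition for the Picard map. -/
def SmallTime (n : ℕ) (a K T : ℝ) : Prop :=
  8 * (duhamelConst n * betaConst 0 (2 * a)) * K * T ^ (1 / 2 - a) ≤ 1

theorem exists_smallTime (n : ℕ) {a K : ℝ} (ha2 : a < 1 / 2) (hK : 0 ≤ K) :
    ∃ T, 0 < T ∧ SmallTime n a K T := by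
  have hC := duhamelConst_nonneg n
  have hB := betaConst_pos (γ := 0) (β := 2 * a) (by norm_num) (by linarith)
  set A := 8 * (duhamelConst n * betaConst 0 (2 * a)) * K with hA
  have hA0 : 0 ≤ A := by positivity
  refine ⟨(A + 1)⁻¹ ^ (1 / 2 - a)⁻¹, by positivity, ?_⟩
  rw [SmallTime, ← hA, Real.rpow_inv_rpow (by positivity) (by linarith)]
  rw [← div_eq_mul_inv, div_le_one (by positivity)]
  linarith

/-- From t^{1/2-2a} ≤ T^{1/2-a} t^{-a} and the smallness of T the coefficient is at most MM'/(8K).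
With M = M' = 2K this is below K, so the ball of radius 2K is preserved; with M = ε, M' = 2K it is
ε/4, and the two terms of a difference add to ε/2. -/
theorem enorm_duhamel_le_of_lt {a K T M M' c : ℝ} (ha : 0 ≤ a) (ha2 : a < 1 / 2) (hM : 0 ≤ M)
    (hM' : 0 ≤ M') (hT : SmallTime n a K T) (hK : 0 < K) (hc : M * M' / K ≤ 8 * c)
    {u w : ℝ → Rn n → Rn n} (hu : PathIn a M u) (hw : PathIn a M' w) {t : ℝ} (ht : 0 < t)
    (htT : t < T) (x : Rn n) :
    ‖duhamel u w t x‖ₑ ≤ ENNReal.ofReal (c * t ^ (-a)) := by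
  have hC := duhamelConst_nonneg n
  have hB := betaConst_pos (γ := 0) (β := 2 * a) (by norm_num) (by linarith)
  refine (enorm_duhamel_le ha ha2 hM hM' hu hw ht x).trans (ENNReal.ofReal_le_ofReal ?_)
  have h1 : t ^ (1 / 2 - 2 * a) ≤ T ^ (1 / 2 - a) * t ^ (-a) := by
    have := rpow_neg_le_mul_rpow_neg (a := -(1 / 2 - 2 * a)) (a' := a) (by linarith) ht htT.le
    rwa [neg_neg, show a - -(1 / 2 - 2 * a) = 1 / 2 - a by ring] at this
  have h2 : 0 < t ^ (-a) := Real.rpow_pos_of_pos ht _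
  have h3 : (M * M' / K) * (8 * (duhamelConst n * betaConst 0 (2 * a)) * K * T ^ (1 / 2 - a)) ≤
      (M * M' / K) * 1 := mul_le_mul_of_nonneg_left hT (by positivity)
  calc duhamelConst n * (M * M') * betaConst 0 (2 * a) * t ^ (1 / 2 - 2 * a)
      ≤ duhamelConst n * (M * M') * betaConst 0 (2 * a) * (T ^ (1 / 2 - a) * t ^ (-a)) := by
        gcongr
    _ = (M * M' / K) * (8 * (duhamelConst n * betaConst 0 (2 * a)) * K * T ^ (1 / 2 - a)) / 8 *
          t ^ (-a) := by field_simp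
    _ ≤ c * t ^ (-a) := by
        refine mul_le_mul_of_nonneg_right ?_ h2.le
        linarith

theorem pathIn_picardMap {a K T : ℝ} {f : Rn n → Rn n} (hf : IsDatum a K f)
    (hT : SmallTime n a K T) {v : ℝ → Rn n → Rn n} (hv : PathIn a (2 * K) v) :
    PathIn a (2 * K) (picardMap f T v) := by
  have hK := hf.pos
  refine pathIn_cutPath (measurable_cutPath ?_) fun s hs hsT y => ?_
  · exact (measurable_heatVec hf.measurable).sub (measurable_duhamel hv.1 hv.1)
  · have h1 := enorm_duhamel_le_of_lt (c := K) hf.nonneg hf.lt_half (by positivity) (by positivity)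
      hT hK (by field_simp; nlinarith) hv hv hs hsT y
    have h2 := add_le_add (hf.bound s hs y) h1
    rw [← ENNReal.ofReal_add (by positivity) (by positivity), ← add_mul, ← two_mul] at h2
    exact enorm_sub_le.trans h2

theorem picardMap_contract {a K T ε : ℝ} {f : Rn n → Rn n} (hf : IsDatum a K f)
    (hT : SmallTime n a K T) {v w : ℝ → Rn n → Rn n} (hv : PathIn a (2 * K) v)
    (hw : PathIn a (2 * K) w) (hε : 0 ≤ ε) (hvw : PathIn a ε (v - w)) :
    PathIn a (ε / 2) (picardMap f T v - picardMap f T w) := by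
  have hK := hf.pos
  refine ⟨(pathIn_picardMap hf hT hv).1.sub (pathIn_picardMap hf hT hw).1, fun s hs y => ?_⟩
  by_cases hsT : s < T
  · have e1 : (picardMap f T v - picardMap f T w) s y =
        -(duhamel (v - w) v s y + duhamel w (v - w) s y) := by
      rw [← duhamel_sub hf.nonneg hf.lt_half (by positivity) (by positivity) hv hv hw hw hs,
        Pi.sub_apply, Pi.sub_apply, picardMap, picardMap, cutPath_of_mem _ hs hsT,
        cutPath_of_mem _ hs hsT]
      abel
    have b1 := enorm_duhamel_le_of_lt (c := ε / 4) hf.nonneg hf.lt_half hε (by positivity)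
      hT hK (by field_simp; linarith) hvw hv hs hsT y
    have b2 := enorm_duhamel_le_of_lt (c := ε / 4) hf.nonneg hf.lt_half (by positivity) hε
      hT hK (by field_simp; linarith) hw hvw hs hsT y
    have h2 := add_le_add b1 b2
    rw [← ENNReal.ofReal_add (by positivity) (by positivity), ← add_mul,
      show ε / 4 + ε / 4 = ε / 2 by ring] at h2
    rw [e1, enorm_neg]
    exact (enorm_add_le _ _).trans h2
  · have h : s ∉ Ioo 0 T := fun h => hsT h.2
    rw [Pi.sub_apply, Pi.sub_apply, picardMap, picardMap, cutPath_of_notMem _ h,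
      cutPath_of_notMem _ h]
    simp

/-- The Picard iterates. -/
def picardSeq (f : Rn n → Rn n) (T : ℝ) : ℕ → ℝ → Rn n → Rn n
  | 0 => 0
  | m + 1 => picardMap f T (picardSeq f T m)

theorem pathIn_zero (a : ℝ) {M : ℝ} : PathIn a M (0 : ℝ → Rn n → Rn n) :=
  ⟨measurable_const, fun s hs y => by simp⟩

theorem pathIn_picardSeq {a K T : ℝ} {f : Rn n → Rn n} (hf : IsDatum a K f)
    (hT : SmallTime n a K T) (m : ℕ) : PathIn a (2 * K) (picardSeq f T m) := by
  induction m with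
  | zero => exact pathIn_zero a
  | succ m ih => exact pathIn_picardMap hf hT ih

/-- The constant is arranged in the shape used by `cauchySeq_of_le_geometric_two`. -/
theorem pathIn_picardSeq_sub {a K T : ℝ} {f : Rn n → Rn n} (hf : IsDatum a K f)
    (hT : SmallTime n a K T) (m : ℕ) :
    PathIn a (4 * K / 2 / 2 ^ m) (picardSeq f T (m + 1) - picardSeq f T m) := by
  have hK := hf.pos
  induction m with
  | zero =>
    rw [show picardSeq f T (0 + 1) - picardSeq f T 0 = picardSeq f T 1 from sub_zero _]
    exact (pathIn_picardSeq hf hT 1).mono (by norm_num; linarith)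
  | succ m ih =>
    have h := picardMap_contract hf hT (pathIn_picardSeq hf hT (m + 1)) (pathIn_picardSeq hf hT m)
      (by positivity) ih
    rwa [div_div _ _ (2 : ℝ), ← pow_succ] at h

theorem PathIn.norm_le {a M : ℝ} (hM : 0 ≤ M) {u : ℝ → Rn n → Rn n} (hu : PathIn a M u) {s : ℝ}
    (hs : 0 < s) (y : Rn n) : ‖u s y‖ ≤ M * s ^ (-a) := by
  have h := hu.2 s hs y
  rwa [← ofReal_norm, ENNReal.ofReal_le_ofReal_iff (by positivity)] at h

theorem pathIn_of_norm_le {a M : ℝ} {u : ℝ → Rn n → Rn n} (hu : Measurable (Function.uncurry u))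
    (h : ∀ s, 0 < s → ∀ y, ‖u s y‖ ≤ M * s ^ (-a)) : PathIn a M u :=
  ⟨hu, fun s hs y => by
    rw [← ofReal_norm]
    exact ENNReal.ofReal_le_ofReal (h s hs y)⟩

theorem exists_picard_fixed {a K T : ℝ} {f : Rn n → Rn n} (hf : IsDatum a K f)
    (hT : SmallTime n a K T) :
    ∃ u, PathIn a (2 * K) u ∧ ∀ t, 0 < t → t < T → ∀ x,
      u t x = heatVec f t x - duhamel u u t x := by
  have hK := hf.pos
  have hdist : ∀ s, 0 < s → ∀ y m, dist (picardSeq f T m s y) (picardSeq f T (m + 1) s y) ≤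
      4 * K * s ^ (-a) / 2 / 2 ^ m := fun s hs y m => by
    rw [dist_comm, dist_eq_norm]
    refine ((pathIn_picardSeq_sub hf hT m).norm_le (by positivity) hs y).trans (le_of_eq ?_)
    ring
  have hdist0 : ∀ s, s ≤ 0 → ∀ m, picardSeq f T m s = 0 := fun s hs m => by
    cases m with
    | zero => rfl
    | succ m =>
      rw [picardSeq, picardMap]
      exact cutPath_of_notMem _ fun h => absurd h.1 (not_lt.2 hs)
  have hex : ∀ s y, ∃ l, Tendsto (fun m => picardSeq f T m s y) atTop (𝓝 l) := fun s y => by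
    rcases le_or_gt s 0 with hs | hs
    · exact ⟨0, by simp [hdist0 s hs]⟩
    · exact cauchySeq_tendsto_of_complete (cauchySeq_of_le_geometric_two (hdist s hs y))
  choose u hu using hex
  have hum : Measurable (Function.uncurry u) := by
    refine measurable_of_tendsto_metrizable (fun m => (pathIn_picardSeq hf hT m).1) ?_
    rw [tendsto_pi_nhds]
    exact fun z => hu z.1 z.2
  have huP : PathIn a (2 * K) u := pathIn_of_norm_le hum fun s hs y =>
    le_of_tendsto (hu s y).norm
      (Eventually.of_forall fun m => (pathIn_picardSeq hf hT m).norm_le (by positivity) hs y)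
  refine ⟨u, huP, fun t ht htT x => ?_⟩
  have herr : ∀ m, PathIn a (4 * K / 2 ^ m) (picardSeq f T m - u) := fun m =>
    pathIn_of_norm_le ((pathIn_picardSeq hf hT m).1.sub hum) fun s hs y => by
      rw [Pi.sub_apply, Pi.sub_apply, ← dist_eq_norm]
      refine (dist_le_of_le_geometric_two_of_tendsto (hdist s hs y) (hu s y) m).trans (le_of_eq ?_)
      ring
  -- The iterates converge to u at rate 2^{-m} in the weighted norm; the contraction carries this to
  -- their images, so u is a fixed point at every point of space, not merely almost everywhere.
  have hlim : Tendsto (fun m => picardSeq f T (m + 1) t x) atTop (𝓝 (picardMap f T u t x)) := by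
    rw [tendsto_iff_norm_sub_tendsto_zero]
    have h0 : Tendsto (fun m : ℕ => 4 * K / 2 / 2 ^ m * t ^ (-a)) atTop (𝓝 0) := by
      have := ((tendsto_pow_atTop_nhds_zero_of_lt_one (r := (2 : ℝ)⁻¹) (by norm_num)
        (by norm_num)).const_mul (4 * K / 2)).mul_const (t ^ (-a))
      simpa [div_eq_mul_inv] using this
    refine squeeze_zero (fun m => norm_nonneg _) (fun m => ?_) h0
    have h := (picardMap_contract hf hT (pathIn_picardSeq hf hT m) huP (by positivity)
      (herr m)).norm_le (by positivity) ht x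
    rwa [div_right_comm] at h
  have h1 := tendsto_nhds_unique ((tendsto_add_atTop_iff_nat 1).2 (hu t x)) hlim
  rw [h1, picardMap, cutPath_of_mem _ ht htT]

theorem exists_isLocalSol {a K : ℝ} {f : Rn n → Rn n} (hf : IsDatum a K f) :
    ∃ T u, 0 < T ∧ IsLocalSol a f T u := by
  obtain ⟨T, hT0, hT⟩ := exists_smallTime n hf.lt_half hf.pos.le
  obtain ⟨u, hu, heq⟩ := exists_picard_fixed hf hT
  have hK := hf.pos
  refine ⟨T, u, hT0, ⟨2 * K, by positivity, hu.cutPath⟩, fun t ht htT x => ?_⟩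
  have h : ∀ s, 0 < s → s < t → u s = cutPath T u s := fun s hs hst =>
    (cutPath_of_mem u hs (hst.trans htT)).symm
  rw [heq t ht htT x, duhamel_congr h h]

/-! ### Mild solutions and the integral equation -/

theorem timeInterval_ofReal {T : ℝ} (hT : 0 < T) : timeInterval (ENNReal.ofReal T) = Ioo 0 T := by
  ext t
  exact and_congr_right fun _ => ENNReal.ofReal_lt_ofReal_iff hT

theorem MemPath.exists_bound {σ T : ℝ} (hT : 0 < T) {u : ℝ → Rn n → Rn n}
    (hu : MemPath σ (ENNReal.ofReal T) u) : ∃ N : ℝ, 0 ≤ N ∧ ∀ s, 0 < s → s < T → ∀ y,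
      ‖u s y‖ₑ ≤ ENNReal.ofReal (N * s ^ (-(-σ / 2))) := by
  have h := hu.2
  rw [timeInterval_ofReal hT] at h
  set S := ⨆ t ∈ Ioo 0 T, ENNReal.ofReal (t ^ (-σ / 2)) * supNorm (u t) with hS
  refine ⟨S.toReal, ENNReal.toReal_nonneg, fun s hs hsT y => ?_⟩
  have h1 : ENNReal.ofReal (s ^ (-σ / 2)) * ‖u s y‖ₑ ≤ S :=
    (mul_le_mul_right (le_iSup (fun x => ‖u s x‖ₑ) y) _).trans
      (le_iSup₂ (f := fun t (_ : t ∈ Ioo 0 T) => ENNReal.ofReal (t ^ (-σ / 2)) * supNorm (u t)) s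
        ⟨hs, hsT⟩)
  rw [ENNReal.ofReal_mul ENNReal.toReal_nonneg, ENNReal.ofReal_toReal h.ne, Real.rpow_neg hs.le,
    ENNReal.ofReal_inv_of_pos (by positivity), ← div_eq_mul_inv,
    ENNReal.le_div_iff_mul_le (Or.inl (by simpa using Real.rpow_pos_of_pos hs _))
      (Or.inl ENNReal.ofReal_ne_top), mul_comm]
  exact h1

/-- The Duhamel estimates require Borel paths, while a mild solution is only almost everywhere
measurable on space-time. -/
theorem exists_pathIn_version {a M T : ℝ} {u : ℝ → Rn n → Rn n}
    (hu : AEStronglyMeasurable (fun z : ℝ × Rn n => u z.1 z.2)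
      (volume.restrict (Ioo 0 T ×ˢ (univ : Set (Rn n)))))
    (hb : ∀ s, 0 < s → s < T → ∀ y, ‖u s y‖ₑ ≤ ENNReal.ofReal (M * s ^ (-a))) :
    ∃ v, PathIn a M v ∧ ∀ᵐ s ∂(volume.restrict (Ioo 0 T)), u s =ᵐ[volume] v s := by
  set g := hu.mk _ with hg
  have hgm : Measurable g := hu.stronglyMeasurable_mk.measurable
  -- Cutting g to the set where the bound holds makes it valid everywhere; nothing changes on almost
  -- every slice because u obeys the bound.
  set A : Set (ℝ × Rn n) := {z | ‖g z‖ₑ ≤ ENNReal.ofReal (M * z.1 ^ (-a))} with hA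
  have hAm : MeasurableSet A := measurableSet_le hgm.enorm
    ((measurable_fst.pow_const _).const_mul M).ennreal_ofReal
  refine ⟨fun s y => A.indicator g (s, y), ⟨hgm.indicator hAm, fun s hs y => ?_⟩, ?_⟩
  · beta_reduce
    by_cases h : (s, y) ∈ A
    · rw [indicator_of_mem h]
      exact h
    · rw [indicator_of_notMem h]
      simp
  · have hae : ∀ᵐ z ∂((volume.restrict (Ioo 0 T)).prod (volume : Measure (Rn n))),
        u z.1 z.2 = g z := by
      have h : ∀ᵐ z ∂((volume.prod volume).restrict (Ioo 0 T ×ˢ (univ : Set (Rn n)))),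
          u z.1 z.2 = g z := hu.ae_eq_mk
      rwa [← Measure.prod_restrict, Measure.restrict_univ] at h
    filter_upwards [Measure.ae_ae_of_ae_prod hae, ae_restrict_mem measurableSet_Ioo] with s hs hsT
    filter_upwards [hs] with y hy
    rw [indicator_of_mem, hy]
    change ‖g (s, y)‖ₑ ≤ ENNReal.ofReal (M * s ^ (-a))
    rw [← hy]
    exact hb s hsT.1 hsT.2 y

theorem eq_heatVec_sub_duhamel {a a' K M T t : ℝ} {f : Rn n → Rn n} (hf : IsDatum a K f)
    (ha : 0 ≤ a') (ha2 : a' < 1 / 2) (hM : 0 ≤ M) {u v : ℝ → Rn n → Rn n} (hv : PathIn a' M v)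
    (huv : ∀ᵐ s ∂(volume.restrict (Ioo 0 T)), u s =ᵐ[volume] v s) (ht : 0 < t) (htT : t < T)
    {x : Rn n} (heq : ∀ i, u t x i = heatMap f i t x - bilinearOp u u i t x) :
    u t x = heatVec f t x - duhamel v v t x := by
  ext i
  rw [heq i, heatMap_eq_heatVec hf.measurable hf.kFun_ne_top ht,
    bilinearOp_eq_duhamel ha ha2 hM hv ht (ae_restrict_of_ae_restrict_of_subset
      (Ioo_subset_Ioo_right htT.le) huv) x i]
  rfl

/-- The larger of the two singularity exponents, from the datum and from the class of u, is
admissible for both and still below 1/2. -/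
theorem IsMildSolution.exists_isLocalSol {a K : ℝ} {f : Rn n → Rn n} (hf : IsDatum a K f)
    {T : ℝ≥0∞} {u : ℝ → Rn n → Rn n} (hu : IsMildSolution f T u) :
    ∃ a', a ≤ a' ∧ a' < 1 / 2 ∧
      ∀ S : ℝ, 0 < S → ENNReal.ofReal S < T → IsLocalSol a' f S u := by
  obtain ⟨⟨σ, hσ, hmem⟩, heq⟩ := hu
  refine ⟨max a (-σ / 2), le_max_left _ _, max_lt hf.lt_half (by linarith), fun S hS hST => ?_⟩
  set a' := max a (-σ / 2) with ha'
  have ha0 : 0 ≤ a' := hf.nonneg.trans (le_max_left _ _)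
  have ha2 : a' < 1 / 2 := max_lt hf.lt_half (by linarith)
  have hp := hmem _ (ENNReal.ofReal_pos.2 hS) hST
  obtain ⟨N, hN, hb⟩ := hp.exists_bound hS
  have hm := hp.1
  rw [timeInterval_ofReal hS] at hm
  have hM : 0 ≤ N * S ^ (a' - -σ / 2) := by positivity
  set M := N * S ^ (a' - -σ / 2) with hMdef
  have hb' : ∀ s, 0 < s → s < S → ∀ y, ‖u s y‖ₑ ≤ ENNReal.ofReal (M * s ^ (-a')) :=
    fun s hs hsS y => (hb s hs hsS y).trans (ENNReal.ofReal_le_ofReal (by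
      rw [hMdef, mul_assoc]
      exact mul_le_mul_of_nonneg_left (rpow_neg_le_mul_rpow_neg (le_max_right _ _) hs hsS.le) hN))
  have hmem' : ∀ t, 0 < t → t < S → t ∈ timeInterval T := fun t ht htS =>
    ⟨ht, ((ENNReal.ofReal_lt_ofReal_iff hS).2 htS).trans hST⟩
  obtain ⟨v, hv, huv⟩ := exists_pathIn_version hm hb'
  have hcut : PathIn a' M (cutPath S u) := by
    refine pathIn_cutPath ?_ hb'
    -- The equation holds at every point, and its right side is built from the Borel version v;
    -- hence u itself is Borel on the strip.
    rw [cutPath_congr fun t ht htS => funext fun x => eq_heatVec_sub_duhamel hf ha0 ha2 hM hv huv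
      ht htS (heq t (hmem' t ht htS) x)]
    exact measurable_cutPath ((measurable_heatVec hf.measurable).sub (measurable_duhamel hv.1 hv.1))
  refine ⟨⟨M, hM, hcut⟩, fun t ht htS x => ?_⟩
  refine eq_heatVec_sub_duhamel hf ha0 ha2 hM hcut ?_ ht htS (heq t (hmem' t ht htS) x)
  filter_upwards [ae_restrict_mem measurableSet_Ioo] with s hs
  rw [cutPath_of_mem u hs.1 hs.2]

/-- Near t = 0 uniqueness in the weaker class identifies u with the Picard solution, which has rate
t^{-a}; for s ≥ S the two weights are comparable. -/
theorem IsLocalSol.improve {a a' K T : ℝ} {f : Rn n → Rn n} (hf : IsDatum a K f) (haa : a ≤ a')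
    (ha2 : a' < 1 / 2) {u : ℝ → Rn n → Rn n} (hu : IsLocalSol a' f T u) : IsLocalSol a f T u := by
  obtain ⟨S, w, hS, hw⟩ := LorentzNS.exists_isLocalSol hf
  have huw : ∀ t, 0 < t → t < S → t < T → u t = w t := fun t ht htS htT => by
    have h1 := hu.restrict (min_le_right S T)
    have h2 := (hw.mono_exponent hS haa).restrict (min_le_left S T)
    exact h1.unique (hf.nonneg.trans haa) ha2 h2 ht (lt_min htS htT)
  obtain ⟨⟨M₁, hM₁, h1⟩, heq⟩ := hu
  obtain ⟨⟨M₂, hM₂, h2⟩, -⟩ := hw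
  refine ⟨⟨max M₂ (M₁ * (S ^ (-(a' - a)))), le_max_of_le_left hM₂,
    pathIn_cutPath h1.1 fun s hs hsT y => ?_⟩, heq⟩
  have hp : 0 ≤ s ^ (-a) := Real.rpow_nonneg hs.le _
  rcases lt_or_ge s S with hsS | hsS
  · rw [huw s hs hsS hsT]
    refine (h2.bound_of_cutPath hs hsS y).trans (ENNReal.ofReal_le_ofReal ?_)
    exact mul_le_mul_of_nonneg_right (le_max_left _ _) hp
  · refine (h1.bound_of_cutPath hs hsT y).trans (ENNReal.ofReal_le_ofReal ?_)
    refine le_trans ?_ (mul_le_mul_of_nonneg_right (le_max_right _ _) hp)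
    rw [mul_assoc]
    refine mul_le_mul_of_nonneg_left ?_ hM₁
    calc s ^ (-a') = s ^ (-(a' - a)) * s ^ (-a) := by
          rw [← Real.rpow_add hs]; congr 1; ring
      _ ≤ _ := mul_le_mul_of_nonneg_right
          (Real.rpow_le_rpow_of_nonpos hS hsS (by linarith)) hp

theorem exists_real_between {T : ℝ≥0∞} {t : ℝ} (ht : t ∈ timeInterval T) :
    ∃ S : ℝ, t < S ∧ 0 < S ∧ ENNReal.ofReal S < T := by
  obtain ⟨r, hr1, hr2⟩ := exists_between ht.2
  have h : t < r.toReal := by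
    rw [← ENNReal.ofReal_lt_iff_lt_toReal ht.1.le hr2.ne_top]
    exact hr1
  exact ⟨r.toReal, h, ht.1.trans h, by rwa [ENNReal.ofReal_toReal hr2.ne_top]⟩

/-- It removes the unknown exponent σ from the class: all mild solutions share the rate a, that is σ
= -2a, and can be compared directly. -/
theorem isMildSolution_iff {a K : ℝ} {f : Rn n → Rn n} (hf : IsDatum a K f) {T : ℝ≥0∞}
    {u : ℝ → Rn n → Rn n} : IsMildSolution f T u ↔
      ∀ S : ℝ, 0 < S → ENNReal.ofReal S < T → IsLocalSol a f S u := by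
  constructor
  · intro hu S hS hST
    obtain ⟨a', haa, ha2, h⟩ := hu.exists_isLocalSol hf
    exact (h S hS hST).improve hf haa ha2
  · intro h
    refine ⟨⟨-(2 * a), by linarith [hf.lt_half], fun S hS hST => ?_⟩, fun t ht x i => ?_⟩
    · have hSr : S = ENNReal.ofReal S.toReal := (ENNReal.ofReal_toReal hST.ne_top).symm
      have hS0 : 0 < S.toReal := ENNReal.toReal_pos hS.ne' hST.ne_top
      obtain ⟨⟨M, hM, hc⟩, -⟩ := h S.toReal hS0 (hSr ▸ hST)
      rw [hSr]
      unfold MemPath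
      rw [timeInterval_ofReal hS0]
      constructor
      · refine hc.1.aestronglyMeasurable.congr ?_
        filter_upwards [ae_restrict_mem (measurableSet_Ioo.prod MeasurableSet.univ)] with z hz
        exact congrFun (cutPath_of_mem u hz.1.1 hz.1.2) z.2
      · refine lt_of_le_of_lt (iSup₂_le fun t ht => ?_) (ENNReal.ofReal_lt_top (r := M))
        have hp := Real.rpow_pos_of_pos ht.1 a
        have h1 : supNorm (u t) ≤ ENNReal.ofReal (M * t ^ (-a)) :=
          iSup_le fun y => hc.bound_of_cutPath ht.1 ht.2 y
        refine (mul_le_mul_right h1 _).trans (le_of_eq ?_)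
        rw [show -(-(2 * a)) / 2 = a by ring, ← ENNReal.ofReal_mul hp.le, Real.rpow_neg ht.1.le]
        congr 1
        field_simp
    · obtain ⟨S, htS, hS, hST⟩ := exists_real_between ht
      obtain ⟨⟨M, hM, hc⟩, heq⟩ := h S hS hST
      rw [heq t ht.1 htS x, heatMap_eq_heatVec hf.measurable hf.kFun_ne_top ht.1,
        bilinearOp_eq_duhamel hf.nonneg hf.lt_half hM hc ht.1 ?_ x i]
      · rfl
      · filter_upwards [ae_restrict_mem measurableSet_Ioo] with s hs
        rw [cutPath_of_mem u hs.1 (hs.2.trans htS)]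

/-! ### The maximal solution -/

theorem maximalTime_pos {a K : ℝ} {f : Rn n → Rn n} (hf : IsDatum a K f) : 0 < maximalTime f := by
  obtain ⟨T, u, hT, hu⟩ := exists_isLocalSol hf
  have hT' := ENNReal.ofReal_pos.2 hT
  refine hT'.trans_le (le_sSup ⟨hT', u, (isMildSolution_iff hf).2 fun S hS hST => hu.restrict ?_⟩)
  exact ((ENNReal.ofReal_lt_ofReal_iff hT).1 hST).le

theorem exists_isLocalSol_of_lt {a K S : ℝ} {f : Rn n → Rn n} (hf : IsDatum a K f) (hS : 0 < S)
    (hST : ENNReal.ofReal S < maximalTime f) : ∃ v, IsLocalSol a f S v := by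
  obtain ⟨T, ⟨-, v, hv⟩, hT⟩ := lt_sSup_iff.1 hST
  exact ⟨v, (isMildSolution_iff hf).1 hv S hS hT⟩

theorem exists_maximal_solution {a K : ℝ} {f : Rn n → Rn n} (hf : IsDatum a K f) :
    ∃ u, IsMildSolution f (maximalTime f) u := by
  have h : ∀ t ∈ timeInterval (maximalTime f), ∃ S v, t < S ∧ IsLocalSol a f S v := fun t ht => by
    obtain ⟨S, htS, hS, hST⟩ := exists_real_between ht
    obtain ⟨v, hv⟩ := exists_isLocalSol_of_lt hf hS hST
    exact ⟨S, v, htS, hv⟩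
  choose! S v hS hv using h
  -- Each t selects its own solution on an interval extending beyond t; uniqueness makes the
  -- selections coherent, so the diagonal agrees with one local solution on every (0,R).
  refine ⟨fun t => v t t, (isMildSolution_iff hf).2 fun R hR hRT => ?_⟩
  obtain ⟨w, hw⟩ := exists_isLocalSol_of_lt hf hR hRT
  refine hw.congr fun t ht htR => ?_
  have htm : t ∈ timeInterval (maximalTime f) :=
    ⟨ht, ((ENNReal.ofReal_lt_ofReal_iff hR).2 htR).trans hRT⟩
  exact (hw.restrict (min_le_left R (S t))).unique hf.nonneg hf.lt_half
    ((hv t htm).restrict (min_le_right R (S t))) ht (lt_min htR (hS t htm))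

theorem IsMildSolution.unique {a K : ℝ} {f : Rn n → Rn n} (hf : IsDatum a K f) {T : ℝ≥0∞}
    {u v : ℝ → Rn n → Rn n} (hu : IsMildSolution f T u) (hv : IsMildSolution f T v) {t : ℝ}
    (ht : t ∈ timeInterval T) : u t = v t := by
  obtain ⟨S, htS, hS, hST⟩ := exists_real_between ht
  exact ((isMildSolution_iff hf).1 hu S hS hST).unique hf.nonneg hf.lt_half
    ((isMildSolution_iff hf).1 hv S hS hST) ht.1 htS

/-! ### Regularity of solutions -/

theorem IsLocalSol.measurable {a T : ℝ} {f : Rn n → Rn n} {u : ℝ → Rn n → Rn n}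
    (hu : IsLocalSol a f T u) {t : ℝ} (ht : 0 < t) (htT : t < T) : Measurable (u t) := by
  obtain ⟨⟨M, -, hM⟩, -⟩ := hu
  rw [← cutPath_of_mem u ht htT]
  exact hM.1.comp (measurable_const.prodMk measurable_id)

theorem IsLocalSol.kFun_le_add {a K T M : ℝ} {f : Rn n → Rn n} (hf : IsDatum a K f)
    {u : ℝ → Rn n → Rn n} (hu : IsLocalSol a f T u) (hP : PathIn a M (cutPath T u)) {t : ℝ}
    (ht : 0 < t) (htT : t < T) (τ : ℝ) :
    kFun (cutPath T u t) τ ≤ kFun f τ + ∫⁻ s in Ioi (0 : ℝ),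
      ENNReal.ofReal (duhamelConst n * M * timeKer 0 (t - s) * s ^ (-a)) *
        kFun (cutPath T u s) τ := by
  have e : cutPath T u t = heatVec f t - duhamel (cutPath T u) (cutPath T u) t := by
    rw [cutPath_of_mem u ht htT]
    exact funext fun x => hu.2 t ht htT x
  have h1 := kFun_heatVec_le hf.measurable ht τ
  have h2 := kFun_duhamel_le_lintegral hP hP.1 t τ
  have h3 : kFun (heatVec f t - duhamel (cutPath T u) (cutPath T u) t) τ ≤ _ :=
    kFun_sub_le (measurable_heatVec_apply hf.measurable t)
  rw [← e] at h3
  exact h3.trans (add_le_add h1 h2)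

theorem PathIn.kFun_le {a M : ℝ} {v : ℝ → Rn n → Rn n} (hv : PathIn a M v) {t : ℝ} (ht : 0 < t)
    (τ : ℝ) : kFun (v t) τ ≤ ENNReal.ofReal (max τ 0 * M * t ^ (-a)) := by
  refine (kFun_le_of_bound (hv.2 t ht)).trans ?_
  rw [mul_assoc, ENNReal.ofReal_mul (p := max τ 0) (le_max_right _ _)]
  exact mul_le_mul_left (ENNReal.ofReal_le_ofReal (le_max_left _ _)) _

/-- Propagation of the datum: Gronwall for s ↦ K(u(s),τ) with α = K(f,τ). The linear inequality
comes from bounding one factor of the product by M s^{-a}. -/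
theorem IsLocalSol.kFun_le {a K T : ℝ} {f : Rn n → Rn n} (hf : IsDatum a K f) (hT : 0 < T)
    {u : ℝ → Rn n → Rn n} (hu : IsLocalSol a f T u) :
    ∃ L : ℝ≥0∞, L ≠ ∞ ∧ ∀ τ s, 0 < s → kFun (cutPath T u s) τ ≤ L * kFun f τ := by
  obtain ⟨M, hM, hP⟩ := hu.1
  obtain ⟨L, hL, h⟩ := volterra_gronwall (D := duhamelConst n * M) hf.nonneg hf.lt_half hT
    (mul_nonneg (duhamelConst_nonneg n) hM)
  refine ⟨L, hL, fun τ s hs => ?_⟩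
  rcases lt_or_ge s T with hsT | hsT
  -- The a priori constant grows with τ, but L does not see it.
  · exact h (fun s => kFun (cutPath T u s) τ) (kFun f τ) (max τ 0 * M)
      (fun t ht _ => hP.kFun_le ht τ) (fun t ht htT => hu.kFun_le_add hf hP ht htT τ) s hs hsT
  · rw [cutPath_of_notMem u fun h => absurd h.2 (not_lt.2 hsT)]
    refine (kFun_le_of_bound (M := 0) fun x => by simp).trans (by simp)

theorem IsLocalSol.sub_eq {a T : ℝ} {f : Rn n → Rn n} {u : ℝ → Rn n → Rn n}
    (hu : IsLocalSol a f T u) {t t₀ : ℝ} (ht : 0 < t) (htT : t < T) (ht₀ : 0 < t₀) (ht₀T : t₀ < T) :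
    u t - u t₀ = (heatVec f t - heatVec f t₀) -
      (duhamel (cutPath T u) (cutPath T u) t - duhamel (cutPath T u) (cutPath T u) t₀) := by
  funext x
  simp only [Pi.sub_apply]
  rw [hu.2 t ht htT, hu.2 t₀ ht₀ ht₀T]
  abel

theorem tendsto_time_coeff {c γ β t₀ : ℝ} (hγ : 0 < γ) (ht₀ : 0 < t₀) :
    Tendsto (fun t : ℝ => ENNReal.ofReal (c * |t - t₀| ^ γ * (t ^ β + t₀ ^ β))) (𝓝 t₀) (𝓝 0) := by
  have h1 : ContinuousAt (fun t : ℝ => c * |t - t₀| ^ γ * (t ^ β + t₀ ^ β)) t₀ := by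
    have h2 : ContinuousAt (fun t : ℝ => |t - t₀| ^ γ) t₀ :=
      (by fun_prop : ContinuousAt (fun t : ℝ => |t - t₀|) t₀).rpow_const (Or.inr hγ.le)
    have h3 : ContinuousAt (fun t : ℝ => t ^ β) t₀ := Real.continuousAt_rpow_const _ _ (Or.inl ht₀.ne')
    exact (continuousAt_const.mul h2).mul (h3.add continuousAt_const)
  have h4 := ENNReal.tendsto_ofReal h1.tendsto
  simpa [Real.zero_rpow hγ.ne'] using h4

/-- The coefficient c(t) is the L¹ distance of the heat kernels plus the Hölder factor of the
Duhamel term, both free of τ. The bound is by c(t) times a finite constant, so q = ∞ is covered too.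
-/
theorem IsLocalSol.tendsto_lorentzQuasinorm {a K T : ℝ} {f : Rn n → Rn n} (hf : IsDatum a K f)
    {p q : ℝ≥0∞} (hq : 1 ≤ q) (hN : lorentzFun p q (fun τ => kFun f τ / ENNReal.ofReal τ) ≠ ∞)
    {u : ℝ → Rn n → Rn n} (hu : IsLocalSol a f T u) {t₀ : ℝ} (ht₀ : 0 < t₀) (ht₀T : t₀ < T) :
    Tendsto (fun t => lorentzQuasinorm p q (u t - u t₀)) (𝓝 t₀) (𝓝 0) := by
  obtain ⟨L, hL, hk⟩ := hu.kFun_le hf (ht₀.trans ht₀T)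
  obtain ⟨M, hM, hP⟩ := hu.1
  set N := lorentzFun p q (fun τ => kFun f τ / ENNReal.ofReal τ)
  set c : ℝ → ℝ≥0∞ := fun t => (∫⁻ x : Rn n, ‖heatKernel t x - heatKernel t₀ x‖ₑ) +
    ENNReal.ofReal (duhamelConst n * M * betaConst (1 / 4) a * |t - t₀| ^ (1 / 4 : ℝ) *
        (t ^ (1 / 2 - 1 / 4 - a) + t₀ ^ (1 / 2 - 1 / 4 - a))) * L with hc
  have hc0 : Tendsto c (𝓝 t₀) (𝓝 0) := by
    have h1 := (tendsto_lintegral_heatKernel_sub (n := n) ht₀).add (ENNReal.Tendsto.mul_const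
      (tendsto_time_coeff (c := duhamelConst n * M * betaConst (1 / 4) a) (γ := 1 / 4)
        (β := 1 / 2 - 1 / 4 - a) (by norm_num) ht₀) (Or.inr hL))
    rwa [zero_mul, add_zero] at h1
  have hcN : Tendsto (fun t => c t * N) (𝓝 t₀) (𝓝 0) := by
    simpa using ENNReal.Tendsto.mul_const hc0 (Or.inr hN)
  refine tendsto_of_tendsto_of_tendsto_of_le_of_le' tendsto_const_nhds hcN
    (Eventually.of_forall fun _ => zero_le) ?_
  filter_upwards [Ioo_mem_nhds ht₀ ht₀T, hc0.eventually (Iio_mem_nhds ENNReal.zero_lt_top)]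
    with t ht htc
  refine lorentzQuasinorm_le_of_kFun_le hq
    ((hu.measurable ht.1 ht.2).sub (hu.measurable ht₀ ht₀T)) (ne_of_lt htc) fun τ _ => ?_
  rw [hu.sub_eq ht.1 ht.2 ht₀ ht₀T]
  refine (kFun_sub_le ((measurable_heatVec_apply hf.measurable t).sub
    (measurable_heatVec_apply hf.measurable t₀))).trans ?_
  rw [hc, add_mul, mul_assoc _ L]
  exact add_le_add (kFun_heatVec_time_sub_le hf.measurable hf.kFun_ne_top ht.1 ht₀ τ)
    (kFun_duhamel_time_sub_le hf.nonneg hf.lt_half hM hM hP hP (hk τ) ht.1 ht₀ (by norm_num)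
      (by norm_num))

/-- The exponent 1/4 stands for any time Hölder exponent in (0,1/2). -/
theorem IsLocalSol.tendsto_supNorm {a K T : ℝ} {f : Rn n → Rn n} (hf : IsDatum a K f)
    (hk0 : Tendsto (kFun f) (𝓝[>] 0) (𝓝 0)) {u : ℝ → Rn n → Rn n} (hu : IsLocalSol a f T u)
    {t₀ : ℝ} (ht₀ : 0 < t₀) (ht₀T : t₀ < T) :
    Tendsto (fun t => supNorm (u t - u t₀)) (𝓝 t₀) (𝓝 0) := by
  obtain ⟨M, hM, hP⟩ := hu.1
  rw [ENNReal.tendsto_nhds_zero]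
  intro ε hε
  have hε2 := ENNReal.half_pos hε.ne'
  filter_upwards [Ioo_mem_nhds ht₀ ht₀T,
    eventually_enorm_heatVec_sub_le hf.measurable hf.kFun_ne_top hk0 ht₀ hε2,
    ENNReal.tendsto_nhds_zero.1 (tendsto_time_coeff
      (c := duhamelConst n * (M * M) * betaConst (1 / 4) (2 * a)) (γ := 1 / 4)
        (β := 1 / 2 - 1 / 4 - 2 * a) (by norm_num) ht₀) _ hε2] with t ht h1 h2
  refine iSup_le fun x => ?_
  rw [hu.sub_eq ht.1 ht.2 ht₀ ht₀T, ← ENNReal.add_halves ε]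
  exact enorm_sub_le.trans (add_le_add (h1 x) ((enorm_duhamel_time_sub_le hf.nonneg hf.lt_half hM hM
    hP hP ht.1 ht₀ (by norm_num) (by norm_num) x).trans h2))

theorem min_le_add_mul_rpow {A B r α : ℝ} (hA : 0 ≤ A) (hB : 0 ≤ B) (hr : 0 ≤ r) (hα0 : 0 < α)
    (hα : α ≤ 1) : min (A * r) B ≤ (A + B) * r ^ α := by
  have hp := Real.rpow_nonneg hr α
  rcases le_total r 1 with h | h
  · have h1 : r ≤ r ^ α := by
      simpa using Real.rpow_le_rpow_of_exponent_ge' hr h hα0.le hα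
    calc min (A * r) B ≤ A * r := min_le_left _ _
      _ ≤ (A + B) * r ^ α := by gcongr; linarith
  · have h1 : 1 ≤ r ^ α := Real.one_le_rpow h hα0.le
    calc min (A * r) B ≤ B * 1 := by simp
      _ ≤ (A + B) * r ^ α := by gcongr; linarith

/-- Interpolation between the Lipschitz bound of S[f](t) and twice its sup bound. -/
theorem enorm_heatVec_holder_le {a K : ℝ} {f : Rn n → Rn n} (hf : IsDatum a K f) {M b : ℝ}
    (hM0 : 0 ≤ M) (hM : ∀ τ, 0 < τ → kFun f τ ≤ ENNReal.ofReal (M * τ ^ (1 - b))) {α : ℝ}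
    (hα0 : 0 < α) (hα : α < 1) {t : ℝ} (ht : 0 < t) (x h : Rn n) :
    ‖heatVec f t (x + h) - heatVec f t x‖ₑ ≤ ENNReal.ofReal
      ((heatConst n 1 * t ^ (-(1 / 2) : ℝ) *
        (M * (4 * Real.pi) ^ (-(n * b / 2) : ℝ) * (2 * t) ^ (-(n * b / 2) : ℝ)) +
        2 * (K * t ^ (-a))) * ‖h‖ ^ α) := by
  have hc := heatConst_pos n 1
  have hK := hf.pos
  have h1 := enorm_heatVec_shift_le hf.measurable hf.kFun_ne_top hM ht x h
  have h2 : ‖heatVec f t (x + h) - heatVec f t x‖ₑ ≤ ENNReal.ofReal (2 * (K * t ^ (-a))) := by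
    rw [two_mul, ENNReal.ofReal_add (by positivity) (by positivity)]
    exact enorm_sub_le.trans (add_le_add (hf.bound t ht _) (hf.bound t ht _))
  have h3 := le_min h1 h2
  rw [← (ENNReal.ofReal_mono).map_min] at h3
  exact h3.trans (ENNReal.ofReal_le_ofReal
    (min_le_add_mul_rpow (by positivity) (by positivity) (norm_nonneg h) hα0 hα.le))

theorem IsLocalSol.eHolderNorm_le {a K T : ℝ} {f : Rn n → Rn n} (hf : IsDatum a K f) {M b : ℝ}
    (hM0 : 0 ≤ M) (hM : ∀ τ, 0 < τ → kFun f τ ≤ ENNReal.ofReal (M * τ ^ (1 - b)))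
    {u : ℝ → Rn n → Rn n} (hu : IsLocalSol a f T u) {α : ℝ≥0} (hα0 : 0 < α) (hα : α < 1) {t₀ : ℝ}
    (ht₀ : 0 < t₀) (ht₀T : t₀ < T) :
    ∃ C : ℝ≥0, ∀ᶠ t in 𝓝 t₀, eHolderNorm α (u t) ≤ C := by
  obtain ⟨M', hM', hP⟩ := hu.1
  have hc := heatConst_pos n 1
  have hK := hf.pos
  have hD := duhamelConst_nonneg n
  have hα1 : (α : ℝ) < 1 := by exact_mod_cast hα
  have hα2 : 0 < (α : ℝ) := by exact_mod_cast hα0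
  have hB := betaConst_pos (γ := (α : ℝ) / 2) (β := 2 * a) (by linarith)
    (by linarith [hf.lt_half])
  set g : ℝ → ℝ := fun t => (heatConst n 1 * t ^ (-(1 / 2) : ℝ) *
        (M * (4 * Real.pi) ^ (-(n * b / 2) : ℝ) * (2 * t) ^ (-(n * b / 2) : ℝ)) +
        2 * (K * t ^ (-a))) +
      2 * duhamelConst n * (M' * M') * betaConst (α / 2) (2 * a) *
        t ^ (1 / 2 - α / 2 - 2 * a : ℝ) with hg
  have hgc : ContinuousAt g t₀ := by
    have h1 : ∀ β : ℝ, ContinuousAt (fun t : ℝ => t ^ β) t₀ := fun β =>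
      Real.continuousAt_rpow_const _ _ (Or.inl ht₀.ne')
    have h2 : ∀ β : ℝ, ContinuousAt (fun t : ℝ => (2 * t) ^ β) t₀ := fun β =>
      (by fun_prop : ContinuousAt (fun t : ℝ => 2 * t) t₀).rpow_const (Or.inl (by positivity))
    exact ((((continuousAt_const.mul (h1 _)).mul (continuousAt_const.mul (h2 _))).add
      (continuousAt_const.mul (continuousAt_const.mul (h1 _))))).add
      (continuousAt_const.mul (h1 _))
  -- The Hölder constant g(t) is continuous in t at t₀, hence below g(t₀) + 1 nearby.
  refine ⟨(g t₀ + 1).toNNReal, ?_⟩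
  filter_upwards [Ioo_mem_nhds ht₀ ht₀T,
    hgc.eventually (Iio_mem_nhds (lt_add_one (g t₀)))] with t ht hgt
  have hgt : g t < g t₀ + 1 := hgt
  refine HolderWith.eHolderNorm_le fun y x => ?_
  set h := y - x with hh
  have hy : y = x + h := by rw [hh]; abel
  have e : u t (x + h) - u t x = (heatVec f t (x + h) - heatVec f t x) -
      (duhamel (cutPath T u) (cutPath T u) t (x + h) -
        duhamel (cutPath T u) (cutPath T u) t x) := by
    rw [hu.2 t ht.1 ht.2, hu.2 t ht.1 ht.2]
    abel
  have ht0 := ht.1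
  have h1 := enorm_heatVec_holder_le hf hM0 hM hα2 hα1 ht.1 x h
  have h2 := enorm_duhamel_shift_le hf.nonneg hf.lt_half hM' hM' hP hP ht.1 hα2.le hα1 x h
  have h3 : ‖u t (x + h) - u t x‖ₑ ≤ ENNReal.ofReal (g t * ‖h‖ ^ (α : ℝ)) := by
    rw [e]
    refine enorm_sub_le.trans ((add_le_add h1 h2).trans (le_of_eq ?_))
    rw [← ENNReal.ofReal_add (by positivity) (by positivity), hg]
    congr 1
    ring
  rw [edist_eq_enorm_sub, edist_eq_enorm_sub, ← hh, hy]
  refine h3.trans ?_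
  rw [← ofReal_norm h, ENNReal.ofReal_rpow_of_nonneg (norm_nonneg h) hα2.le,
    ENNReal.ofReal_mul (by positivity)]
  exact mul_le_mul_left (ENNReal.ofReal_le_ofReal hgt.le) _

/-- K(u(t)-f,τ) is dominated by (L+1) K(f,τ) and tends to 0 for each τ: the heat part by continuity
of translations, the Duhamel part by its factor t^{1/2-a}. -/
theorem IsLocalSol.tendsto_initial {a K T : ℝ} {f : Rn n → Rn n} (hf : IsDatum a K f)
    {p q : ℝ≥0∞} (hp1 : 1 ≤ p) (hp : p ≠ ∞) (hq1 : 1 ≤ q) (hq : q ≠ ∞)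
    (hd : ∀ y, 0 < y → distribFun f y ≠ ∞)
    (hN : lorentzFun p q (fun τ => kFun f τ / ENNReal.ofReal τ) ≠ ∞) (hT : 0 < T)
    {u : ℝ → Rn n → Rn n} (hu : IsLocalSol a f T u) :
    Tendsto (fun t => lorentzQuasinorm p q (u t - f)) (𝓝[>] 0) (𝓝 0) := by
  obtain ⟨L, hL, hk⟩ := hu.kFun_le hf hT
  obtain ⟨M, hM, hP⟩ := hu.1
  have hev : ∀ᶠ t in 𝓝[>] (0 : ℝ), t ∈ Ioo 0 T := Ioo_mem_nhdsGT hT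
  refine tendsto_lorentzQuasinorm_of_kFun hp1 hp hq1 hq hN (C := L + 1) ?_
    (ENNReal.add_ne_top.2 ⟨hL, ENNReal.one_ne_top⟩) ?_ fun τ hτ => ?_
  · filter_upwards [hev] with t ht
    exact (hu.measurable ht.1 ht.2).sub hf.measurable
  · filter_upwards [hev] with t ht τ _
    rw [add_mul, one_mul]
    refine (kFun_sub_le (hu.measurable ht.1 ht.2)).trans (add_le_add_left ?_ _)
    rw [← cutPath_of_mem u ht.1 ht.2]
    exact hk τ t ht.1
  · have h1 := tendsto_kFun_heatVec_sub_self hf.measurable hd hf.kFun_ne_top τ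
    have h2 : Tendsto (fun t : ℝ => ENNReal.ofReal
        (duhamelConst n * M * betaConst 0 a * t ^ (1 / 2 - a)) * (L * kFun f τ))
        (𝓝[>] 0) (𝓝 0) := by
      have ha : 0 < 1 / 2 - a := by linarith [hf.lt_half]
      have h3 : ContinuousAt (fun t : ℝ => duhamelConst n * M * betaConst 0 a * t ^ (1 / 2 - a)) 0 :=
        continuousAt_const.mul (Real.continuousAt_rpow_const _ _ (Or.inr ha.le))
      have h4 := ENNReal.Tendsto.mul_const
        (ENNReal.tendsto_ofReal (h3.tendsto.mono_left (nhdsWithin_le_nhds (s := Ioi 0))))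
        (Or.inr (ENNReal.mul_ne_top hL (hf.kFun_ne_top τ)))
      rwa [Real.zero_rpow ha.ne', mul_zero, ENNReal.ofReal_zero, zero_mul] at h4
    have h5 := h1.add h2
    rw [add_zero] at h5
    refine tendsto_of_tendsto_of_tendsto_of_le_of_le' tendsto_const_nhds h5
      (Eventually.of_forall fun _ => zero_le) ?_
    filter_upwards [hev] with t ht
    have e : u t - f = (heatVec f t - f) - duhamel (cutPath T u) (cutPath T u) t := by
      funext x
      simp only [Pi.sub_apply]
      rw [hu.2 t ht.1 ht.2]
      abel
    rw [e]
    exact (kFun_sub_le ((measurable_heatVec_apply hf.measurable t).sub hf.measurable)).trans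
      (add_le_add_right (kFun_duhamel_le hf.nonneg hf.lt_half hM hP hP.1 (hk τ) ht.1) _)

theorem IsLocalSol.memLorentz {a K T : ℝ} {f : Rn n → Rn n} (hf : IsDatum a K f)
    {p q : ℝ≥0∞} (hq : 1 ≤ q) (hN : lorentzFun p q (fun τ => kFun f τ / ENNReal.ofReal τ) ≠ ∞)
    {u : ℝ → Rn n → Rn n} (hu : IsLocalSol a f T u) {t : ℝ} (ht : 0 < t) (htT : t < T) :
    MemLorentz p q (u t) := by
  obtain ⟨L, hL, hk⟩ := hu.kFun_le hf (ht.trans htT)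
  have hm := hu.measurable ht htT
  refine ⟨hm.aestronglyMeasurable, (lorentzQuasinorm_le_of_kFun_le hq hm hL fun τ _ => ?_).trans_lt
    (ENNReal.mul_lt_top (lt_top_iff_ne_top.2 hL) (lt_top_iff_ne_top.2 hN))⟩
  rw [← cutPath_of_mem u ht htT]
  exact hk τ t ht

theorem IsLocalSol.supNorm_lt_top {a T : ℝ} {f : Rn n → Rn n} {u : ℝ → Rn n → Rn n}
    (hu : IsLocalSol a f T u) {t : ℝ} (ht : 0 < t) (htT : t < T) : supNorm (u t) < ∞ := by
  obtain ⟨M, -, hP⟩ := hu.1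
  exact (iSup_le fun x => hP.bound_of_cutPath ht htT x).trans_lt ENNReal.ofReal_lt_top

/-! ### Data in Lorentz spaces -/

/-- With b = 1/r the condition nb < 1 is r > n, and it is exactly what puts a = nb/2 below 1/2. -/
theorem isDatum_of_kFun_le {f : Rn n → Rn n} (hf : Measurable f) {M b : ℝ} (hM0 : 0 < M)
    (hb : 0 ≤ b) (hnb : n * b < 1)
    (hM : ∀ τ, 0 < τ → kFun f τ ≤ ENNReal.ofReal (M * τ ^ (1 - b))) :
    IsDatum (n * b / 2) (M * (4 * Real.pi) ^ (-(n * b / 2) : ℝ)) f where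
  measurable := hf
  kFun_ne_top τ := ne_top_of_le_ne_top ENNReal.ofReal_ne_top
    ((kFun_mono f (le_max_left τ 1)).trans (hM _ (by positivity)))
  nonneg := by positivity
  lt_half := by linarith
  pos := by positivity
  bound t ht x := enorm_heatVec_le hM ht x

theorem tendsto_kFun_zero {f : Rn n → Rn n} {M b : ℝ} (hb : b < 1)
    (hM : ∀ τ, 0 < τ → kFun f τ ≤ ENNReal.ofReal (M * τ ^ (1 - b))) :
    Tendsto (kFun f) (𝓝[>] 0) (𝓝 0) := by
  have hb' : 0 < 1 - b := by linarith
  have h1 : ContinuousAt (fun τ : ℝ => M * τ ^ (1 - b)) 0 :=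
    continuousAt_const.mul (Real.continuousAt_rpow_const _ _ (Or.inr hb'.le))
  have h2 := ENNReal.tendsto_ofReal (h1.tendsto.mono_left (nhdsWithin_le_nhds (s := Ioi 0)))
  rw [Real.zero_rpow hb'.ne', mul_zero, ENNReal.ofReal_zero] at h2
  refine tendsto_of_tendsto_of_tendsto_of_le_of_le' tendsto_const_nhds h2
    (Eventually.of_forall fun _ => zero_le) ?_
  filter_upwards [self_mem_nhdsWithin] with τ hτ using hM τ hτ

theorem natCast_mul_inv_toReal_lt_one {r : ℝ≥0∞} (hr : (n : ℝ≥0∞) < r) :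
    (n : ℝ) * r.toReal⁻¹ < 1 := by
  rcases eq_or_ne r ∞ with rfl | hrt
  · simp
  · have h : (n : ℝ) < r.toReal := by
      simpa using (ENNReal.toReal_lt_toReal (ENNReal.natCast_ne_top n) hrt).2 hr
    have hr0 : 0 < r.toReal := (Nat.cast_nonneg n).trans_lt h
    rwa [← div_eq_mul_inv, div_lt_one hr0]

theorem distribFun_congr_ae {f g : Rn n → Rn n} (h : f =ᵐ[volume] g) :
    distribFun f = distribFun g := by
  funext y
  refine measure_congr ?_
  filter_upwards [h] with x hx
  exact congrArg (fun z => y < ‖z‖) hx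

theorem lorentzQuasinorm_congr_ae {p q : ℝ≥0∞} {f g : Rn n → Rn n} (h : f =ᵐ[volume] g) :
    lorentzQuasinorm p q f = lorentzQuasinorm p q g := by
  have h1 : rearrangement f = rearrangement g := by
    funext t
    rw [rearrangement, rearrangement, distribFun_congr_ae h]
  rw [lorentzQuasinorm, lorentzQuasinorm, h1]

theorem heatMap_congr_ae {f g : Rn n → Rn n} (h : f =ᵐ[volume] g) : heatMap f = heatMap g := by
  funext i t x
  refine integral_congr_ae ?_
  filter_upwards [h] with y hy
  rw [hy]

theorem isMildSolution_congr_ae {f g : Rn n → Rn n} (h : f =ᵐ[volume] g) :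
    IsMildSolution f = IsMildSolution g := by
  funext T u
  rw [IsMildSolution, IsMildSolution, heatMap_congr_ae h]

theorem maximalTime_congr_ae {f g : Rn n → Rn n} (h : f =ᵐ[volume] g) :
    maximalTime f = maximalTime g := by
  rw [maximalTime, maximalTime, isMildSolution_congr_ae h]

end

end LorentzNS

/-! ### The main theorem -/

open LorentzNS
theorem theorem2p7 (n : ℕ) (hn : 1 ≤ n) (p q : ℝ≥0∞) (hp : 1 < p) (hq : 1 ≤ q)
    (hpq : p = ∞ → q = ∞) (f : Rn n → Rn n) (hf : MemLorentz p q f)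
    (hfr : ∃ r : ℝ≥0∞, (n : ℝ≥0∞) < r ∧ MemLorentz r ∞ f) :
    -- the maximal time and the maximal solution are well defined
    0 < maximalTime f ∧
    ∃ u : ℝ → Rn n → Rn n,
      IsMildSolution f (maximalTime f) u ∧
      (∀ v : ℝ → Rn n → Rn n, IsMildSolution f (maximalTime f) v →
        ∀ t ∈ timeInterval (maximalTime f), v t = u t) ∧
      -- the maximal solution is a continuous map into the intersection of the two spaces
      (∀ t ∈ timeInterval (maximalTime f), MemLorentz p q (u t) ∧ supNorm (u t) < ∞) ∧
      (∀ t₀ ∈ timeInterval (maximalTime f),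
        Tendsto (fun t => lorentzQuasinorm p q (u t - u t₀)) (𝓝 t₀) (𝓝 0) ∧
        Tendsto (fun t => supNorm (u t - u t₀)) (𝓝 t₀) (𝓝 0)) ∧
      -- its Hölder seminorms are locally bounded in time
      (∀ α : ℝ≥0, 0 < α → α < 1 → ∀ t₀ ∈ timeInterval (maximalTime f),
        ∃ C : ℝ≥0, ∀ᶠ t in 𝓝 t₀, eHolderNorm α (u t) ≤ C) ∧
      -- the initial value is attained in the Lorentz space when the second index is finite
      (q < ∞ → Tendsto (fun t => lorentzQuasinorm p q (u t - f)) (𝓝[>] 0) (𝓝 0)) := by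
  obtain ⟨r, hnr, hr⟩ := hfr
  -- The datum enters the equation and the quasinorms only up to null sets, so it may be replaced by
  -- a Borel representative.
  set g := hf.1.mk f with hg
  have hfg : f =ᵐ[volume] g := hf.1.ae_eq_mk
  have hgm : Measurable g := hf.1.stronglyMeasurable_mk.measurable
  have hgpq : lorentzQuasinorm p q g < ∞ := lorentzQuasinorm_congr_ae hfg ▸ hf.2
  have hgr : lorentzQuasinorm r ∞ g < ∞ := lorentzQuasinorm_congr_ae hfg ▸ hr.2
  have hr1 : 1 < r := lt_of_le_of_lt (by exact_mod_cast hn) hnr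
  obtain ⟨M, hM0, hM⟩ := exists_kFun_le_rpow hr1 hgm hgr
  have hD := isDatum_of_kFun_le hgm hM0 (inv_nonneg.2 ENNReal.toReal_nonneg)
    (natCast_mul_inv_toReal_lt_one hnr) hM
  have hN := lorentzFun_kFun_ne_top hp hq hgm hgpq
  rw [maximalTime_congr_ae hfg, isMildSolution_congr_ae hfg]
  have hT := maximalTime_pos hD
  obtain ⟨u, hu⟩ := exists_maximal_solution hD
  have hloc := (isMildSolution_iff hD).1 hu
  refine ⟨hT, u, hu, fun v hv t ht => hv.unique hD hu ht, fun t ht => ?_, fun t₀ ht₀ => ?_,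
    fun α hα0 hα t₀ ht₀ => ?_, fun hqt => ?_⟩
  · obtain ⟨S, htS, hS, hST⟩ := exists_real_between ht
    exact ⟨(hloc S hS hST).memLorentz hD hq hN ht.1 htS, (hloc S hS hST).supNorm_lt_top ht.1 htS⟩
  · obtain ⟨S, htS, hS, hST⟩ := exists_real_between ht₀
    exact ⟨(hloc S hS hST).tendsto_lorentzQuasinorm hD hq hN ht₀.1 htS,
      (hloc S hS hST).tendsto_supNorm hD (tendsto_kFun_zero (inv_toReal_lt_one hr1) hM) ht₀.1 htS⟩
  · obtain ⟨S, htS, hS, hST⟩ := exists_real_between ht₀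
    exact (hloc S hS hST).eHolderNorm_le hD hM0.le hM hα0 hα ht₀.1 htS
  -- A finite q forces a finite p, which is what makes all level sets above positive heights have
  -- finite measure.
  · have hpt : p ≠ ∞ := fun h => hqt.ne (hpq h)
    obtain ⟨S, hS, hST⟩ : ∃ S : ℝ, 0 < S ∧ ENNReal.ofReal S < maximalTime g := by
      obtain ⟨s, hs0, hsT⟩ := exists_between hT
      exact ⟨s.toReal, ENNReal.toReal_pos hs0.ne' hsT.ne_top,
        by rwa [ENNReal.ofReal_toReal hsT.ne_top]⟩
    have h1 := (hloc S hS hST).tendsto_initial hD hp.le hpt hq hqt.ne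
      (fun y hy => distribFun_ne_top hp.le hpt hq hqt.ne hgpq hy) hN hS
    refine h1.congr fun t => lorentzQuasinorm_congr_ae ?_
    filter_upwards [hfg] with x hx
    simp only [Pi.sub_apply, hx]
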